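/- Let $V$ be a one-dimensional complex vector space with a hermitian norm $\|\cdot\|$, let $V^*$ be its dual and let $P=V\cup\{\infty\}$ be its projective compactification, with charts $V$ and $V^*=P\setminus\{0\}$ (a functional $\zeta\neq 0$ corresponds to the point $z\in V\setminus\{0\}$ with $\zeta(z)=1$, and $\zeta=0$ to $\infty$). A distributional $(1,q)$-form ($q=0,1$) on an open set $\Omega\subset V$ is called tempered if it extends to a distributional $(1,q)$-form on $P$; write $\mathcal{D}b^{t,1,q}_P(\Omega)$ for the space of these. For a closed set $Z\subset V$, let $\Gamma_Z(V,\mathcal{D}b^{t,1,q}_P)$ be the space of tempered distributional $(1,q)$-forms on $V$ whose restriction to $V\setminus Z$ is zero, and let $$H^1_Z(V,\Omega^t_P)=\Gamma_Z(V,\mathcal{D}b^{t,1,1}_P)\,/\,\bar\partial\,\Gamma_Z(V,\mathcal{D}b^{t,1,0}_P)$$ be the first cohomology space of the tempered Dolbeault complex with supports in $Z$. Let $\Omega^t_P(V)$ be the space of holomorphic $1$-forms on $V$ that are tempered. Let $K\subset V$ be a non-empty convex compact set and, for $\varepsilon>0$, let $K_\varepsilon=K+\{z\in V:\|z\|\le\varepsilon\}$.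 Let $\Omega^{t_\infty}_P(V\setminus K)$ be the space of holomorphic $1$-forms on $V\setminus K$ that are tempered at infinity, i.e. whose restriction to $\{z\in V:\|z\|>R\}$ is tempered for all sufficiently large $R$. The space $\Omega^t_P(V)$ maps to $\Omega^{t_\infty}_P(V\setminus K)$ by restriction, and for $\varepsilon\le\varepsilon'$ the inclusion $K_\varepsilon\subset K_{\varepsilon'}$ induces a map $H^1_{K_\varepsilon}(V,\Omega^t_P)\to H^1_{K_{\varepsilon'}}(V,\Omega^t_P)$. Then there is a unique isomorphism of complex vector spaces $$\Phi:\ \Omega^{t_\infty}_P(V\setminus K)/\Omega^t_P(V)\ \xrightarrow{\ \sim\ }\ \varprojlim_{\varepsilon\to0}H^1_{K_\varepsilon}(V,\Omega^t_P)$$ with the following two properties, for all $\varepsilon>0$ and all $\omega\in\Omega^{t_\infty}_P(V\setminus K)$. (1) (Canonicity: $\Phi$ is induced by the connecting maps of the excision sequences.) The form $\omega|_{V\setminus K_\varepsilon}$ has an extension to a tempered distributional $(1,0)$-form on $V$, and for each such extension $\eta$, one has $\bar\partial\eta\in\Gamma_{K_\varepsilon}(V,\mathcal{D}b^{t,1,1}_P)$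 and the image of $\Phi([\omega])$ in $H^1_{K_\varepsilon}(V,\Omega^t_P)$ is $[\bar\partial\eta]$. (2) If $\psi_\varepsilon:V\to\mathbb{R}$ is a $C^\infty$ function that is equal to $1$ on $V\setminus K_\varepsilon$ and to $0$ on $K_{\varepsilon/2}$, then $\bar\partial(\psi_\varepsilon\omega)\in\Gamma_{K_\varepsilon}(V,\mathcal{D}b^{t,1,1}_P)$ and the image of $\Phi([\omega])$ in $H^1_{K_\varepsilon}(V,\Omega^t_P)$ is $[\bar\partial(\psi_\varepsilon\omega)]$ (where $\psi_\varepsilon\omega$ is extended by zero to $K$). -/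

import Mathlib

set_option maxSynthPendingDepth 3

open scoped Distributions Pointwise
open TopologicalSpace

namespace TemperedForms

noncomputable section

/-! ### Currents

`V` is a complex normed space, of complex dimension one in the theorem.  Distributional forms are
realized as currents: a distributional `(1,0)`-form on `Ω` is a continuous linear functional on the
smooth compactly supported `(0,1)`-forms on `Ω` (a `(0,1)`-form is a function with values in the
conjugate-linear functionals on `V`), and a distributional `(1,1)`-form is a continuous linear
functional on the smooth compactly supported functions on `Ω`. -/

section Currents

variable {V : Type*} [NormedAddCommGroup V] [NormedSpace ℂ V]

/-- Distributional `(1,0)`-forms on `Ω`. -/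
abbrev Current10 (Ω : Opens V) : Type _ := 𝓓(Ω, V →L⋆[ℂ] ℂ) →L[ℂ] ℂ

/-- Distributional `(1,1)`-forms on `Ω`. -/
abbrev Current11 (Ω : Opens V) : Type _ := 𝓓(Ω, ℂ) →L[ℂ] ℂ

/-- Restriction of distributional `(1,0)`-forms from `V` to the open subset `Ω`. -/
def restrict10 (Ω : Opens V) : Current10 (⊤ : Opens V) →ₗ[ℂ] Current10 Ω where
  toFun T := T ∘L TestFunction.monoCLM ℂ
  map_add' _ _ := rfl
  map_smul' _ _ := rfl

/-- Restriction of distributional `(1,1)`-forms from `V` to the open subset `Ω`. -/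
def restrict11 (Ω : Opens V) : Current11 (⊤ : Opens V) →ₗ[ℂ] Current11 Ω where
  toFun T := T ∘L TestFunction.monoCLM ℂ
  map_add' _ _ := rfl
  map_smul' _ _ := rfl

/-- The conjugate-linear part `v ↦ (L v + i L (i v)) / 2` of a real-linear functional `L`. -/
def conjPartAux (L : V →L[ℝ] ℂ) : V →L⋆[ℂ] ℂ where
  toFun v := (L v + Complex.I * L (Complex.I • v)) / 2
  map_add' v w := by simp only [smul_add, map_add]; ring
  map_smul' c v := by
    have h1 : c • v = c.re • v + c.im • (Complex.I • v) := by
      conv_lhs => rw [← Complex.re_add_im c, add_smul, mul_smul]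
      simp only [Complex.coe_smul]
    have h2 : Complex.I • c • v = c.re • (Complex.I • v) - c.im • v := by
      rw [h1, smul_add, smul_comm Complex.I c.re, smul_comm Complex.I c.im,
        smul_smul Complex.I Complex.I, Complex.I_mul_I, neg_one_smul, smul_neg,
        sub_eq_add_neg]
    rw [h2, h1]
    simp only [map_add, map_sub, map_smul, Complex.real_smul, smul_eq_mul]
    have h3 : (starRingEnd ℂ) c = c.re - c.im * Complex.I := by
      apply Complex.ext <;> simp
    rw [h3]
    linear_combination (c.im * L (Complex.I • v) / 2) * Complex.I_sq
  cont := by fun_prop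

/-- Taking the conjugate-linear part of a real-linear functional, as a continuous linear map. -/
def conjPart : (V →L[ℝ] ℂ) →L[ℂ] (V →L⋆[ℂ] ℂ) :=
  LinearMap.mkContinuous
    { toFun := conjPartAux
      map_add' := fun L M => by
        ext v
        change (L v + M v + Complex.I * (L _ + M _)) / 2 =
          (L v + Complex.I * L _) / 2 + (M v + Complex.I * M _) / 2
        ring
      map_smul' := fun c L => by
        ext v
        change (c * L v + Complex.I * (c * L _)) / 2 = c * ((L v + Complex.I * L _) / 2)
        ring } 1 (fun L => by
      rw [one_mul]
      refine ContinuousLinearMap.opNorm_le_bound _ (norm_nonneg _) fun v => ?_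
      change ‖(L v + Complex.I * L (Complex.I • v)) / 2‖ ≤ ‖L‖ * ‖v‖
      have h1 := L.le_opNorm v
      have h2 := L.le_opNorm (Complex.I • v)
      rw [norm_smul, Complex.norm_I, one_mul] at h2
      have h3 := norm_add_le (L v) (Complex.I * L (Complex.I • v))
      rw [norm_mul, Complex.norm_I, one_mul] at h3
      rw [norm_div, Complex.norm_ofNat]
      linarith)

theorem conjPart_apply (L : V →L[ℝ] ℂ) (v : V) :
    conjPart L v = (L v + Complex.I * L (Complex.I • v)) / 2 := rfl

/-- The Cauchy-Riemann operator `∂̄` from test functions to `(0,1)`-test forms. -/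
def dbarTest (Ω : Opens V) : 𝓓(Ω, ℂ) →L[ℂ] 𝓓(Ω, V →L⋆[ℂ] ℂ) :=
  TestFunction.postcompCLM conjPart ∘L TestFunction.fderivCLM ℂ ⊤ ⊤

theorem dbarTest_apply (Ω : Opens V) (φ : 𝓓(Ω, ℂ)) (z : V) :
    dbarTest Ω φ z = conjPart (fderiv ℝ φ z) := by
  change conjPart (TestFunction.fderivCLM ℂ ⊤ ⊤ φ z) = _
  rw [TestFunction.fderivCLM_apply_of_le φ (by simp)]

/-- The operator `∂̄` from distributional `(1,0)`-forms to distributional `(1,1)`-forms.  The sign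
is the one for which `⟨∂̄ω, φ⟩ = ∫ φ ∂̄ω = ∫ ω ∧ ∂̄φ` holds for smooth `ω`. -/
def dbar (Ω : Opens V) : Current10 Ω →ₗ[ℂ] Current11 Ω where
  toFun T := T ∘L dbarTest Ω
  map_add' _ _ := rfl
  map_smul' _ _ := rfl

/-! ### Tempered distributional forms

If `V` is a complex line, its projective compactification `P = V ∪ {∞}` is covered by the two
charts `V` and `P ∖ {0}`; the second one is identified with the dual line `V*`, a functional
`ζ ≠ 0` corresponding to the point `z ∈ V ∖ {0}` with `ζ z = 1` and `ζ = 0` to `∞`.  (In a linear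
coordinate this is `ζ = 1 / z`.)  A distributional form on `P` is a pair of distributional forms
on the two charts which correspond to each other on the overlap. -/

/-- `T` on `V` and `S` on the chart `V*` at infinity are the two restrictions of a distributional
`(1,0)`-form on `P`: they take the same values on test forms supported in the overlap and
corresponding to each other.  The differential at `z` of the change of charts is
`v ↦ -(ζ v) • ζ`, where `ζ z = 1`. -/
def Glue10 (T : Current10 (⊤ : Opens V)) (S : Current10 (⊤ : Opens (StrongDual ℂ V))) : Prop :=
  ∀ (χ : 𝓓((⊤ : Opens V), V →L⋆[ℂ] ℂ))
    (φ : 𝓓((⊤ : Opens (StrongDual ℂ V)), StrongDual ℂ V →L⋆[ℂ] ℂ)),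
    0 ∉ tsupport χ → 0 ∉ tsupport φ →
    (∀ (z : V) (ζ : StrongDual ℂ V), ζ z = 1 → ∀ v : V, χ z v = φ ζ (-(ζ v) • ζ)) → T χ = S φ

/-- `T` on `V` and `S` on the chart `V*` at infinity are the two restrictions of a distributional
`(1,1)`-form on `P`. -/
def Glue11 (T : Current11 (⊤ : Opens V)) (S : Current11 (⊤ : Opens (StrongDual ℂ V))) : Prop :=
  ∀ (χ : 𝓓((⊤ : Opens V), ℂ)) (φ : 𝓓((⊤ : Opens (StrongDual ℂ V)), ℂ)),
    0 ∉ tsupport χ → 0 ∉ tsupport φ →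
    (∀ (z : V) (ζ : StrongDual ℂ V), ζ z = 1 → χ z = φ ζ) → T χ = S φ

/-- Tempered distributional `(1,0)`-forms on `Ω ⊆ V`: those that extend to `P`. -/
def Tempered10 (Ω : Opens V) : Submodule ℂ (Current10 Ω) where
  carrier := {T | ∃ T₀ S, Glue10 T₀ S ∧ restrict10 Ω T₀ = T}
  add_mem' := by
    rintro _ _ ⟨T₁, S₁, h₁, rfl⟩ ⟨T₂, S₂, h₂, rfl⟩
    refine ⟨T₁ + T₂, S₁ + S₂, fun χ φ hχ hφ h => ?_, map_add _ _ _⟩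
    simp only [add_apply, h₁ χ φ hχ hφ h, h₂ χ φ hχ hφ h]
  zero_mem' := ⟨0, 0, fun _ _ _ _ _ => rfl, map_zero _⟩
  smul_mem' := by
    rintro c _ ⟨T₁, S₁, h₁, rfl⟩
    refine ⟨c • T₁, c • S₁, fun χ φ hχ hφ h => ?_, map_smul _ _ _⟩
    simp only [smul_apply, h₁ χ φ hχ hφ h]

/-- Tempered distributional `(1,1)`-forms on `Ω ⊆ V`: those that extend to `P`. -/
def Tempered11 (Ω : Opens V) : Submodule ℂ (Current11 Ω) where
  carrier := {T | ∃ T₀ S, Glue11 T₀ S ∧ restrict11 Ω T₀ = T}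
  add_mem' := by
    rintro _ _ ⟨T₁, S₁, h₁, rfl⟩ ⟨T₂, S₂, h₂, rfl⟩
    refine ⟨T₁ + T₂, S₁ + S₂, fun χ φ hχ hφ h => ?_, map_add _ _ _⟩
    simp only [add_apply, h₁ χ φ hχ hφ h, h₂ χ φ hχ hφ h]
  zero_mem' := ⟨0, 0, fun _ _ _ _ _ => rfl, map_zero _⟩
  smul_mem' := by
    rintro c _ ⟨T₁, S₁, h₁, rfl⟩
    refine ⟨c • T₁, c • S₁, fun χ φ hχ hφ h => ?_, map_smul _ _ _⟩
    simp only [smul_apply, h₁ χ φ hχ hφ h]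

theorem tsupport_dbarTest (Ω : Opens V) (φ : 𝓓(Ω, ℂ)) : tsupport (dbarTest Ω φ) ⊆ tsupport φ := by
  have h : (dbarTest Ω φ : V → V →L⋆[ℂ] ℂ) = conjPart ∘ fderiv ℝ φ :=
    funext fun z => dbarTest_apply Ω φ z
  rw [h]
  exact (tsupport_comp_subset (map_zero _) _).trans (tsupport_fderiv_subset ℝ)

/-- `∂̄` is compatible with the change of charts. -/
theorem Glue10.dbar {T : Current10 (⊤ : Opens V)} {S : Current10 (⊤ : Opens (StrongDual ℂ V))}
    (h : Glue10 T S) : Glue11 (dbar ⊤ T) (dbar ⊤ S) := by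
  intro χ φ hχ hφ hχφ
  refine h (dbarTest ⊤ χ) (dbarTest ⊤ φ) (fun h0 => hχ (tsupport_dbarTest _ _ h0))
    (fun h0 => hφ (tsupport_dbarTest _ _ h0)) ?_
  intro z ζ hz v
  have hne : ζ z ≠ 0 := by rw [hz]; exact one_ne_zero
  have hι : HasFDerivAt (𝕜 := ℝ) (fun z' : V => (ζ z')⁻¹ • ζ)
      ((-(ζ.restrictScalars ℝ)).smulRight ζ) z := by
    have h1 : HasFDerivAt (𝕜 := ℂ) (fun z' : V => (ζ z')⁻¹) (-ζ) z := by
      have h2 := (hasDerivAt_inv hne).comp_hasFDerivAt z ζ.hasFDerivAt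
      simpa [hz, Function.comp_def, neg_one_smul] using h2
    exact (h1.smul_const ζ).restrictScalars ℝ
  have hφd : DifferentiableAt ℝ φ ((ζ z)⁻¹ • ζ) :=
    (φ.contDiff.differentiable (by simp)).differentiableAt
  have hcomp := hφd.hasFDerivAt.comp z hι
  have hev : (χ : V → ℂ) =ᶠ[nhds z] (φ : StrongDual ℂ V → ℂ) ∘ fun z' => (ζ z')⁻¹ • ζ := by
    filter_upwards [ζ.continuous.continuousAt.eventually_ne hne] with z' hz'
    exact hχφ z' _ (by simp [hz'])
  have hd := (hcomp.congr_of_eventuallyEq hev).fderiv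
  simp only [dbarTest_apply, conjPart_apply, hd]
  simp [hz, smul_smul]

/-! ### The cohomology `H¹_Z(V, Ωᵗ_P)` -/

/-- Tempered distributional `(1,0)`-forms on `V` supported in `Z`. -/
def Supported10 (Z : Closeds V) : Submodule ℂ (Current10 (⊤ : Opens V)) where
  carrier := {T | T ∈ Tempered10 ⊤ ∧ restrict10 Z.compl T = 0}
  add_mem' h₁ h₂ := ⟨add_mem h₁.1 h₂.1, by rw [map_add, h₁.2, h₂.2, add_zero]⟩
  zero_mem' := ⟨zero_mem _, map_zero _⟩
  smul_mem' c _ h := ⟨Submodule.smul_mem _ c h.1, by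
    rw [map_smul, h.2]; exact smul_zero c⟩

/-- Tempered distributional `(1,1)`-forms on `V` supported in `Z`. -/
def Supported11 (Z : Closeds V) : Submodule ℂ (Current11 (⊤ : Opens V)) where
  carrier := {T | T ∈ Tempered11 ⊤ ∧ restrict11 Z.compl T = 0}
  add_mem' h₁ h₂ := ⟨add_mem h₁.1 h₂.1, by rw [map_add, h₁.2, h₂.2, add_zero]⟩
  zero_mem' := ⟨zero_mem _, map_zero _⟩
  smul_mem' c _ h := ⟨Submodule.smul_mem _ c h.1, by
    rw [map_smul, h.2]; exact smul_zero c⟩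

theorem restrict10_top (T : Current10 (⊤ : Opens V)) : restrict10 ⊤ T = T := by
  ext φ
  change T _ = T φ
  congr 1
  ext z : 1
  simp

theorem restrict11_top (T : Current11 (⊤ : Opens V)) : restrict11 ⊤ T = T := by
  ext φ
  change T _ = T φ
  congr 1
  ext z : 1
  simp

theorem restrict11_dbar (Ω : Opens V) (T : Current10 (⊤ : Opens V)) :
    restrict11 Ω (dbar ⊤ T) = dbar Ω (restrict10 Ω T) := by
  ext φ
  change T _ = T _
  congr 1
  ext z : 1
  simp [dbarTest_apply]

theorem dbar_mem_supported (Z : Closeds V) {T : Current10 (⊤ : Opens V)} (hT : T ∈ Supported10 Z) :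
    dbar ⊤ T ∈ Supported11 Z := by
  obtain ⟨⟨T₀, S, hS, rfl⟩, h0⟩ := hT
  rw [restrict10_top] at h0 ⊢
  exact ⟨⟨dbar ⊤ T₀, dbar ⊤ S, hS.dbar, restrict11_top _⟩, by rw [restrict11_dbar, h0, map_zero]⟩

/-- The differential `Γ_Z(V, Dbᵗ^{1,0}) → Γ_Z(V, Dbᵗ^{1,1})` of the tempered Dolbeault complex with
supports in `Z`.  As `V` is a complex line, these are the only two terms of this complex, in degrees
`0` and `1`. -/
def dbarSupported (Z : Closeds V) : Supported10 Z →ₗ[ℂ] Supported11 Z :=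
  (dbar ⊤).restrict fun _ hT => dbar_mem_supported Z hT

/-- `H¹_Z(V, Ωᵗ_P)`: the first cohomology of the tempered Dolbeault complex of `(1,•)`-forms with
supports in `Z`.  (The subanalytic sheaves of tempered distributional forms are quasi-injective, so
their sections with supports compute the derived sections with supports of `Ωᵗ_P`.) -/
abbrev H1 (Z : Closeds V) : Type _ := Supported11 Z ⧸ LinearMap.range (dbarSupported Z)

theorem restrict10_eq_zero_mono {Z Z' : Closeds V} (h : Z ≤ Z') {T : Current10 (⊤ : Opens V)}
    (hT : restrict10 Z.compl T = 0) : restrict10 Z'.compl T = 0 := by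
  have hle : Z'.compl ≤ Z.compl := Set.compl_subset_compl.2 h
  ext φ
  have h1 := DFunLike.congr_fun hT (TestFunction.monoCLM ℂ φ)
  refine Eq.trans ?_ h1
  change T _ = T _
  congr 1
  ext z : 1
  simp [hle]

theorem restrict11_eq_zero_mono {Z Z' : Closeds V} (h : Z ≤ Z') {T : Current11 (⊤ : Opens V)}
    (hT : restrict11 Z.compl T = 0) : restrict11 Z'.compl T = 0 := by
  have hle : Z'.compl ≤ Z.compl := Set.compl_subset_compl.2 h
  ext φ
  have h1 := DFunLike.congr_fun hT (TestFunction.monoCLM ℂ φ)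
  refine Eq.trans ?_ h1
  change T _ = T _
  congr 1
  ext z : 1
  simp [hle]

theorem supported11_mono {Z Z' : Closeds V} (h : Z ≤ Z') : Supported11 Z ≤ Supported11 Z' :=
  fun _ hT => ⟨hT.1, restrict11_eq_zero_mono h hT.2⟩

/-- The map `H¹_Z → H¹_{Z'}` induced by an inclusion `Z ⊆ Z'`. -/
def H1.map {Z Z' : Closeds V} (h : Z ≤ Z') : H1 Z →ₗ[ℂ] H1 Z' :=
  Submodule.mapQ _ _ (Submodule.inclusion (supported11_mono h)) <| by
    rintro _ ⟨T, rfl⟩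
    exact ⟨⟨T.1, T.2.1, restrict10_eq_zero_mono h T.2.2⟩, rfl⟩

/-- The closed thickening `K_ε = K + D̄(0, ε)`. -/
def thick (K : Compacts V) (ε : ℝ) : Closeds V :=
  ⟨(K : Set V) + Metric.closedBall 0 ε,
    IsClosed.add_left_of_isCompact Metric.isClosed_closedBall K.isCompact⟩

theorem thick_mono (K : Compacts V) {ε ε' : ℝ} (h : ε ≤ ε') : thick K ε ≤ thick K ε' :=
  Set.add_subset_add_left (Metric.closedBall_subset_closedBall h)

/-- The projective limit of `H¹_{K_ε}(V, Ωᵗ_P)` for `ε → 0`, `ε > 0`: compatible families. -/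
def limH1 (K : Compacts V) : Submodule ℂ (∀ ε : Set.Ioi (0 : ℝ), H1 (thick K ε)) where
  carrier := {c | ∀ (ε ε' : Set.Ioi (0 : ℝ)) (h : (ε : ℝ) ≤ ε'),
    H1.map (thick_mono K h) (c ε) = c ε'}
  add_mem' h₁ h₂ ε ε' h := by simp only [Pi.add_apply, map_add, h₁ ε ε' h, h₂ ε ε' h]
  zero_mem' _ _ _ := map_zero _
  smul_mem' c _ h₁ ε ε' h := by simp only [Pi.smul_apply, map_smul, h₁ ε ε' h]

end Currents

/-! ### Holomorphic forms -/

section Forms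

variable {V : Type*} [NormedAddCommGroup V] [NormedSpace ℂ V]

/-- Holomorphic `1`-forms on `Ω`; a form is encoded as a function on `V` that vanishes
outside `Ω`. -/
def HolForm (Ω : Opens V) : Submodule ℂ (V → StrongDual ℂ V) where
  carrier := {ω | DifferentiableOn ℂ ω Ω ∧ ∀ z ∉ Ω, ω z = 0}
  add_mem' h₁ h₂ := ⟨h₁.1.add h₂.1, fun z hz => by rw [Pi.add_apply, h₁.2 z hz, h₂.2 z hz, add_zero]⟩
  zero_mem' := ⟨differentiableOn_const 0, fun _ _ => rfl⟩
  smul_mem' c _ h := ⟨h.1.const_smul c, fun z hz => by rw [Pi.smul_apply, h.2 z hz, smul_zero]⟩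

/-- Restriction of forms to `Ω`, in the encoding by functions vanishing outside the domain. -/
def restrictForm (Ω : Opens V) : (V → StrongDual ℂ V) →ₗ[ℂ] (V → StrongDual ℂ V) where
  toFun ω := (Ω : Set V).indicator ω
  map_add' ω ω' := Set.indicator_add _ ω ω'
  map_smul' c ω := Set.indicator_const_smul _ c ω

variable (V) in
/-- A nonzero vector `e` of a complex line, as a basis. -/
def lineBasis [h : Fact (Module.finrank ℂ V = 1)] : Module.Basis (Fin 1) ℂ V :=
  haveI : FiniteDimensional ℂ V := Module.finite_of_finrank_eq_succ h.out
  Module.finBasisOfFinrankEq ℂ V h.out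

/-- The value `(ω ∧ φ)(e, ie)` for a `(1,0)`-covector `ω` and a `(0,1)`-covector `φ`. -/
def wedge (e : V) : (V →L⋆[ℂ] ℂ) →L[ℂ] StrongDual ℂ V →L[ℂ] ℂ :=
  (ContinuousLinearMap.mul ℂ ℂ).bilinearComp
      (ContinuousLinearMap.apply' ℂ (starRingEnd ℂ) (Complex.I • e))
      (ContinuousLinearMap.apply' ℂ (RingHom.id ℂ) e) -
    (ContinuousLinearMap.mul ℂ ℂ).bilinearComp
      (ContinuousLinearMap.apply' ℂ (starRingEnd ℂ) e)
      (ContinuousLinearMap.apply' ℂ (RingHom.id ℂ) (Complex.I • e))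

theorem wedge_apply (e : V) (φ : V →L⋆[ℂ] ℂ) (ω : StrongDual ℂ V) :
    wedge e φ ω = φ (Complex.I • e) * ω e - φ e * ω (Complex.I • e) := rfl

variable [MeasurableSpace V] [BorelSpace V] [Fact (Module.finrank ℂ V = 1)]

/-- The distributional `(1,0)`-form `φ ↦ ∫ ω ∧ φ` attached to a (locally integrable) `(1,0)`-form
`ω`.  The integral over `V` with its complex orientation is computed in the oriented real basis
`(e, ie)`, with the Lebesgue measure for which this basis spans a parallelogram of area one. -/
def formCurrent (Ω : Opens V) (ω : V → StrongDual ℂ V) : Current10 Ω :=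
  TestFunction.integralAgainstBilinCLM (wedge (lineBasis V 0))
    (Complex.basisOneI.smulTower (lineBasis V)).addHaar ω

theorem HolForm.locallyIntegrableOn {Ω Ω' : Opens V} (h : Ω' ≤ Ω) {ω : V → StrongDual ℂ V}
    (hω : ω ∈ HolForm Ω) :
    MeasureTheory.LocallyIntegrableOn ω (Ω' : Set V)
      (Complex.basisOneI.smulTower (lineBasis V)).addHaar := by
  have : FiniteDimensional ℝ V :=
    (Complex.basisOneI.smulTower (lineBasis V)).finiteDimensional_of_finite
  have : ProperSpace V := FiniteDimensional.proper_real V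
  exact (hω.1.continuousOn.mono h).locallyIntegrableOn Ω'.isOpen.measurableSet

theorem formCurrent_apply {Ω : Opens V} {ω : V → StrongDual ℂ V}
    (h : MeasureTheory.LocallyIntegrableOn ω (Ω : Set V)
      (Complex.basisOneI.smulTower (lineBasis V)).addHaar) (φ : 𝓓(Ω, V →L⋆[ℂ] ℂ)) :
    formCurrent Ω ω φ = ∫ z, wedge (lineBasis V 0) (φ z) (ω z)
      ∂(Complex.basisOneI.smulTower (lineBasis V)).addHaar :=
  TestFunction.integralAgainstBilinCLM_eq_integral h

theorem formCurrent_add {Ω : Opens V} {ω ω' : V → StrongDual ℂ V}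
    (hω : ω ∈ HolForm Ω) (hω' : ω' ∈ HolForm Ω) {Ω' : Opens V} (h : Ω' ≤ Ω) :
    formCurrent Ω' (ω + ω') = formCurrent Ω' ω + formCurrent Ω' ω' := by
  have h₁ := HolForm.locallyIntegrableOn h hω
  have h₂ := HolForm.locallyIntegrableOn h hω'
  ext φ
  rw [add_apply, formCurrent_apply h₁, formCurrent_apply h₂,
    formCurrent_apply (HolForm.locallyIntegrableOn h (add_mem hω hω')),
    ← MeasureTheory.integral_add (TestFunction.integrable_bilin _ h₁ φ)
      (TestFunction.integrable_bilin _ h₂ φ)]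
  simp only [Pi.add_apply, map_add]

theorem formCurrent_smul {Ω : Opens V} (c : ℂ) {ω : V → StrongDual ℂ V}
    (hω : ω ∈ HolForm Ω) {Ω' : Opens V} (h : Ω' ≤ Ω) :
    formCurrent Ω' (c • ω) = c • formCurrent Ω' ω := by
  ext φ
  rw [smul_apply, formCurrent_apply (HolForm.locallyIntegrableOn h hω),
    formCurrent_apply (HolForm.locallyIntegrableOn h (Submodule.smul_mem _ c hω)),
    ← MeasureTheory.integral_smul]
  simp only [Pi.smul_apply, map_smul]

variable (V) in
/-- `Ωᵗ_P(V)`: holomorphic `1`-forms on `V` that are tempered. -/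
def TemperedHolForm : Submodule ℂ (V → StrongDual ℂ V) where
  carrier := {ω | ω ∈ HolForm ⊤ ∧ formCurrent ⊤ ω ∈ Tempered10 ⊤}
  add_mem' h₁ h₂ := ⟨add_mem h₁.1 h₂.1, by
    rw [formCurrent_add h₁.1 h₂.1 le_rfl]; exact add_mem h₁.2 h₂.2⟩
  zero_mem' := ⟨zero_mem _, by
    have h := formCurrent_smul (V := V) (Ω := ⊤) 0 (zero_mem _) le_rfl
    rw [zero_smul, zero_smul] at h
    rw [h]; exact zero_mem _⟩
  smul_mem' c _ h := ⟨Submodule.smul_mem _ c h.1, by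
    rw [formCurrent_smul c h.1 le_rfl]; exact Submodule.smul_mem _ c h.2⟩

/-- The complement of the closed ball of radius `R`; these sets, together with `∞`, form a basis of
neighbourhoods of `∞` in `P`. -/
def nearInfinity (V : Type*) [NormedAddCommGroup V] (R : ℝ) : Opens V :=
  ⟨(Metric.closedBall 0 R)ᶜ, Metric.isClosed_closedBall.isOpen_compl⟩

/-- The open set `V ∖ K`. -/
def complOpens {V : Type*} [NormedAddCommGroup V] (K : Compacts V) : Opens V :=
  ⟨(K : Set V)ᶜ, K.isCompact.isClosed.isOpen_compl⟩

theorem eventually_nearInfinity_le (K : Compacts V) :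
    ∀ᶠ R in Filter.atTop, nearInfinity V R ≤ complOpens K := by
  obtain ⟨r, hr⟩ := K.isCompact.isBounded.subset_closedBall (0 : V)
  filter_upwards [Filter.eventually_ge_atTop r] with R hR
  exact Set.compl_subset_compl.2 (hr.trans (Metric.closedBall_subset_closedBall hR))

/-- `Ω^{t∞}_P(V ∖ K)`: holomorphic `1`-forms on `V ∖ K` that are tempered at infinity, that is,
whose restrictions to all small enough neighbourhoods of `∞` are tempered. -/
def TemperedAtInftyHolForm (K : Compacts V) : Submodule ℂ (V → StrongDual ℂ V) where
  carrier := {ω | ω ∈ HolForm (complOpens K) ∧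
    ∀ᶠ R in Filter.atTop, formCurrent (nearInfinity V R) ω ∈ Tempered10 (nearInfinity V R)}
  add_mem' h₁ h₂ := ⟨add_mem h₁.1 h₂.1, by
    filter_upwards [h₁.2, h₂.2, eventually_nearInfinity_le K] with R hR₁ hR₂ hR
    rw [formCurrent_add h₁.1 h₂.1 hR]; exact add_mem hR₁ hR₂⟩
  zero_mem' := ⟨zero_mem _, by
    filter_upwards [eventually_nearInfinity_le K] with R hR
    have h := formCurrent_smul (V := V) 0 (zero_mem _) hR
    rw [zero_smul, zero_smul] at h
    rw [h]; exact zero_mem _⟩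
  smul_mem' c _ h := ⟨Submodule.smul_mem _ c h.1, by
    filter_upwards [h.2, eventually_nearInfinity_le K] with R hR₁ hR
    rw [formCurrent_smul c h.1 hR]; exact Submodule.smul_mem _ c hR₁⟩

theorem restrictForm_mem_holForm (Ω : Opens V) {ω : V → StrongDual ℂ V} (hω : ω ∈ HolForm ⊤) :
    restrictForm Ω ω ∈ HolForm Ω :=
  ⟨(hω.1.mono fun _ _ => trivial).congr fun _ hz => Set.indicator_of_mem hz ω,
    fun _ hz => Set.indicator_of_notMem hz ω⟩

theorem restrictForm_mem (K : Compacts V) {ω : V → StrongDual ℂ V} (hω : ω ∈ TemperedHolForm V) :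
    restrictForm (complOpens K) ω ∈ TemperedAtInftyHolForm K := by
  refine ⟨restrictForm_mem_holForm _ hω.1, ?_⟩
  filter_upwards [eventually_nearInfinity_le K] with R hR
  obtain ⟨T, S, hTS, hT⟩ := hω.2
  refine ⟨T, S, hTS, ?_⟩
  rw [restrict10_top] at hT
  ext φ
  rw [hT, formCurrent_apply (HolForm.locallyIntegrableOn hR (restrictForm_mem_holForm _ hω.1))]
  change formCurrent ⊤ ω (TestFunction.monoCLM ℂ φ) = _
  rw [formCurrent_apply (HolForm.locallyIntegrableOn le_rfl hω.1)]
  refine MeasureTheory.integral_congr_ae (Filter.Eventually.of_forall fun z => ?_)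
  by_cases hz : z ∈ complOpens K
  · simp [restrictForm, hz]
  · have h0 : φ z = 0 :=
      image_eq_zero_of_notMem_tsupport fun h => hz (hR (φ.tsupport_subset h))
    simp [h0]

/-- The restriction map `Ωᵗ_P(V) → Ω^{t∞}_P(V ∖ K)`. -/
def restrictTempered (K : Compacts V) : TemperedHolForm V →ₗ[ℂ] TemperedAtInftyHolForm K :=
  (restrictForm (complOpens K)).restrict fun _ hω => restrictForm_mem K hω

/-- The quotient `Ω^{t∞}_P(V ∖ K) / Ωᵗ_P(V)`. -/
abbrev FormQuotient (K : Compacts V) : Type _ :=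
  TemperedAtInftyHolForm K ⧸ LinearMap.range (restrictTempered K)

end Forms

end

end TemperedForms

open TemperedForms

/-! The connecting map sends `ω` to the class of `∂̄η`, where `η` is any distribution on `V` that
agrees with `ω` off `K_ε`; a cutoff function supplies one. Two extensions differ by a distribution
supported in `K_ε`, so the class is well defined. Temperedness of `η` is automatic: near infinity
`η` agrees with a form that extends to `P`, and a compactly supported distribution always extends to
`P` (`SuppIn.exists_glueC`, `mem_tempered10_of_restrict10_nearInfinity_eq`). What has to be proved
is that the kernel is the space of entire tempered forms and that every compatible family is
reached.

Kernel. If `∂̄η = ∂̄τ` with `τ` supported in `K_ε`, then `η - τ` is `∂̄`-closed on `V` and agrees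
with `ω` off `K_ε`. By Weyl's lemma (`exists_holomorphic_of_dzbar_eq_zero`) it is an entire form.
The identity theorem shows that this form does not depend on `ε`, so it extends `ω` from the union
of the `V ∖ K_ε`, which is `V ∖ K`.

Image. In a linear coordinate let `P` be convolution with the fundamental solution `1 / (π t)`, so
that `∂̄P = P∂̄ = id` on test functions. For `u` supported in `K_ε`, the functional `η = u ∘ P`
satisfies `∂̄η = u`; as `Pφ` is not compactly supported, it is multiplied by a cutoff `κ` equal to
`1` near `K_ε`, which `u` does not see. By Weyl's lemma `η` is holomorphic off `K_ε`, and near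
infinity it is a Cauchy integral of size `O(1/|x|)`. This decay makes it tempered: in the chart `w =
1 / x` the coefficient becomes `O(1/|w|)`, which is locally integrable (`exists_glueC_intTest`,
`SuppIn.exists_glueC_cutTransform`).

This primitive also settles the passage to the limit. If `u - u' = ∂̄τ` with `τ` supported in
`K_ε'`, then `u ∘ P - u' ∘ P = τ`, which vanishes off `K_ε'`. Hence the holomorphic part off `K_ε`
depends only on the class of `u`, and for a compatible family of classes these parts agree where
they overlap, whatever representatives are chosen. They glue to a form on `V ∖ K`
(`exists_holForm_of_compatible`), and no correction of representatives is needed. -/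

namespace TemperedForms

/-! ### Seminorm estimates for distributions and for operators on test functions. -/

section TestFunctions

variable {E : Type*} [NormedAddCommGroup E] [NormedSpace ℝ E]
  {E' : Type*} [NormedAddCommGroup E'] [NormedSpace ℝ E']

/-- A distribution has finite order on test functions supported in a compact set. -/
theorem exists_bound_of_compact (T : 𝓓((⊤ : Opens E), ℂ) →L[ℂ] ℂ) (K : Compacts E) :
    ∃ (C : ℝ) (N : ℕ), 0 ≤ C ∧ ∀ (φ : 𝓓((⊤ : Opens E), ℂ)) (M : ℝ), tsupport φ ⊆ K →
      (∀ i ≤ N, ∀ x, ‖iteratedFDeriv ℝ i φ x‖ ≤ M) → ‖T φ‖ ≤ C * M := by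
  have hsub : (K : Set E) ⊆ (⊤ : Opens E) := fun _ _ => trivial
  let TK : 𝓓_{K}(E, ℂ) →L[ℂ] ℂ := T ∘L TestFunction.ofSupportedInCLM ℂ hsub
  obtain ⟨s, C, hC, h⟩ := Seminorm.bound_of_continuous
    (ContDiffMapSupportedIn.withSeminorms ℂ E ℂ ⊤ K)
    ((normSeminorm ℂ ℂ).comp TK.toLinearMap) (by exact TK.continuous.norm)
  refine ⟨C, s.sup id, C.2, fun φ M hφ hM => ?_⟩
  let φK : 𝓓_{K}(E, ℂ) := .of_support_subset φ.contDiff (subset_closure.trans hφ)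
  have h1 : TK φK = T φ := by
    change T _ = T _
    congr 1
  have h2 := h φK
  change ‖TK φK‖ ≤ C * _ at h2
  rw [h1] at h2
  refine h2.trans (mul_le_mul_of_nonneg_left ?_ C.2)
  have hM0 : 0 ≤ M := (norm_nonneg _).trans (hM 0 (Nat.zero_le _) 0)
  refine Seminorm.finset_sup_apply_le hM0 fun i hi => ?_
  rw [ContDiffMapSupportedIn.seminorm_top_le_iff ℂ hM0]
  exact fun x _ => hM i (Finset.le_sup (f := id) hi) x

/-- An operator between spaces of test functions which satisfies `C^n` estimates is continuous. -/
theorem exists_clm_of_bound (A : 𝓓((⊤ : Opens E), ℂ) → 𝓓((⊤ : Opens E'), ℂ))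
    (hadd : ∀ f g, A (f + g) = A f + A g) (hsmul : ∀ (c : ℂ) f, A (c • f) = c • A f)
    (hb : ∀ K : Compacts E, ∃ K' : Compacts E',
      (∀ φ : 𝓓((⊤ : Opens E), ℂ), tsupport φ ⊆ K → tsupport (A φ) ⊆ K') ∧
      ∀ n : ℕ, ∃ C : ℝ, 0 ≤ C ∧ ∀ (φ : 𝓓((⊤ : Opens E), ℂ)) (M : ℝ), tsupport φ ⊆ K →
        (∀ i ≤ n, ∀ x, ‖iteratedFDeriv ℝ i φ x‖ ≤ M) →
        ∀ x ∈ K', ‖iteratedFDeriv ℝ n (A φ) x‖ ≤ C * M) :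
    ∃ L : 𝓓((⊤ : Opens E), ℂ) →L[ℂ] 𝓓((⊤ : Opens E'), ℂ), ∀ φ, L φ = A φ := by
  refine ⟨TestFunction.mkCLM ℂ A hadd hsmul fun K hK => ?_, fun φ => rfl⟩
  obtain ⟨K', hsupp, hbd⟩ := hb K
  have hsub : (K' : Set E') ⊆ (⊤ : Opens E') := fun _ _ => trivial
  let j : 𝓓_{K}(E, ℂ) → 𝓓((⊤ : Opens E), ℂ) := TestFunction.ofSupportedIn hK
  let B : 𝓓_{K}(E, ℂ) →ₗ[ℂ] 𝓓_{K'}(E', ℂ) :=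
    { toFun := fun f => ⟨A (j f), (A (j f)).contDiff, fun x hx =>
        image_eq_zero_of_notMem_tsupport fun h => hx (hsupp (j f) f.tsupport_subset h)⟩
      map_add' := fun f g => by
        ext x
        have : j (f + g) = j f + j g := rfl
        change A (j (f + g)) x = A (j f) x + A (j g) x
        rw [this, hadd]; rfl
      map_smul' := fun c f => by
        ext x
        have : j (c • f) = c • j f := rfl
        change A (j (c • f)) x = c • A (j f) x
        rw [this, hsmul]; rfl }
  have hB : Continuous B := by
    refine WithSeminorms.continuous_of_isBounded (ContDiffMapSupportedIn.withSeminorms ℂ E ℂ ⊤ K)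
      (ContDiffMapSupportedIn.withSeminorms ℂ E' ℂ ⊤ K') B (.of_real fun n => ?_)
    obtain ⟨C, hC, h⟩ := hbd n
    refine ⟨Finset.range (n + 1), C, fun f => ?_⟩
    refine ((B f).seminorm_top_le_iff ℂ (mul_nonneg hC (apply_nonneg _ _)) n).2 fun x hx => ?_
    refine h (j f) _ f.tsupport_subset (fun i hi y => ?_) x hx
    exact (ContDiffMapSupportedIn.norm_iteratedFDeriv_apply_le_seminorm_top ℂ).trans
      (Seminorm.le_finset_sup_apply (p := fun j => ContDiffMapSupportedIn.seminorm ℂ E ℂ ⊤ K j)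
        (Finset.mem_range.2 (Nat.lt_succ_of_le hi)))
  have : A ∘ TestFunction.ofSupportedIn hK = TestFunction.ofSupportedIn hsub ∘ B := rfl
  rw [this]
  exact (TestFunction.continuous_ofSupportedIn hsub).comp hB

/-- The bound is chosen `≥ 1` so that it is dominated by its own positive powers, the form in which
the chain rule estimate wants it. -/
theorem exists_bound_iteratedFDeriv {F : Type*} [NormedAddCommGroup F] [NormedSpace ℝ F]
    {f : E → F} {U : Set E} (hU : IsOpen U) (hf : ContDiffOn ℝ (⊤ : ℕ∞) f U) {K : Set E}
    (hK : IsCompact K) (hKU : K ⊆ U) (n : ℕ) :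
    ∃ D : ℝ, 1 ≤ D ∧ ∀ i ≤ n, ∀ x ∈ K, ‖iteratedFDerivWithin ℝ i f U x‖ ≤ D := by
  have h : ∀ i : ℕ, ∃ D : ℝ, ∀ x ∈ K, ‖iteratedFDerivWithin ℝ i f U x‖ ≤ D := fun i =>
    hK.exists_bound_of_continuousOn
      ((hf.continuousOn_iteratedFDerivWithin (by exact_mod_cast le_top) hU.uniqueDiffOn).mono hKU)
  choose D hD using h
  refine ⟨1 + ∑ i ∈ Finset.range (n + 1), |D i|, ?_, fun i hi x hx => ?_⟩
  · have : 0 ≤ ∑ i ∈ Finset.range (n + 1), |D i| := Finset.sum_nonneg fun _ _ => abs_nonneg _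
    linarith
  · have h1 : |D i| ≤ ∑ i ∈ Finset.range (n + 1), |D i| :=
      Finset.single_le_sum (f := fun i => |D i|) (fun _ _ => abs_nonneg _)
        (Finset.mem_range.2 (Nat.lt_succ_of_le hi))
    linarith [hD i x hx, le_abs_self (D i)]

/-- `C^n` estimate for the operator `φ ↦ a · (φ ∘ g)`. -/
theorem exists_bound_mul_comp {a : E' → ℂ} {g : E' → E} {U : Set E'} (hU : IsOpen U)
    (ha : ContDiffOn ℝ (⊤ : ℕ∞) a U) (hg : ContDiffOn ℝ (⊤ : ℕ∞) g U) {K : Set E'}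
    (hK : IsCompact K) (hKU : K ⊆ U) (n : ℕ) :
    ∃ C : ℝ, 0 ≤ C ∧ ∀ (φ : E → ℂ) (M : ℝ), ContDiff ℝ (⊤ : ℕ∞) φ →
      (∀ i ≤ n, ∀ x, ‖iteratedFDeriv ℝ i φ x‖ ≤ M) →
      ∀ x ∈ K, ‖iteratedFDeriv ℝ n (fun y => a y * φ (g y)) x‖ ≤ C * M := by
  obtain ⟨Da, hDa1, hDa⟩ := exists_bound_iteratedFDeriv hU ha hK hKU n
  obtain ⟨Dg, hDg1, hDg⟩ := exists_bound_iteratedFDeriv hU hg hK hKU n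
  refine ⟨∑ i ∈ Finset.range (n + 1), (n.choose i : ℝ) * Da * ((n - i).factorial * Dg ^ (n - i)),
    by positivity, fun φ M hφ hM x hx => ?_⟩
  have hM0 : 0 ≤ M := (norm_nonneg _).trans (hM 0 (Nat.zero_le _) 0)
  have hcomp : ContDiffOn ℝ (⊤ : ℕ∞) (fun y => φ (g y)) U := hφ.comp_contDiffOn hg
  rw [← iteratedFDerivWithin_of_isOpen n hU (hKU hx)]
  refine (norm_iteratedFDerivWithin_mul_le ha hcomp hU.uniqueDiffOn (hKU hx)
    (by exact_mod_cast le_top)).trans ?_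
  rw [Finset.sum_mul]
  refine Finset.sum_le_sum fun i hi => ?_
  have hi' : i ≤ n := Nat.lt_succ_iff.1 (Finset.mem_range.1 hi)
  have h1 := hDa i hi' x hx
  have h2 : ‖iteratedFDerivWithin ℝ (n - i) (φ ∘ g) U x‖ ≤ (n - i).factorial * M * Dg ^ (n - i) := by
    have hle : ∀ k : ℕ, (k : WithTop ℕ∞) ≤ ((⊤ : ℕ∞) : WithTop ℕ∞) := fun k =>
      (mod_cast le_top : ((k : ℕ∞) : WithTop ℕ∞) ≤ ((⊤ : ℕ∞) : WithTop ℕ∞))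
    refine norm_iteratedFDerivWithin_comp_le (N := ((⊤ : ℕ∞) : WithTop ℕ∞)) hφ.contDiffOn hg
      (hle _) uniqueDiffOn_univ
      hU.uniqueDiffOn (Set.mapsTo_univ _ _) (hKU hx) (fun j hj => ?_) (fun j hj hj' => ?_)
    · rw [iteratedFDerivWithin_univ]
      exact hM j (hj.trans (Nat.sub_le _ _)) _
    · exact (hDg j (hj'.trans (Nat.sub_le _ _)) x hx).trans
        (le_self_pow₀ hDg1 (by lia))
  calc _ ≤ (n.choose i : ℝ) * Da * ((n - i).factorial * M * Dg ^ (n - i)) := by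
        gcongr
        exact h2
    _ = _ := by ring

/-- The operator `φ ↦ a · (φ ∘ g)` on test functions. -/
theorem exists_mulCompCLM (a : E' → ℂ) (g : E' → E)
    (H : ∀ K : Compacts E, ∃ (K' : Compacts E') (U : Set E'), IsOpen U ∧ (K' : Set E') ⊆ U ∧
      ContDiffOn ℝ (⊤ : ℕ∞) a U ∧ ContDiffOn ℝ (⊤ : ℕ∞) g U ∧ ∀ x ∉ K', a x = 0 ∨ g x ∉ K) :
    ∃ L : 𝓓((⊤ : Opens E), ℂ) →L[ℂ] 𝓓((⊤ : Opens E'), ℂ), ∀ φ x, L φ x = a x * φ (g x) := by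
  have hsupp : ∀ (K : Compacts E) (K' : Compacts E'), (∀ x ∉ K', a x = 0 ∨ g x ∉ K) →
      ∀ φ : 𝓓((⊤ : Opens E), ℂ), tsupport φ ⊆ K → tsupport (fun x => a x * φ (g x)) ⊆ K' := by
    intro K K' h φ hφ
    refine closure_minimal (fun x hx => ?_) K'.isCompact.isClosed
    by_contra hx'
    rcases h x hx' with h | h
    · exact hx (by simp [h])
    · exact hx (by simp [image_eq_zero_of_notMem_tsupport fun h' => h (hφ h')])
  have hex : ∀ φ : 𝓓((⊤ : Opens E), ℂ), ∃ ψ : 𝓓((⊤ : Opens E'), ℂ),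
      ∀ x, ψ x = a x * φ (g x) := by
    intro φ
    obtain ⟨K', U, hU, hKU, ha, hg, h⟩ := H ⟨tsupport φ, φ.hasCompactSupport⟩
    have hs := hsupp _ K' h φ subset_rfl
    refine ⟨⟨fun x => a x * φ (g x), ?_, ?_, fun _ _ => trivial⟩, fun x => rfl⟩
    · rw [contDiff_iff_contDiffAt]
      intro x
      by_cases hx : x ∈ K'
      · have hUx := hU.mem_nhds (hKU hx)
        exact (ha.contDiffAt hUx).mul (φ.contDiff.contDiffAt.comp x (hg.contDiffAt hUx))
      · have : (fun x => a x * φ (g x)) =ᶠ[nhds x] fun _ => 0 :=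
          notMem_tsupport_iff_eventuallyEq.1 fun h' => hx (hs h')
        exact contDiffAt_const.congr_of_eventuallyEq this
    · exact K'.isCompact.of_isClosed_subset (isClosed_tsupport _) hs
  choose A hA using hex
  have hAfun : ∀ φ, (A φ : E' → ℂ) = fun x => a x * φ (g x) := fun φ => funext (hA φ)
  obtain ⟨L, hL⟩ := exists_clm_of_bound A
    (fun f g => by ext x; simp only [hA, add_apply, mul_add])
    (fun c f => by ext x; simp only [hA, smul_apply, smul_eq_mul]; ring)
    (fun K => by
      obtain ⟨K', U, hU, hKU, ha, hg, h⟩ := H K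
      refine ⟨K', fun φ hφ => by rw [hAfun]; exact hsupp K K' h φ hφ, fun n => ?_⟩
      obtain ⟨C, hC, hb⟩ := exists_bound_mul_comp hU ha hg K'.isCompact hKU n
      exact ⟨C, hC, fun φ M _ hM x hx => by rw [hAfun]; exact hb φ M φ.contDiff hM x hx⟩)
  exact ⟨L, fun φ x => by rw [hL, hA]⟩

end TestFunctions

/-! ### The Cauchy transform of test functions and the Cauchy-Pompeiu formula. -/

section CauchyTransform

open MeasureTheory Convolution

/-- The derivatives of `f ⋆ g` are bounded by those of `g`. -/
theorem norm_iteratedFDeriv_convolution_le {f : ℂ → ℂ} (hf : LocallyIntegrable f) {Q : Set ℂ}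
    (hQ : IsCompact Q) {x : ℂ} (n : ℕ) : ∀ {F F' : Type} [NormedAddCommGroup F] [NormedSpace ℝ F]
    [NormedAddCommGroup F'] [NormedSpace ℝ F'] (L : ℂ →L[ℝ] F →L[ℝ] F') {g : ℂ → F},
    ContDiff ℝ (⊤ : ℕ∞) g → HasCompactSupport g → (∀ t, x - t ∈ tsupport g → t ∈ Q) →
    ∀ M : ℝ, (∀ y, ‖iteratedFDeriv ℝ n g y‖ ≤ M) →
      ‖iteratedFDeriv ℝ n (f ⋆[L] g) x‖ ≤ ‖L‖ * (∫ t in Q, ‖f t‖) * M := by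
  have hfQ : IntegrableOn (fun t => ‖f t‖) Q := (hf.integrableOn_isCompact hQ).norm
  -- Each step replaces `g` by its derivative, which takes values in another space; this is why the
  -- target spaces and the bilinear map are quantified inside the induction.
  induction n with
  | zero =>
    intro F F' _ _ _ _ L g hg hgc hgQ M hM
    rw [norm_iteratedFDeriv_zero]
    have hM' : ∀ y, ‖g y‖ ≤ M := fun y => by simpa using hM y
    have h1 : (f ⋆[L] g) x = ∫ t in Q, L (f t) (g (x - t)) := by
      rw [convolution, setIntegral_eq_integral_of_forall_compl_eq_zero]
      intro t ht
      rw [image_eq_zero_of_notMem_tsupport fun h => ht (hgQ t h), map_zero]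
    rw [h1, ← integral_const_mul, ← integral_mul_const]
    refine norm_integral_le_of_norm_le ((hfQ.const_mul _).mul_const _) (ae_of_all _ fun t => ?_)
    calc _ ≤ ‖L‖ * ‖f t‖ * ‖g (x - t)‖ := L.le_opNorm₂ _ _
      _ ≤ _ := by gcongr; exact hM' _
  | succ n ih =>
    intro F F' _ _ _ _ L g hg hgc hgQ M hM
    have hfd : fderiv ℝ (f ⋆[L] g) = f ⋆[L.precompR ℂ] (fderiv ℝ g) := funext fun y =>
      (hgc.hasFDerivAt_convolution_right L hf (hg.of_le (mod_cast le_top)) y).fderiv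
    rw [← norm_iteratedFDeriv_fderiv, hfd]
    have hM0 : 0 ≤ M := (norm_nonneg _).trans (hM 0)
    refine (ih (L.precompR ℂ) (hg.fderiv_right (m := ((⊤ : ℕ∞) : WithTop ℕ∞)) (mod_cast le_top))
      (hgc.fderiv ℝ) (fun t ht => hgQ t (tsupport_fderiv_subset ℝ ht)) M
      (fun y => by rw [norm_iteratedFDeriv_fderiv]; exact hM y)).trans ?_
    gcongr
    exact L.norm_precompR_le ℂ

/-- In polar coordinates the Jacobian `r` cancels `‖t⁻¹‖ = 1 / r`, leaving the area of a bounded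
rectangle. -/
theorem integrableOn_inv_ball (R : ℝ) : IntegrableOn (fun t : ℂ => t⁻¹) (Metric.ball 0 R) := by
  refine ⟨measurable_inv.aestronglyMeasurable, ?_⟩
  rw [hasFiniteIntegral_iff_enorm, ← lintegral_indicator Metric.isOpen_ball.measurableSet,
    ← Complex.lintegral_comp_polarCoord_symm]
  have hle : ∀ p ∈ polarCoord.target, ENNReal.ofReal p.1 •
      (Metric.ball (0 : ℂ) R).indicator (fun t : ℂ => ‖t⁻¹‖ₑ) (Complex.polarCoord.symm p) ≤
      (Set.Ioo (0 : ℝ) R ×ˢ Set.Ioo (-Real.pi) Real.pi).indicator 1 p := by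
    intro p hp
    rw [polarCoord_target] at hp
    have hp1 : 0 < p.1 := hp.1
    have hn : ‖Complex.polarCoord.symm p‖ = p.1 := by
      rw [Complex.norm_polarCoord_symm, abs_of_pos hp1]
    have hmem : Complex.polarCoord.symm p ∈ Metric.ball (0 : ℂ) R ↔ p.1 < R := by
      rw [mem_ball_zero_iff, hn]
    by_cases hR : p.1 < R
    · have hp' : p ∈ Set.Ioo (0 : ℝ) R ×ˢ Set.Ioo (-Real.pi) Real.pi := ⟨⟨hp1, hR⟩, hp.2⟩
      rw [Set.indicator_of_mem (hmem.2 hR), Set.indicator_of_mem hp']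
      rw [← ofReal_norm, norm_inv, hn, smul_eq_mul, ← ENNReal.ofReal_mul hp1.le,
        mul_inv_cancel₀ hp1.ne']
      simp
    · rw [Set.indicator_of_notMem (fun h => hR (hmem.1 h))]
      simp
  refine (setLIntegral_mono' polarCoord.open_target.measurableSet hle).trans_lt ?_
  refine (setLIntegral_le_lintegral _ _).trans_lt ?_
  rw [lintegral_indicator_one (measurableSet_Ioo.prod measurableSet_Ioo), Measure.volume_eq_prod,
    Measure.prod_prod]
  simp [ENNReal.mul_lt_top_iff]

theorem locallyIntegrable_of_norm_le {f : ℂ → ℂ} (hf : AEStronglyMeasurable f) {C : ℝ}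
    (h : ∀ x, ‖f x‖ ≤ C * ‖x‖⁻¹) : LocallyIntegrable f := by
  intro x
  refine ⟨Metric.ball 0 (‖x‖ + 1), Metric.isOpen_ball.mem_nhds (by simp), ?_⟩
  refine Integrable.mono' ((integrableOn_inv_ball _).norm.const_mul C) hf.restrict
    (ae_of_all _ fun t => ?_)
  simpa using h t

/-- The fundamental solution `1 / (π t)` of the Cauchy-Riemann operator on `ℂ`. -/
noncomputable def cauchyKernel (t : ℂ) : ℂ := (Real.pi * t)⁻¹

theorem locallyIntegrable_cauchyKernel : LocallyIntegrable cauchyKernel := by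
  refine locallyIntegrable_of_norm_le (C := Real.pi⁻¹) ?_ fun x => ?_
  · exact ((measurable_const.mul measurable_id).inv).aestronglyMeasurable
  · simp [cauchyKernel, abs_of_pos Real.pi_pos, mul_comm]

/-- The Cauchy-Riemann operator `∂/∂z̄` on `ℂ`. -/
noncomputable def dzbar (φ : ℂ → ℂ) (x : ℂ) : ℂ :=
  (fderiv ℝ φ x 1 + Complex.I * fderiv ℝ φ x Complex.I) / 2

/-- The convolution of `φ` with the Cauchy kernel. -/
noncomputable def cauchyTransform (φ : ℂ → ℂ) : ℂ → ℂ :=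
  cauchyKernel ⋆[ContinuousLinearMap.mul ℝ ℂ] φ

theorem cauchyTransform_apply (φ : ℂ → ℂ) (x : ℂ) :
    cauchyTransform φ x = ∫ t, cauchyKernel t * φ (x - t) := rfl

theorem contDiff_cauchyTransform {φ : ℂ → ℂ} (hφ : ContDiff ℝ (⊤ : ℕ∞) φ)
    (hc : HasCompactSupport φ) : ContDiff ℝ (⊤ : ℕ∞) (cauchyTransform φ) :=
  hc.contDiff_convolution_right _ locallyIntegrable_cauchyKernel hφ

/-- Derivatives of a convolution may be put on the smooth factor, so no derivative of the singular
kernel occurs. -/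
theorem dzbar_cauchyTransform_eq {φ : ℂ → ℂ} (hφ : ContDiff ℝ (⊤ : ℕ∞) φ)
    (hc : HasCompactSupport φ) : dzbar (cauchyTransform φ) = cauchyTransform (dzbar φ) := by
  ext x
  have hd := hc.hasFDerivAt_convolution_right (ContinuousLinearMap.mul ℝ ℂ)
    locallyIntegrable_cauchyKernel (hφ.of_le (mod_cast le_top)) x
  have hcont : Continuous (fderiv ℝ φ) := hφ.continuous_fderiv (by simp)
  have hv : ∀ v : ℂ, fderiv ℝ (cauchyTransform φ) x v =
      ∫ t, cauchyKernel t * fderiv ℝ φ (x - t) v := fun v => by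
    rw [cauchyTransform, hd.fderiv, convolution_precompR_apply _ locallyIntegrable_cauchyKernel
      (hc.fderiv ℝ) hcont]
    rfl
  have hint : ∀ v : ℂ, Integrable fun t => cauchyKernel t * fderiv ℝ φ (x - t) v := fun v => by
    have := (hc.fderiv_apply ℝ v).convolutionExists_right (ContinuousLinearMap.mul ℝ ℂ)
      locallyIntegrable_cauchyKernel (hcont.clm_apply continuous_const) x
    exact this
  rw [dzbar, hv, hv, ← integral_const_mul, ← integral_add (hint 1) ((hint _).const_mul _),
    ← integral_div, cauchyTransform_apply]
  congr 1
  ext t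
  simp only [dzbar]
  ring

/-- Rotating the frame `(1, i)` to `(e, ie)` with `e = exp (iθ)` multiplies `∂/∂z̄` by `e`. At `y =
r e` this factor and the Jacobian `r` cancel against `y⁻¹`, which leaves half of radial plus `i`
times tangential derivative. -/
theorem dzbar_eq_polar (φ : ℂ → ℂ) (x : ℂ) (θ : ℝ) :
    dzbar φ x = Complex.exp (θ * Complex.I) *
      ((fderiv ℝ φ x (Complex.exp (θ * Complex.I)) +
        Complex.I * fderiv ℝ φ x (Complex.I * Complex.exp (θ * Complex.I))) / 2) := by
  have h1 : Complex.exp (θ * Complex.I) = Real.cos θ • (1 : ℂ) + Real.sin θ • Complex.I := by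
    rw [Complex.exp_mul_I]; simp
  have h2 : Complex.I * Complex.exp (θ * Complex.I) =
      Real.cos θ • Complex.I - Real.sin θ • (1 : ℂ) := by
    rw [h1, mul_add, mul_smul_comm, mul_smul_comm, Complex.I_mul_I]; simp [sub_eq_add_neg]
  rw [h2, h1, map_add, map_sub, map_smul, map_smul, map_smul, map_smul, dzbar]
  simp only [Complex.real_smul, mul_one]
  have h3 : (Real.cos θ : ℂ) ^ 2 + (Real.sin θ : ℂ) ^ 2 = 1 := by
    exact_mod_cast Real.cos_sq_add_sin_sq θ
  linear_combination (-(fderiv ℝ φ x 1 + Complex.I * fderiv ℝ φ x Complex.I) / 2) * h3 +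
    (-(Real.cos θ * Real.sin θ * fderiv ℝ φ x Complex.I / 2) +
      (Real.sin θ : ℂ) ^ 2 * fderiv ℝ φ x 1 / 2) * Complex.I_sq

/-- Fundamental theorem of calculus along the ray through `e`: only the endpoint at the origin
contributes. -/
theorem integral_polar_radial {φ : ℂ → ℂ} (hφ : ContDiff ℝ (⊤ : ℕ∞) φ)
    (hc : HasCompactSupport φ) (e : ℂ) (he : ‖e‖ = 1) :
    ∫ r in Set.Ioi (0 : ℝ), fderiv ℝ φ (r * e) e = - φ 0 := by
  have hd : ∀ r : ℝ, HasDerivAt (fun r : ℝ => φ (r * e)) (fderiv ℝ φ (r * e) e) r := fun r => by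
    have h1 : HasDerivAt (fun r : ℝ => (r : ℂ) * e) e r := by
      simpa using (Complex.ofRealCLM.hasDerivAt (x := r)).mul_const e
    exact ((hφ.differentiable (by simp)).differentiableAt.hasFDerivAt).comp_hasDerivAt r h1
  obtain ⟨R, hR0, hR⟩ : ∃ R : ℝ, 0 < R ∧ ∀ x, R < ‖x‖ → φ x = 0 := by
    obtain ⟨R, hR⟩ := hc.isCompact.isBounded.subset_closedBall (0 : ℂ)
    refine ⟨max R 1, by positivity, fun x hx => image_eq_zero_of_notMem_tsupport fun h => ?_⟩
    have := hR h
    rw [mem_closedBall_zero_iff] at this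
    exact absurd (this.trans (le_max_left R 1)) (not_le.2 hx)
  have hz : ∀ r : ℝ, R < r → φ (r * e) = 0 := fun r hr => hR _ (by
    rw [norm_mul, he, mul_one, Complex.norm_real, Real.norm_of_nonneg (hR0.trans hr).le]; exact hr)
  have hcont : Continuous fun r : ℝ => fderiv ℝ φ (r * e) e := by
    have := hφ.continuous_fderiv (by simp)
    fun_prop
  have hint : IntegrableOn (fun r : ℝ => fderiv ℝ φ (r * e) e) (Set.Ioi 0) := by
    rw [← Set.Ioc_union_Ioi_eq_Ioi hR0.le]
    refine (hcont.integrableOn_Ioc).union ?_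
    have h0 : IntegrableOn (fun _ : ℝ => (0 : ℂ)) (Set.Ioi R) := integrableOn_zero
    refine h0.congr_fun (fun r hr => ?_) measurableSet_Ioi
    refine ((hd r).unique ?_).symm
    refine (hasDerivAt_const r (0 : ℂ)).congr_of_eventuallyEq ?_
    filter_upwards [Ioi_mem_nhds hr] with s hs using hz s hs
  have htend : Filter.Tendsto (fun r : ℝ => φ (r * e)) Filter.atTop (nhds 0) := by
    refine tendsto_const_nhds.congr' ?_
    filter_upwards [Filter.eventually_gt_atTop R] with r hr using (hz r hr).symm
  rw [integral_Ioi_of_hasDerivAt_of_tendsto (hd 0).continuousAt.continuousWithinAt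
    (fun r _ => hd r) hint htend]
  simp

/-- Up to the factor `r` the integrand is the `θ`-derivative of a `2π`-periodic function. -/
theorem integral_polar_angular {φ : ℂ → ℂ} (hφ : ContDiff ℝ (⊤ : ℕ∞) φ) {r : ℝ} (hr : 0 < r) :
    ∫ θ in Set.Ioo (-Real.pi) Real.pi, fderiv ℝ φ (r * Complex.exp (θ * Complex.I))
      (Complex.I * Complex.exp (θ * Complex.I)) = 0 := by
  have hd : ∀ θ : ℝ, HasDerivAt (fun θ : ℝ => (r : ℂ)⁻¹ * φ (r * Complex.exp (θ * Complex.I)))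
      (fderiv ℝ φ (r * Complex.exp (θ * Complex.I))
        (Complex.I * Complex.exp (θ * Complex.I))) θ := fun θ => by
    have h0 : HasDerivAt (fun θ : ℝ => (θ : ℂ) * Complex.I) Complex.I θ := by
      simpa using (Complex.ofRealCLM.hasDerivAt (x := θ)).mul_const Complex.I
    have h1 := (h0.cexp).const_mul (r : ℂ)
    have h2 := ((hφ.differentiable (by simp)).differentiableAt.hasFDerivAt).comp_hasDerivAt θ h1
    have h3 := h2.const_mul (r : ℂ)⁻¹
    refine h3.congr_deriv ?_
    have h4 : (r : ℂ) * (Complex.exp (θ * Complex.I) * Complex.I) =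
        r • (Complex.I * Complex.exp (θ * Complex.I)) := by
      rw [Complex.real_smul, mul_comm Complex.I]
    rw [h4, map_smul, Complex.real_smul, ← mul_assoc, inv_mul_cancel₀ (by exact_mod_cast hr.ne'), one_mul]
  have hcont : Continuous fun θ : ℝ => fderiv ℝ φ (r * Complex.exp (θ * Complex.I))
      (Complex.I * Complex.exp (θ * Complex.I)) := by
    have := hφ.continuous_fderiv (by simp)
    fun_prop
  rw [← integral_Ioc_eq_integral_Ioo, ← intervalIntegral.integral_of_le (by linarith [Real.pi_pos]),
    intervalIntegral.integral_eq_sub_of_hasDerivAt (fun θ _ => hd θ)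
      (hcont.intervalIntegrable _ _)]
  have : Complex.exp ((-Real.pi : ℝ) * Complex.I) = Complex.exp (Real.pi * Complex.I) := by
    rw [Complex.exp_eq_exp_iff_exists_int]
    exact ⟨-1, by push_cast; ring⟩
  rw [this, sub_self]

/-- The Cauchy-Pompeiu formula at the origin. -/
theorem integral_inv_mul_dzbar {φ : ℂ → ℂ} (hφ : ContDiff ℝ (⊤ : ℕ∞) φ)
    (hc : HasCompactSupport φ) : ∫ y, y⁻¹ * dzbar φ y = -Real.pi * φ 0 := by
  have hcontd : Continuous (fderiv ℝ φ) := hφ.continuous_fderiv (by simp)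
  set A : ℝ × ℝ → ℂ := fun p => fderiv ℝ φ (p.1 * Complex.exp (p.2 * Complex.I))
    (Complex.exp (p.2 * Complex.I)) with hA
  set B : ℝ × ℝ → ℂ := fun p => fderiv ℝ φ (p.1 * Complex.exp (p.2 * Complex.I))
    (Complex.I * Complex.exp (p.2 * Complex.I)) with hB
  have hAc : Continuous A := by fun_prop
  have hBc : Continuous B := by fun_prop
  obtain ⟨R, hR⟩ := (hc.fderiv ℝ).isCompact.isBounded.subset_closedBall (0 : ℂ)
  have hz : ∀ p : ℝ × ℝ, p ∉ Set.Icc (-R) R ×ˢ Set.univ →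
      fderiv ℝ φ (p.1 * Complex.exp (p.2 * Complex.I)) = 0 := by
    intro p hp
    refine image_eq_zero_of_notMem_tsupport fun h => hp ⟨?_, trivial⟩
    have := hR h
    rw [mem_closedBall_zero_iff, norm_mul, Complex.norm_exp_ofReal_mul_I, mul_one,
      Complex.norm_real, Real.norm_eq_abs] at this
    exact abs_le.1 this
  have hint : ∀ F : ℝ × ℝ → ℂ, Continuous F → (∀ p, p ∉ Set.Icc (-R) R ×ˢ Set.univ → F p = 0) →
      IntegrableOn F (Set.Ioi (0 : ℝ) ×ˢ Set.Ioo (-Real.pi) Real.pi) := by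
    intro F hF hF0
    have h1 : IntegrableOn F (Set.Icc (-R) R ×ˢ Set.Icc (-Real.pi) Real.pi) :=
      hF.continuousOn.integrableOn_compact (isCompact_Icc.prod isCompact_Icc)
    refine h1.of_forall_sdiff_eq_zero (measurableSet_Ioi.prod measurableSet_Ioo) ?_
    rintro p ⟨hp1, hp2⟩
    exact hF0 p fun h => hp2 ⟨h.1, Set.Ioo_subset_Icc_self hp1.2⟩
  have hAi := hint A hAc fun p hp => by simp only [hA, hz p hp]; rfl
  have hBi := hint B hBc fun p hp => by simp only [hB, hz p hp]; rfl
  have hIA : ∫ p in Set.Ioi (0 : ℝ) ×ˢ Set.Ioo (-Real.pi) Real.pi, A p = -(2 * Real.pi) * φ 0 := by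
    rw [Measure.volume_eq_prod] at hAi ⊢
    -- The angle becomes the outer variable, so that the inner integral runs along a ray.
    rw [← setIntegral_prod_swap]
    refine (setIntegral_prod (A ∘ Prod.swap) hAi.swap).trans ?_
    have : ∀ θ ∈ Set.Ioo (-Real.pi) Real.pi,
        ∫ r in Set.Ioi (0 : ℝ), (A ∘ Prod.swap) (θ, r) = - φ 0 := fun θ _ =>
      integral_polar_radial hφ hc _ (Complex.norm_exp_ofReal_mul_I θ)
    rw [setIntegral_congr_fun measurableSet_Ioo this, setIntegral_const,
      Real.volume_real_Ioo_of_le (by linarith [Real.pi_pos]), Complex.real_smul]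
    push_cast
    ring
  have hIB : ∫ p in Set.Ioi (0 : ℝ) ×ˢ Set.Ioo (-Real.pi) Real.pi, B p = 0 := by
    rw [Measure.volume_eq_prod] at hBi ⊢
    rw [setIntegral_prod _ hBi]
    have : ∀ r ∈ Set.Ioi (0 : ℝ),
        ∫ θ in Set.Ioo (-Real.pi) Real.pi, B (r, θ) = 0 := fun r hr =>
      integral_polar_angular hφ hr
    rw [setIntegral_congr_fun measurableSet_Ioi this]
    simp
  rw [← Complex.integral_comp_polarCoord_symm, polarCoord_target]
  have hcongr : ∀ p ∈ Set.Ioi (0 : ℝ) ×ˢ Set.Ioo (-Real.pi) Real.pi,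
      p.1 • ((Complex.polarCoord.symm p)⁻¹ * dzbar φ (Complex.polarCoord.symm p)) =
        (A p + Complex.I * B p) / 2 := by
    intro p hp
    have hp1 : (p.1 : ℂ) ≠ 0 := by exact_mod_cast (ne_of_gt hp.1)
    have he : Complex.polarCoord.symm p = p.1 * Complex.exp (p.2 * Complex.I) := by
      rw [Complex.polarCoord_symm_apply, Complex.exp_mul_I]; simp
    rw [he, dzbar_eq_polar φ _ p.2, Complex.real_smul]
    field_simp
    rfl
  rw [setIntegral_congr_fun (measurableSet_Ioi.prod measurableSet_Ioo) hcongr, integral_div,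
    integral_add hAi (hBi.const_mul _), integral_const_mul, hIA, hIB]
  ring

theorem dzbar_comp_sub (φ : ℂ → ℂ) (hφ : ContDiff ℝ (⊤ : ℕ∞) φ) (x t : ℂ) :
    dzbar (fun s => φ (x - s)) t = - dzbar φ (x - t) := by
  have h : HasFDerivAt (fun s => φ (x - s)) (-fderiv ℝ φ (x - t)) t := by
    have h1 : HasFDerivAt (𝕜 := ℝ) (fun s : ℂ => x - s) (-ContinuousLinearMap.id ℝ ℂ) t := by
      simpa using (hasFDerivAt_id (𝕜 := ℝ) t).const_sub x
    have h2 := ((hφ.differentiable (by simp)).differentiableAt (x := x - t)).hasFDerivAt.comp t h1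
    refine h2.congr_fderiv ?_
    ext; simp
  simp only [dzbar, h.fderiv, neg_apply]
  ring

/-- Cauchy-Pompeiu at the origin for `s ↦ φ (x - s)`; the sign produced by the reflection cancels
the one in `-π φ(0)`. -/
theorem cauchyTransform_dzbar {φ : ℂ → ℂ} (hφ : ContDiff ℝ (⊤ : ℕ∞) φ)
    (hc : HasCompactSupport φ) : cauchyTransform (dzbar φ) = φ := by
  ext x
  have h := integral_inv_mul_dzbar (φ := fun s => φ (x - s)) (by fun_prop)
    (hc.comp_homeomorph (Homeomorph.subLeft x))
  simp only [dzbar_comp_sub φ hφ, sub_zero] at h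
  have hpi : (Real.pi : ℂ) ≠ 0 := by exact_mod_cast Real.pi_ne_zero
  have h2 : φ x = (-Real.pi : ℂ)⁻¹ * ∫ t, t⁻¹ * -dzbar φ (x - t) := by
    rw [h]; field_simp
  rw [h2, ← integral_const_mul, cauchyTransform_apply]
  congr 1
  ext t
  rw [cauchyKernel, mul_inv, inv_neg]
  ring

theorem dzbar_cauchyTransform {φ : ℂ → ℂ} (hφ : ContDiff ℝ (⊤ : ℕ∞) φ)
    (hc : HasCompactSupport φ) : dzbar (cauchyTransform φ) = φ := by
  rw [dzbar_cauchyTransform_eq hφ hc, cauchyTransform_dzbar hφ hc]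

end CauchyTransform

/-! ### Cut-off Cauchy transforms, supports of distributions, and Cauchy integrals. -/

section Distributions

open MeasureTheory Convolution

/-- Smooth compactly supported functions on `ℂ`. -/
abbrev TestC : Type := 𝓓((⊤ : Opens ℂ), ℂ)

/-- Smooth cutoff functions. -/
theorem exists_cutoff {E : Type*} [NormedAddCommGroup E] [NormedSpace ℝ E] [FiniteDimensional ℝ E]
    {L U : Set E} (hL : IsCompact L) (hU : IsOpen U) (hLU : L ⊆ U) :
    ∃ κ : E → ℝ, ContDiff ℝ (⊤ : ℕ∞) κ ∧ HasCompactSupport κ ∧ tsupport κ ⊆ U ∧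
      ∃ W, IsOpen W ∧ L ⊆ W ∧ ∀ x ∈ W, κ x = 1 := by
  obtain ⟨L', hL', hLL', hLU'⟩ := exists_compact_between hL hU hLU
  obtain ⟨f, hf1, hf0, -⟩ := exists_contMDiffMap_one_nhds_of_subset_interior (n := ⊤)
    (modelWithCornersSelf ℝ E) hL.isClosed hLL'
  obtain ⟨W, hW, hLW, h1⟩ := eventually_nhdsSet_iff_exists.1 hf1
  have hsupp : tsupport f ⊆ L' := closure_minimal
    (fun x hx => by by_contra h; exact hx (hf0 x h)) hL'.isClosed
  exact ⟨f, f.contMDiff.contDiff, hL'.of_isClosed_subset (isClosed_tsupport _) hsupp,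
    hsupp.trans hLU', W, hW, hLW, h1⟩

theorem exists_test_cutoff {L U : Set ℂ} (hL : IsCompact L) (hU : IsOpen U) (hLU : L ⊆ U) :
    ∃ κ : TestC, tsupport κ ⊆ U ∧ ∃ W, IsOpen W ∧ L ⊆ W ∧ ∀ x ∈ W, κ x = 1 := by
  obtain ⟨κ, hκ, hc, hs, W, hW, hLW, h1⟩ := exists_cutoff hL hU hLU
  have hsub : tsupport (fun x => (κ x : ℂ)) ⊆ tsupport κ :=
    tsupport_comp_subset (g := fun r : ℝ => (r : ℂ)) Complex.ofReal_zero κ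
  refine ⟨⟨fun x => κ x, Complex.ofRealCLM.contDiff.comp hκ,
    hc.of_isClosed_subset (isClosed_tsupport _) hsub, fun _ _ => trivial⟩, hsub.trans hs,
    W, hW, hLW, fun x hx => ?_⟩
  change ((κ x : ℝ) : ℂ) = 1
  rw [h1 x hx, Complex.ofReal_one]

theorem TestFunction.exists_bound {F : Type*} [NormedAddCommGroup F] [NormedSpace ℝ F] {f : ℂ → F}
    (hf : ContDiff ℝ (⊤ : ℕ∞) f) (hc : HasCompactSupport f) (n : ℕ) :
    ∃ D : ℝ, 0 ≤ D ∧ ∀ i ≤ n, ∀ x, ‖iteratedFDeriv ℝ i f x‖ ≤ D := by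
  obtain ⟨D, hD1, hD⟩ := exists_bound_iteratedFDeriv isOpen_univ hf.contDiffOn hc.isCompact
    (Set.subset_univ _) n
  refine ⟨D, zero_le_one.trans hD1, fun i hi x => ?_⟩
  by_cases hx : x ∈ tsupport f
  · simpa [iteratedFDerivWithin_univ] using hD i hi x hx
  · rw [image_eq_zero_of_notMem_tsupport fun h => hx (tsupport_iteratedFDeriv_subset i h), norm_zero]
    linarith

/-- The Cauchy-Riemann operator on test functions. -/
noncomputable def dzbarTest : TestC →L[ℂ] TestC :=
  TestFunction.postcompCLM (ContinuousLinearMap.apply' ℂ (starRingEnd ℂ) (1 : ℂ)) ∘L dbarTest ⊤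

theorem dzbarTest_apply (φ : TestC) (x : ℂ) : dzbarTest φ x = dzbar φ x := by
  change dbarTest ⊤ φ x 1 = _
  rw [dbarTest_apply, conjPart_apply, dzbar, smul_eq_mul, mul_one]

theorem coe_dzbarTest (φ : TestC) : (dzbarTest φ : ℂ → ℂ) = dzbar φ := funext (dzbarTest_apply φ)

theorem tsupport_dzbarTest_subset (φ : TestC) : tsupport (dzbarTest φ) ⊆ tsupport φ := by
  have : (dzbarTest φ : ℂ → ℂ) =
      (fun L : ℂ →L⋆[ℂ] ℂ => L 1) ∘ (dbarTest ⊤ φ : ℂ → ℂ →L⋆[ℂ] ℂ) := rfl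
  rw [this]
  exact (tsupport_comp_subset rfl _).trans (tsupport_dbarTest ⊤ φ)

theorem dzbar_mul {f g : ℂ → ℂ} {x : ℂ} (hf : DifferentiableAt ℝ f x)
    (hg : DifferentiableAt ℝ g x) :
    dzbar (fun y => f y * g y) x = dzbar f x * g x + f x * dzbar g x := by
  simp only [dzbar, fderiv_fun_mul hf hg, add_apply, smul_apply, smul_eq_mul]
  ring

theorem dzbar_eq_zero_of_differentiableAt {f : ℂ → ℂ} {x : ℂ} (hf : DifferentiableAt ℂ f x) :
    dzbar f x = 0 := by
  have h : HasFDerivAt (𝕜 := ℝ) f ((fderiv ℂ f x).restrictScalars ℝ) x :=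
    hf.hasFDerivAt.restrictScalars ℝ
  rw [dzbar, h.fderiv]
  have : fderiv ℂ f x Complex.I = Complex.I * fderiv ℂ f x 1 := by
    conv_lhs => rw [← mul_one Complex.I, ← smul_eq_mul, map_smul, smul_eq_mul]
  simp only [ContinuousLinearMap.coe_restrictScalars', this]
  linear_combination (fderiv ℂ f x 1 / 2) * Complex.I_sq

theorem dzbar_congr {f g : ℂ → ℂ} {x : ℂ} (h : f =ᶠ[nhds x] g) : dzbar f x = dzbar g x := by
  rw [dzbar, dzbar, h.fderiv_eq]

/-- The operator `φ ↦ κ · P φ`, where `P` is the Cauchy transform and `κ` a test function. -/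
theorem exists_cutTransform (κ : TestC) :
    ∃ A : TestC →L[ℂ] TestC, ∀ φ x, A φ x = κ x * cauchyTransform φ x := by
  let A : TestC → TestC := fun φ => ⟨fun x => κ x * cauchyTransform φ x,
    κ.contDiff.mul (contDiff_cauchyTransform φ.contDiff φ.hasCompactSupport),
    κ.hasCompactSupport.mul_right, fun _ _ => trivial⟩
  have hA : ∀ φ x, A φ x = κ x * cauchyTransform φ x := fun _ _ => rfl
  have hex : ∀ (φ : TestC) x, Integrable fun t => cauchyKernel t * φ (x - t) := fun φ x =>
    φ.hasCompactSupport.convolutionExists_right (ContinuousLinearMap.mul ℝ ℂ)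
      locallyIntegrable_cauchyKernel φ.continuous x
  obtain ⟨B, hB⟩ := exists_clm_of_bound A
    (fun f g => by
      ext x
      simp only [hA, add_apply, cauchyTransform_apply, mul_add]
      rw [integral_add (hex f x) (hex g x), mul_add])
    (fun c f => by
      ext x
      simp only [hA, smul_apply, smul_eq_mul, cauchyTransform_apply]
      have : ∀ t, cauchyKernel t * (c * f (x - t)) = c * (cauchyKernel t * f (x - t)) :=
        fun t => by ring
      simp only [this, integral_const_mul]
      ring)
    (fun K => by
      refine ⟨⟨tsupport κ, κ.hasCompactSupport⟩, fun φ _ => tsupport_mul_subset_left, fun n => ?_⟩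
      obtain ⟨D, hD0, hD⟩ := TestFunction.exists_bound κ.contDiff κ.hasCompactSupport n
      -- For `x` in the support of `κ` and `φ` supported in `K`, only `t ∈ tsupport κ - K`
      -- contribute to the convolution at `x`.
      set Q : Set ℂ := (fun p : ℂ × ℂ => p.1 - p.2) '' (tsupport κ ×ˢ (K : Set ℂ)) with hQdef
      have hQ : IsCompact Q :=
        (IsCompact.prod κ.hasCompactSupport K.isCompact).image continuous_sub
      set c : ℝ := ‖ContinuousLinearMap.mul ℝ ℂ‖ * ∫ t in Q, ‖cauchyKernel t‖
      have hc : 0 ≤ c := mul_nonneg (norm_nonneg _) (integral_nonneg fun _ => norm_nonneg _)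
      refine ⟨∑ i ∈ Finset.range (n + 1), (n.choose i : ℝ) * D * c, by positivity,
        fun φ M hφ hM x hx => ?_⟩
      refine (norm_iteratedFDeriv_mul_le κ.contDiff
        (contDiff_cauchyTransform φ.contDiff φ.hasCompactSupport) x
        (mod_cast le_top)).trans ?_
      rw [Finset.sum_mul]
      refine Finset.sum_le_sum fun i hi => ?_
      have h1 := hD i (Nat.lt_succ_iff.1 (Finset.mem_range.1 hi)) x
      have h2 : ‖iteratedFDeriv ℝ (n - i) (cauchyTransform φ) x‖ ≤ c * M :=
        norm_iteratedFDeriv_convolution_le locallyIntegrable_cauchyKernel hQ (n - i) _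
          φ.contDiff φ.hasCompactSupport
          (fun t ht => ⟨(x, x - t), ⟨hx, hφ ht⟩, by simp⟩) M (hM _ (Nat.sub_le _ _))
      rw [mul_assoc _ c M]
      gcongr)
  exact ⟨B, fun φ x => by rw [hB, hA]⟩

noncomputable def cutTransform (κ : TestC) : TestC →L[ℂ] TestC := (exists_cutTransform κ).choose

theorem cutTransform_apply (κ φ : TestC) (x : ℂ) :
    cutTransform κ φ x = κ x * cauchyTransform φ x := (exists_cutTransform κ).choose_spec φ x

theorem tsupport_cutTransform_subset (κ φ : TestC) : tsupport (cutTransform κ φ) ⊆ tsupport κ := by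
  rw [show (cutTransform κ φ : ℂ → ℂ) = fun x => κ x * cauchyTransform φ x from
    funext (cutTransform_apply κ φ)]
  exact tsupport_mul_subset_left

/-- Leibniz rule together with `∂̄P = id`. The error made by cutting off lives on the support of
`∂̄κ`, the fact on which Weyl's lemma and the analysis at infinity rest. -/
theorem dzbarTest_cutTransform (κ φ : TestC) (x : ℂ) :
    dzbarTest (cutTransform κ φ) x = dzbarTest κ x * cauchyTransform φ x + κ x * φ x := by
  rw [dzbarTest_apply, show (cutTransform κ φ : ℂ → ℂ) = fun x => κ x * cauchyTransform φ x from
    funext (cutTransform_apply κ φ), dzbar_mul ((κ.contDiff.differentiable (by simp)) x)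
    (((contDiff_cauchyTransform φ.contDiff φ.hasCompactSupport).differentiable (by simp)) x),
    dzbar_cauchyTransform φ.contDiff φ.hasCompactSupport, dzbarTest_apply]

theorem dzbarTest_eq_zero_of_eq_one {κ : TestC} {W : Set ℂ} (hW : IsOpen W)
    (h1 : ∀ x ∈ W, κ x = 1) {x : ℂ} (hx : x ∈ W) : dzbarTest κ x = 0 := by
  rw [dzbarTest_apply, dzbar_congr (g := fun _ => 1)
    (by filter_upwards [hW.mem_nhds hx] with y hy using h1 y hy), dzbar]
  simp

/-- The functional `u` is supported in `L`. -/
def SuppIn (u : TestC →L[ℂ] ℂ) (L : Set ℂ) : Prop :=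
  ∀ φ : TestC, Disjoint (tsupport φ) L → u φ = 0

theorem SuppIn.mono {u : TestC →L[ℂ] ℂ} {L L' : Set ℂ} (h : SuppIn u L) (hL : L ⊆ L') :
    SuppIn u L' := fun φ hφ => h φ (hφ.mono_right hL)

/-- Agreement is asked on an open neighbourhood of `L`, not just on `L`: only then is the support of
`φ - ψ` disjoint from `L`. -/
theorem SuppIn.congr {u : TestC →L[ℂ] ℂ} {L : Set ℂ} (h : SuppIn u L) {W : Set ℂ} (hW : IsOpen W)
    (hLW : L ⊆ W) {φ ψ : TestC} (hφψ : ∀ x ∈ W, φ x = ψ x) : u φ = u ψ := by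
  rw [← sub_eq_zero, ← map_sub]
  refine h _ (Disjoint.mono ?_ hLW (disjoint_compl_left (a := W)))
  refine closure_minimal (fun x hx hxW => hx ?_) hW.isClosed_compl
  rw [sub_apply, hφψ x hxW, sub_self]

/-- The convolution of `u` with the fundamental solution solves the `∂̄` equation. -/
theorem SuppIn.cutTransform_dzbarTest {u : TestC →L[ℂ] ℂ} {L : Set ℂ} (h : SuppIn u L) {κ : TestC}
    {W : Set ℂ} (hW : IsOpen W) (hLW : L ⊆ W) (h1 : ∀ x ∈ W, κ x = 1) (φ : TestC) :
    u (cutTransform κ (dzbarTest φ)) = u φ :=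
  h.congr hW hLW fun x hx => by
    rw [cutTransform_apply, coe_dzbarTest, cauchyTransform_dzbar φ.contDiff φ.hasCompactSupport,
      h1 x hx, one_mul]

theorem SuppIn.dzbarTest_cutTransform {u : TestC →L[ℂ] ℂ} {L : Set ℂ} (h : SuppIn u L) {κ : TestC}
    {W : Set ℂ} (hW : IsOpen W) (hLW : L ⊆ W) (h1 : ∀ x ∈ W, κ x = 1) (φ : TestC) :
    u (dzbarTest (cutTransform κ φ)) = u φ :=
  h.congr hW hLW fun x hx => by
    rw [TemperedForms.dzbarTest_cutTransform, dzbarTest_eq_zero_of_eq_one hW h1 hx, h1 x hx,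
      zero_mul, one_mul, zero_add]

/-- Independence of the cutoff makes the primitives built for different `ε` comparable. -/
theorem SuppIn.cutTransform_congr {u : TestC →L[ℂ] ℂ} {L : Set ℂ} (h : SuppIn u L) {κ κ' : TestC}
    {W W' : Set ℂ} (hW : IsOpen W) (hLW : L ⊆ W) (h1 : ∀ x ∈ W, κ x = 1)
    (hW' : IsOpen W') (hLW' : L ⊆ W') (h1' : ∀ x ∈ W', κ' x = 1) (φ : TestC) :
    u (cutTransform κ φ) = u (cutTransform κ' φ) :=
  h.congr (hW.inter hW') (Set.subset_inter hLW hLW') fun x hx => by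
    rw [cutTransform_apply, cutTransform_apply, h1 x hx.1, h1' x hx.2]

/-- The function `x ↦ ∫ G(y) / (π (y - x)) dy`. -/
noncomputable def kernelIntegral (G : ℂ → ℂ) (x : ℂ) : ℂ := ∫ y, G y * cauchyKernel (y - x)

theorem cauchyTransform_eq (φ : ℂ → ℂ) (y : ℂ) :
    cauchyTransform φ y = ∫ x, cauchyKernel (y - x) * φ x := by
  rw [cauchyTransform_apply, ← integral_sub_left_eq_self _ volume y]
  simp

theorem measurable_cauchyKernel : Measurable cauchyKernel :=
  (measurable_const.mul measurable_id).inv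

/-- Fubini, which is legitimate because the kernel is bounded on the product of the disjoint compact
sets `M` and `tsupport φ`. -/
theorem integral_mul_cauchyTransform {G : ℂ → ℂ} (hG : Integrable G) {M : Set ℂ}
    (hM : IsCompact M) (hGM : ∀ y ∉ M, G y = 0) (φ : TestC) (hφ : Disjoint (tsupport φ) M) :
    ∫ y, G y * cauchyTransform φ y = ∫ x, φ x * kernelIntegral G x := by
  have hφi : Integrable (φ : ℂ → ℂ) := φ.continuous.integrable_of_hasCompactSupport
    φ.hasCompactSupport
  obtain ⟨C, hC⟩ : ∃ C, ∀ p ∈ M ×ˢ tsupport φ, ‖cauchyKernel (p.1 - p.2)‖ ≤ C := by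
    refine (hM.prod φ.hasCompactSupport).exists_bound_of_continuousOn
      (f := fun p : ℂ × ℂ => cauchyKernel (p.1 - p.2)) ?_
    refine ContinuousOn.inv₀ (by fun_prop) fun p hp => mul_ne_zero ?_ ?_
    · exact_mod_cast Real.pi_ne_zero
    · exact sub_ne_zero.2 fun h => Set.disjoint_left.1 hφ hp.2 (h ▸ hp.1)
  have hint : Integrable (fun p : ℂ × ℂ => G p.1 * (cauchyKernel (p.1 - p.2) * φ p.2))
      (volume.prod volume) := by
    refine Integrable.mono' ((hG.norm.mul_prod hφi.norm).const_mul C) ?_ (ae_of_all _ fun p => ?_)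
    · exact hG.aestronglyMeasurable.comp_fst.mul
        ((measurable_cauchyKernel.comp (measurable_fst.sub measurable_snd)).aestronglyMeasurable.mul
          hφi.aestronglyMeasurable.comp_snd)
    · by_cases h1 : p.1 ∈ M
      · by_cases h2 : p.2 ∈ tsupport φ
        · have := hC p ⟨h1, h2⟩
          rw [norm_mul, norm_mul]
          calc _ ≤ ‖G p.1‖ * (C * ‖φ p.2‖) := by gcongr
            _ = _ := by ring
        · simp [image_eq_zero_of_notMem_tsupport h2]
      · simp [hGM _ h1]
  calc ∫ y, G y * cauchyTransform φ y
      = ∫ y, ∫ x, G y * (cauchyKernel (y - x) * φ x) := by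
        simp only [cauchyTransform_eq, integral_const_mul]
    _ = ∫ x, ∫ y, G y * (cauchyKernel (y - x) * φ x) := integral_integral_swap hint
    _ = _ := by
        simp only [kernelIntegral, ← integral_const_mul]
        congr 1; ext x; congr 1; ext y; ring

/-- Differentiation under the integral sign: near a point at distance `δ` from `M` the singularity
stays at distance at least `δ / 2`. -/
theorem differentiableOn_kernelIntegral {G : ℂ → ℂ} (hG : Integrable G) {M : Set ℂ}
    (hM : IsClosed M) (hGM : ∀ y ∉ M, G y = 0) :
    DifferentiableOn ℂ (kernelIntegral G) Mᶜ := by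
  intro x₀ hx₀
  refine DifferentiableAt.differentiableWithinAt ?_
  obtain ⟨δ, hδ, hball⟩ := Metric.isOpen_iff.1 hM.isOpen_compl x₀ hx₀
  have hfar : ∀ y ∈ M, ∀ x ∈ Metric.ball x₀ (δ / 2), δ / 2 ≤ ‖y - x‖ := by
    intro y hy x hx
    by_contra! h
    refine hball (a := y) ?_ hy
    rw [Metric.mem_ball] at hx ⊢
    rw [← dist_eq_norm] at h
    linarith [dist_triangle y x x₀]
  have hpi : (Real.pi : ℂ) ≠ 0 := by exact_mod_cast Real.pi_ne_zero
  have hk : ∀ y ∈ M, ∀ x ∈ Metric.ball x₀ (δ / 2), HasDerivAt (fun x => cauchyKernel (y - x))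
      (Real.pi / (Real.pi * (y - x)) ^ 2) x := by
    intro y hy x hx
    have hne : (Real.pi : ℂ) * (y - x) ≠ 0 := mul_ne_zero hpi fun h0 => by
      have := hfar y hy x hx
      rw [h0, norm_zero] at this
      linarith
    have h1 : HasDerivAt (fun x : ℂ => (Real.pi : ℂ) * (y - x)) (-Real.pi) x := by
      simpa using ((hasDerivAt_id x).const_sub y).const_mul (Real.pi : ℂ)
    simpa [cauchyKernel, Pi.inv_def] using h1.fun_inv hne
  have hmeas : ∀ x, AEStronglyMeasurable fun y => cauchyKernel (y - x) := fun x =>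
    (measurable_cauchyKernel.comp (measurable_id.sub_const x)).aestronglyMeasurable
  have h := hasDerivAt_integral_of_dominated_loc_of_deriv_le (μ := volume)
    (F := fun x y => G y * cauchyKernel (y - x))
    (F' := fun x y => G y * (Real.pi / (Real.pi * (y - x)) ^ 2))
    (bound := fun y => ‖G y‖ * (Real.pi / (Real.pi * (δ / 2)) ^ 2))
    (Metric.ball_mem_nhds x₀ (half_pos hδ))
    (Filter.Eventually.of_forall fun x => hG.aestronglyMeasurable.mul (hmeas x))
    ?_ ?_ ?_ (hG.norm.mul_const _) ?_
  · exact h.2.differentiableAt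
  · refine Integrable.mono' (hG.norm.mul_const (Real.pi * (δ / 2))⁻¹)
      (hG.aestronglyMeasurable.mul (hmeas x₀)) (ae_of_all _ fun y => ?_)
    by_cases hy : y ∈ M
    · have := hfar y hy x₀ (Metric.mem_ball_self (half_pos hδ))
      rw [norm_mul, cauchyKernel, norm_inv, norm_mul, Complex.norm_real,
        Real.norm_of_nonneg Real.pi_pos.le]
      have := Real.pi_pos
      gcongr
    · simp [hGM y hy]
  · refine hG.aestronglyMeasurable.mul (Measurable.aestronglyMeasurable ?_)
    fun_prop
  · refine ae_of_all _ fun y x hx => ?_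
    by_cases hy : y ∈ M
    · have := hfar y hy x hx
      rw [norm_mul, norm_div, norm_pow, norm_mul, Complex.norm_real,
        Real.norm_of_nonneg Real.pi_pos.le]
      have := Real.pi_pos
      gcongr
    · simp [hGM y hy]
  · refine ae_of_all _ fun y x hx => ?_
    by_cases hy : y ∈ M
    · exact (hk y hy x hx).const_mul _
    · simpa [hGM y hy] using hasDerivAt_const x (0 : ℂ)

/-- For `‖y‖ ≤ R` and `‖x‖ > 2R` one has `‖y - x‖ ≥ ‖x‖ / 2`; the factor `1 / π` of the kernel is
simply bounded by `1`. -/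
theorem exists_norm_kernelIntegral_le (G : ℂ → ℂ) (hG : Integrable G) {R : ℝ}
    (hGM : ∀ y, R < ‖y‖ → G y = 0) :
    ∃ C : ℝ, ∀ x, 2 * R < ‖x‖ → ‖kernelIntegral G x‖ ≤ C * ‖x‖⁻¹ := by
  refine ⟨∫ y, ‖G y‖ * 2, fun x hx => ?_⟩
  rw [← integral_mul_const]
  refine norm_integral_le_of_norm_le ((hG.norm.mul_const _).mul_const _) (ae_of_all _ fun y => ?_)
  by_cases hy : R < ‖y‖
  · simp [hGM y hy]
  · have hx0 : 0 < ‖x‖ := by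
      by_contra! h
      have : ‖x‖ = 0 := le_antisymm h (norm_nonneg _)
      linarith [norm_nonneg y]
    have h1 : ‖x‖ / 2 ≤ ‖y - x‖ := by
      have := norm_sub_norm_le x y
      rw [norm_sub_rev] at this
      linarith
    rw [norm_mul, cauchyKernel, norm_inv, norm_mul, Complex.norm_real,
        Real.norm_of_nonneg Real.pi_pos.le, mul_assoc]
    gcongr
    rw [← div_eq_mul_inv, ← inv_div]
    refine inv_anti₀ (by positivity) (h1.trans ?_)
    exact le_mul_of_one_le_left (norm_nonneg _) (by linarith [Real.pi_gt_three])

end Distributions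

/-! ### Weyl's lemma for the Cauchy-Riemann operator. -/

section Weyl

open MeasureTheory Convolution

/-- A linear functional which is dominated by the norm of its image under a linear map to a Hilbert
space is represented by a vector. -/
theorem exists_inner_eq_of_le {X H : Type*} [AddCommGroup X] [Module ℂ X] [NormedAddCommGroup H]
    [InnerProductSpace ℂ H] [CompleteSpace H] (J : X →ₗ[ℂ] H) (T : X →ₗ[ℂ] ℂ) {C : ℝ}
    (hT : ∀ x, ‖T x‖ ≤ C * ‖J x‖) : ∃ g : H, ∀ x, T x = inner ℂ g (J x) := by
  -- The section `s` chooses preimages linearly. The estimate forces `T` to vanish on the kernel of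
  -- `J`, so `T ∘ s` is a bounded functional on the range of `J`; Hahn-Banach and Riesz do the rest.
  obtain ⟨s, hs⟩ := J.rangeRestrict.exists_rightInverse_of_surjective J.range_rangeRestrict
  have hs' : ∀ y : LinearMap.range J, J (s y) = y := fun y => by
    have := LinearMap.congr_fun hs y
    exact congrArg Subtype.val this
  let f : LinearMap.range J →L[ℂ] ℂ := LinearMap.mkContinuous (T ∘ₗ s) C fun y => by
    refine (hT _).trans (le_of_eq ?_)
    rw [hs']; rfl
  obtain ⟨g, hg, -⟩ := exists_extension_norm_eq (LinearMap.range J) f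
  refine ⟨(InnerProductSpace.toDual ℂ H).symm g, fun x => ?_⟩
  rw [InnerProductSpace.toDual_symm_apply]
  have h1 := hg ⟨J x, x, rfl⟩
  rw [h1]
  change T x = T (s ⟨J x, x, rfl⟩)
  rw [← sub_eq_zero, ← map_sub, ← norm_le_zero_iff]
  refine (hT _).trans (le_of_eq ?_)
  rw [map_sub, hs', sub_self, norm_zero, mul_zero]

theorem TestC.memLp (φ : TestC) : MemLp (φ : ℂ → ℂ) 2 :=
  φ.continuous.memLp_of_hasCompactSupport φ.hasCompactSupport

/-- On the compact set `L` the `L¹` norm is bounded by a multiple of the `L²` norm by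
Cauchy-Schwarz, so the density can be found by Hilbert space duality. -/
theorem exists_L2_of_le {T : TestC →L[ℂ] ℂ} {L : Set ℂ} (hL : IsCompact L) {C : ℝ} (hC : 0 ≤ C)
    (hT : ∀ φ : TestC, tsupport φ ⊆ L → ‖T φ‖ ≤ C * ∫ x, ‖φ x‖) :
    ∃ g : ℂ → ℂ, LocallyIntegrable g ∧ ∀ φ : TestC, tsupport φ ⊆ L → T φ = ∫ x, g x * φ x := by
  let D : Submodule ℂ TestC :=
    { carrier := {φ | ∀ x ∉ L, φ x = 0}
      add_mem' := fun {f g} hf hg x hx => by rw [add_apply, hf x hx, hg x hx, add_zero]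
      zero_mem' := fun x _ => rfl
      smul_mem' := fun c f hf x hx => by rw [smul_apply, hf x hx, smul_zero] }
  have hD : ∀ φ : TestC, φ ∈ D → tsupport φ ⊆ L := fun φ hφ =>
    closure_minimal (fun x hx => by by_contra h; exact hx (hφ x h)) hL.isClosed
  let J : D →ₗ[ℂ] Lp ℂ 2 (volume : Measure ℂ) :=
    { toFun := fun φ => (TestC.memLp φ.1).toLp _
      map_add' := fun f g => MemLp.toLp_add _ _
      map_smul' := fun c f => MemLp.toLp_const_smul c _ }
  have hfin : volume L < ⊤ := hL.measure_lt_top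
  have hbound : ∀ φ : D, ‖(T.toLinearMap ∘ₗ D.subtype) φ‖ ≤
      (C * (volume L ^ (1 / 2 : ℝ)).toReal) * ‖J φ‖ := by
    intro φ
    refine (hT φ.1 (hD _ φ.2)).trans ?_
    rw [mul_assoc]
    refine mul_le_mul_of_nonneg_left ?_ hC
    have h1 : ∫ x, ‖φ.1 x‖ = ∫ x in L, ‖φ.1 x‖ :=
      (setIntegral_eq_integral_of_forall_compl_eq_zero fun x hx => by
        rw [φ.2 x hx, norm_zero]).symm
    have h2 : eLpNorm φ.1 1 (volume.restrict L) ≤ eLpNorm φ.1 2 volume * volume L ^ (1 / 2 : ℝ) := by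
      refine (eLpNorm_le_eLpNorm_mul_rpow_measure_univ (q := 2) (by norm_num)
        φ.1.continuous.aestronglyMeasurable).trans ?_
      rw [Measure.restrict_apply_univ]
      refine mul_le_mul' (eLpNorm_restrict_le _ _ _ _) (le_of_eq ?_)
      norm_num
    have h3 : ‖J φ‖ = (eLpNorm φ.1 2 volume).toReal :=
      Lp.norm_toLp _ (TestC.memLp φ.1)
    have h4 : ∫ x in L, ‖φ.1 x‖ = (eLpNorm φ.1 1 (volume.restrict L)).toReal := by
      rw [eLpNorm_one_eq_lintegral_enorm,
        integral_norm_eq_lintegral_enorm φ.1.continuous.aestronglyMeasurable]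
    rw [h1, h3, h4, mul_comm, ← ENNReal.toReal_mul]
    refine ENNReal.toReal_mono (ENNReal.mul_ne_top (TestC.memLp φ.1).2.ne ?_) h2
    exact ENNReal.rpow_ne_top_of_nonneg (by norm_num) hfin.ne
  obtain ⟨g, hg⟩ := exists_inner_eq_of_le J (T.toLinearMap ∘ₗ D.subtype) hbound
  -- The inner product is conjugate-linear in its first argument, so the density is the conjugate of
  -- the representing vector.
  refine ⟨fun x => starRingEnd ℂ (g x), ?_, fun φ hφ => ?_⟩
  · have := (Lp.memLp g).star.locallyIntegrable (by norm_num : (1 : ENNReal) ≤ 2)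
    exact this
  · have hmem : φ ∈ D := fun x hx => image_eq_zero_of_notMem_tsupport fun h => hx (hφ h)
    have h1 : T φ = inner ℂ g (J ⟨φ, hmem⟩) := hg ⟨φ, hmem⟩
    rw [h1, L2.inner_def]
    refine integral_congr_ae ?_
    filter_upwards [(TestC.memLp φ).coeFn_toLp] with x hx
    change inner ℂ (g x) (((TestC.memLp φ).toLp φ : Lp ℂ 2 volume) x) = _
    rw [hx, RCLike.inner_apply, mul_comm]

/-- The operator `φ ↦ κ · P φ` is bounded from `L¹` to `C^n` on functions supported away from the
support of `κ`. -/
theorem exists_bound_cutTransform (κ : TestC) {L : Set ℂ} (hL : IsCompact L)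
    (hκL : Disjoint (tsupport κ) L) (N : ℕ) :
    ∃ C : ℝ, 0 ≤ C ∧ ∀ φ : TestC, tsupport φ ⊆ L →
      ∀ n ≤ N, ∀ x, ‖iteratedFDeriv ℝ n (cutTransform κ φ) x‖ ≤ C * ∫ y, ‖φ y‖ := by
  set S : Set ℂ := (fun p : ℂ × ℂ => p.1 - p.2) '' (tsupport κ ×ˢ L) with hSdef
  have hS : IsCompact S := (IsCompact.prod κ.hasCompactSupport hL).image continuous_sub
  have hS0 : S ⊆ {0}ᶜ := by
    rintro _ ⟨p, hp, rfl⟩ h0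
    exact Set.disjoint_left.1 hκL hp.1 (sub_eq_zero.1 h0 ▸ hp.2)
  -- The differences `x - y` with `x ∈ tsupport κ` and `y ∈ L` avoid `0`. Multiplying the kernel by
  -- a `θ` that is `1` on them and `0` near the origin changes nothing in `κ · Pφ` and makes the
  -- kernel smooth, so that derivatives can fall on it instead of on `φ`.
  obtain ⟨θ, hθ0, W, -, hSW, hθ1⟩ := exists_test_cutoff hS isOpen_compl_singleton hS0
  set k : ℂ → ℂ := fun t => θ t * cauchyKernel t with hk
  have hkc : HasCompactSupport k := θ.hasCompactSupport.mul_right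
  have hpi : (Real.pi : ℂ) ≠ 0 := by exact_mod_cast Real.pi_ne_zero
  have hks : ContDiff ℝ (⊤ : ℕ∞) k := by
    rw [contDiff_iff_contDiffAt]
    intro t
    by_cases ht : t = 0
    · have h0 : k =ᶠ[nhds t] fun _ => 0 := by
        filter_upwards [(isClosed_tsupport θ).isOpen_compl.mem_nhds
          (fun h => hθ0 h ht : t ∈ (tsupport θ)ᶜ)] with s hs
        rw [hk]
        simp [image_eq_zero_of_notMem_tsupport hs]
      exact contDiffAt_const.congr_of_eventuallyEq h0
    · refine θ.contDiff.contDiffAt.mul ?_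
      exact ContDiffAt.inv (by fun_prop) (mul_ne_zero hpi ht)
  obtain ⟨D, hD0, hD⟩ := TestFunction.exists_bound κ.contDiff κ.hasCompactSupport N
  obtain ⟨D', hD'0, hD'⟩ := TestFunction.exists_bound hks hkc N
  set c : ℝ := ‖ContinuousLinearMap.mul ℝ ℂ‖
  refine ⟨∑ n ∈ Finset.range (N + 1), ∑ i ∈ Finset.range (n + 1), (n.choose i : ℝ) * D * (c * D'),
    by positivity, fun φ hφ n hn x => ?_⟩
  have hφi : Integrable (φ : ℂ → ℂ) := φ.continuous.integrable_of_hasCompactSupport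
    φ.hasCompactSupport
  have hI : 0 ≤ ∫ y, ‖φ y‖ := integral_nonneg fun _ => norm_nonneg _
  have hsm : ContDiff ℝ (⊤ : ℕ∞) (φ ⋆[ContinuousLinearMap.mul ℝ ℂ] k) :=
    hkc.contDiff_convolution_right _ hφi.locallyIntegrable hks
  have heq : (cutTransform κ φ : ℂ → ℂ) =
      fun x => κ x * (φ ⋆[ContinuousLinearMap.mul ℝ ℂ] k) x := by
    ext x
    rw [cutTransform_apply]
    by_cases hx : x ∈ tsupport κ
    · rw [cauchyTransform_eq]
      congr 2
      ext y
      rw [ContinuousLinearMap.mul_apply', hk]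
      by_cases hy : y ∈ tsupport φ
      · have h1 : θ (x - y) = 1 := hθ1 _ (hSW ⟨(x, y), ⟨hx, hφ hy⟩, rfl⟩)
        simp only [h1, one_mul, mul_comm]
      · simp [image_eq_zero_of_notMem_tsupport hy]
    · simp [image_eq_zero_of_notMem_tsupport hx]
  rw [heq]
  refine (norm_iteratedFDeriv_mul_le κ.contDiff hsm x (mod_cast le_top)).trans ?_
  have h1 : ∀ i ∈ Finset.range (n + 1), (n.choose i : ℝ) * ‖iteratedFDeriv ℝ i κ x‖ *
      ‖iteratedFDeriv ℝ (n - i) (φ ⋆[ContinuousLinearMap.mul ℝ ℂ] k) x‖ ≤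
      (n.choose i : ℝ) * D * (c * D') * ∫ y, ‖φ y‖ := by
    intro i hi
    have hi' : i ≤ n := Nat.lt_succ_iff.1 (Finset.mem_range.1 hi)
    have h2 := hD i (hi'.trans hn) x
    have hQ : IsCompact ((fun t => x - t) '' tsupport k) :=
      IsCompact.image hkc (continuous_const.sub continuous_id)
    have h3 : ‖iteratedFDeriv ℝ (n - i) (φ ⋆[ContinuousLinearMap.mul ℝ ℂ] k) x‖ ≤
        c * (∫ t in (fun t => x - t) '' tsupport k, ‖φ t‖) * D' :=
      norm_iteratedFDeriv_convolution_le hφi.locallyIntegrable hQ (n - i) _ hks hkc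
        (fun t ht => ⟨x - t, ht, by simp⟩) D' (hD' _ ((Nat.sub_le _ _).trans hn))
    have h4 : ∫ t in (fun t => x - t) '' tsupport k, ‖φ t‖ ≤ ∫ t, ‖φ t‖ :=
      setIntegral_le_integral hφi.norm (ae_of_all _ fun _ => norm_nonneg _)
    calc _ ≤ (n.choose i : ℝ) * D * (c * (∫ t, ‖φ t‖) * D') := by
          gcongr
          exact h3.trans (by gcongr)
      _ = _ := by ring
  refine (Finset.sum_le_sum h1).trans ?_
  rw [← Finset.sum_mul]
  refine mul_le_mul_of_nonneg_right ?_ hI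
  exact Finset.single_le_sum
    (f := fun n => ∑ i ∈ Finset.range (n + 1), (n.choose i : ℝ) * D * (c * D'))
    (fun _ _ => by positivity) (Finset.mem_range.2 (Nat.lt_succ_of_le hn))

/-- Testing `∂̄T = 0` against `κ · Pφ` gives `T (∂̄κ · Pφ + φ) = 0`. The gain is that `φ ↦ ∂̄κ · Pφ`
is smoothing when `κ = 1` near the support of `φ`. -/
theorem eq_neg_cutTransform {T : TestC →L[ℂ] ℂ} {Ω : Set ℂ}
    (hT : ∀ φ : TestC, tsupport φ ⊆ Ω → T (dzbarTest φ) = 0) {κ : TestC} (hκ : tsupport κ ⊆ Ω)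
    {φ : TestC} (h1 : ∀ x ∈ tsupport φ, κ x = 1) :
    T φ = - T (cutTransform (dzbarTest κ) φ) := by
  have h2 : dzbarTest (cutTransform κ φ) = cutTransform (dzbarTest κ) φ + φ := by
    ext x
    rw [dzbarTest_cutTransform, add_apply, cutTransform_apply]
    congr 1
    by_cases hx : x ∈ tsupport φ
    · rw [h1 x hx, one_mul]
    · simp [image_eq_zero_of_notMem_tsupport hx]
  have h3 := hT _ ((tsupport_cutTransform_subset κ φ).trans hκ)
  rw [h2, map_add] at h3
  linear_combination h3

theorem disjoint_tsupport_dzbarTest {κ : TestC} {W : Set ℂ} (hW : IsOpen W)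
    (h1 : ∀ x ∈ W, κ x = 1) : Disjoint (tsupport (dzbarTest κ)) W := by
  refine Disjoint.mono_left ?_ (disjoint_compl_left (a := W))
  exact closure_minimal (fun x hx hxW => hx (dzbarTest_eq_zero_of_eq_one hW h1 hxW))
    hW.isClosed_compl

/-- First regularity gain: `T` has finite order `N` on the support of `∂̄κ`, while `φ ↦ ∂̄κ · Pφ`
maps `L¹` to `C^N` there. So `T` is bounded in the `L¹` norm on functions supported in `L`. -/
theorem exists_locallyIntegrable_of_dzbar_eq_zero {T : TestC →L[ℂ] ℂ} {Ω : Set ℂ} (hΩ : IsOpen Ω)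
    (hT : ∀ φ : TestC, tsupport φ ⊆ Ω → T (dzbarTest φ) = 0) {L : Set ℂ} (hL : IsCompact L)
    (hLΩ : L ⊆ Ω) :
    ∃ g : ℂ → ℂ, LocallyIntegrable g ∧ ∀ φ : TestC, tsupport φ ⊆ L → T φ = ∫ x, g x * φ x := by
  obtain ⟨κ, hκ, W, hW, hLW, h1⟩ := exists_test_cutoff hL hΩ hLΩ
  have hdis := (disjoint_tsupport_dzbarTest hW h1).mono_right hLW
  obtain ⟨C, N, hC, hTb⟩ := exists_bound_of_compact T
    ⟨tsupport (dzbarTest κ), (dzbarTest κ).hasCompactSupport⟩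
  obtain ⟨C', hC', hb⟩ := exists_bound_cutTransform (dzbarTest κ) hL hdis N
  refine exists_L2_of_le hL (mul_nonneg hC hC') fun φ hφ => ?_
  rw [eq_neg_cutTransform hT hκ fun x hx => h1 x (hLW (hφ hx)), norm_neg, mul_assoc]
  exact hTb _ _ (tsupport_cutTransform_subset _ _) (hb φ hφ)

/-- If `T = g` near the support of `∂̄κ` and `∂̄T = 0` on the support of `κ`, then `T` is given by
a Cauchy integral where `κ = 1`. -/
theorem eq_integral_kernelIntegral {T : TestC →L[ℂ] ℂ} {κ : TestC} {g : ℂ → ℂ}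
    (hg : Integrable fun y => g y * dzbarTest κ y)
    (hTg : ∀ φ : TestC, tsupport φ ⊆ tsupport (dzbarTest κ) → T φ = ∫ x, g x * φ x)
    {φ : TestC} (hφ : Disjoint (tsupport φ) (tsupport (dzbarTest κ))) :
    T (cutTransform (dzbarTest κ) φ) =
      ∫ x, φ x * kernelIntegral (fun y => g y * dzbarTest κ y) x := by
  rw [hTg _ (tsupport_cutTransform_subset _ _), ← integral_mul_cauchyTransform hg
    (dzbarTest κ).hasCompactSupport (fun y hy => by
      rw [image_eq_zero_of_notMem_tsupport hy, mul_zero]) φ hφ]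
  simp only [cutTransform_apply, mul_assoc]

theorem LocallyIntegrable.integrable_mul_test {g : ℂ → ℂ} (hg : LocallyIntegrable g) (φ : TestC) :
    Integrable fun y => g y * φ y := by
  have := hg.integrable_smul_right_of_hasCompactSupport φ.continuous φ.hasCompactSupport
  simpa only [smul_eq_mul] using this

/-- Second regularity gain: once `T` has a density `g`, the same identity and Fubini turn `T` into a
Cauchy integral of `g · ∂̄κ`, holomorphic where `κ` is locally constant. -/
theorem exists_differentiableOn_of_isCompact {T : TestC →L[ℂ] ℂ} {Ω : Set ℂ} (hΩ : IsOpen Ω)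
    (hT : ∀ φ : TestC, tsupport φ ⊆ Ω → T (dzbarTest φ) = 0) {L : Set ℂ} (hL : IsCompact L)
    (hLΩ : L ⊆ Ω) :
    ∃ h : ℂ → ℂ, DifferentiableOn ℂ h L ∧ ∀ φ : TestC, tsupport φ ⊆ L → T φ = ∫ x, φ x * h x := by
  -- The density is needed on the support of `∂̄κ`, which surrounds `L`; hence the larger compact
  -- set.
  obtain ⟨L', hL', hLL', hLΩ'⟩ := exists_compact_between hL hΩ hLΩ
  obtain ⟨g, hgi, hg⟩ := exists_locallyIntegrable_of_dzbar_eq_zero hΩ hT hL' hLΩ'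
  obtain ⟨κ, hκ, W, hW, hLW, h1⟩ := exists_test_cutoff hL isOpen_interior hLL'
  have hdis := (disjoint_tsupport_dzbarTest hW h1).mono_right hLW
  have hG := LocallyIntegrable.integrable_mul_test hgi (dzbarTest κ)
  have hκL : tsupport (dzbarTest κ) ⊆ L' :=
    (tsupport_dzbarTest_subset κ).trans (hκ.trans interior_subset)
  refine ⟨fun x => - kernelIntegral (fun y => g y * dzbarTest κ y) x, ?_, fun φ hφ => ?_⟩
  · refine ((differentiableOn_kernelIntegral hG (isClosed_tsupport _) fun y hy => ?_).mono
      fun x hx hx' => Set.disjoint_left.1 hdis hx' hx).neg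
    rw [image_eq_zero_of_notMem_tsupport hy, mul_zero]
  · rw [eq_neg_cutTransform hT (hκ.trans (interior_subset.trans hLΩ'))
      fun x hx => h1 x (hLW (hφ hx)), eq_integral_kernelIntegral hG
      (fun ψ hψ => hg ψ (hψ.trans hκL)) (hdis.symm.mono_left hφ), ← integral_neg]
    simp

theorem eqOn_of_integral_eq {f₁ f₂ : ℂ → ℂ} {U : Set ℂ} (hU : IsOpen U) (h₁ : ContinuousOn f₁ U)
    (h₂ : ContinuousOn f₂ U)
    (h : ∀ φ : TestC, tsupport φ ⊆ U → ∫ x, φ x * f₁ x = ∫ x, φ x * f₂ x) : Set.EqOn f₁ f₂ U := by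
  refine Measure.eqOn_open_of_ae_eq (μ := volume) ?_ hU h₁ h₂
  have hloc : ∀ f : ℂ → ℂ, ContinuousOn f U → LocallyIntegrableOn f U := fun f hf =>
    hf.locallyIntegrableOn hU.measurableSet
  have := hU.ae_eq_zero_of_integral_contDiff_smul_eq_zero (hloc _ (h₁.sub h₂)) (μ := volume) ?_
  · refine (ae_restrict_iff' hU.measurableSet).2 ?_
    filter_upwards [this] with x hx hxU using sub_eq_zero.1 (hx hxU)
  · intro g hg hgc hgU
    have hsub : tsupport (fun x => (g x : ℂ)) ⊆ tsupport g :=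
      tsupport_comp_subset (g := fun r : ℝ => (r : ℂ)) Complex.ofReal_zero g
    let φ : TestC := ⟨fun x => g x, Complex.ofRealCLM.contDiff.comp hg,
      hgc.of_isClosed_subset (isClosed_tsupport _) hsub, fun _ _ => trivial⟩
    have hi : ∀ f : ℂ → ℂ, ContinuousOn f U → Integrable fun x => φ x * f x := fun f hf => by
      let φ' : 𝓓((⟨U, hU⟩ : Opens ℂ), ℂ) := ⟨φ, φ.contDiff, φ.hasCompactSupport, hsub.trans hgU⟩
      exact TestFunction.integrable_bilin (ContinuousLinearMap.mul ℂ ℂ) (hloc f hf) φ'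
    have h3 := h φ (hsub.trans hgU)
    rw [← sub_eq_zero, ← integral_sub (hi _ h₁) (hi _ h₂)] at h3
    rw [← h3]
    refine integral_congr_ae (ae_of_all _ fun x => ?_)
    change g x • (f₁ x - f₂ x) = (g x : ℂ) * f₁ x - (g x : ℂ) * f₂ x
    rw [Complex.real_smul, mul_sub]

/-- Weyl's lemma for the Cauchy-Riemann operator: a distribution `T` with `∂̄T = 0` on `Ω` is given
by a holomorphic function on `Ω`. -/
theorem exists_holomorphic_of_dzbar_eq_zero {T : TestC →L[ℂ] ℂ} {Ω : Set ℂ} (hΩ : IsOpen Ω)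
    (hT : ∀ φ : TestC, tsupport φ ⊆ Ω → T (dzbarTest φ) = 0) :
    ∃ f : ℂ → ℂ, DifferentiableOn ℂ f Ω ∧
      ∀ φ : TestC, tsupport φ ⊆ Ω → T φ = ∫ x, φ x * f x := by
  have hex := fun (L : Compacts ℂ) (hLΩ : (L : Set ℂ) ⊆ Ω) =>
    exists_differentiableOn_of_isCompact hΩ hT L.isCompact hLΩ
  choose h hd hh using hex
  have hunique : ∀ (L : Compacts ℂ) (hL : (L : Set ℂ) ⊆ Ω) (L' : Compacts ℂ)
      (hL' : (L' : Set ℂ) ⊆ Ω), Set.EqOn (h L hL) (h L' hL') (interior L ∩ interior L') := by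
    intro L hL L' hL'
    refine eqOn_of_integral_eq (isOpen_interior.inter isOpen_interior)
      ((hd L hL).continuousOn.mono (Set.inter_subset_left.trans interior_subset))
      ((hd L' hL').continuousOn.mono (Set.inter_subset_right.trans interior_subset)) fun φ hφ => ?_
    rw [← hh L hL φ (hφ.trans (Set.inter_subset_left.trans interior_subset)),
      ← hh L' hL' φ (hφ.trans (Set.inter_subset_right.trans interior_subset))]
  have hball : ∀ x : Ω, ∃ L : Compacts ℂ, (L : Set ℂ) ⊆ Ω ∧ (x : ℂ) ∈ interior (L : Set ℂ) := by
    rintro ⟨x, hx⟩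
    obtain ⟨L, hL, hxL, hLΩ⟩ := exists_compact_between isCompact_singleton hΩ
      (Set.singleton_subset_iff.2 hx)
    exact ⟨⟨L, hL⟩, hLΩ, hxL rfl⟩
  choose B hB hxB using hball
  classical
  let f : ℂ → ℂ := fun x => if hx : x ∈ Ω then h (B ⟨x, hx⟩) (hB ⟨x, hx⟩) x else 0
  have hf : ∀ (L : Compacts ℂ) (hL : (L : Set ℂ) ⊆ Ω), Set.EqOn f (h L hL) (interior L) := by
    intro L hL x hx
    have hxΩ : x ∈ Ω := hL (interior_subset hx)
    simp only [f, dif_pos hxΩ]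
    exact hunique _ _ _ _ ⟨hxB ⟨x, hxΩ⟩, hx⟩
  refine ⟨f, fun x hx => ?_, fun φ hφ => ?_⟩
  · have h1 := (hd (B ⟨x, hx⟩) (hB ⟨x, hx⟩)).differentiableAt
      (mem_interior_iff_mem_nhds.1 (hxB ⟨x, hx⟩))
    refine (h1.congr_of_eventuallyEq ?_).differentiableWithinAt
    filter_upwards [isOpen_interior.mem_nhds (hxB ⟨x, hx⟩)] with y hy using hf _ _ hy
  · obtain ⟨L, hL, hφL, hLΩ⟩ := exists_compact_between φ.hasCompactSupport hΩ hφ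
    rw [hh ⟨L, hL⟩ hLΩ φ (hφL.trans interior_subset)]
    refine integral_congr_ae (ae_of_all _ fun x => ?_)
    by_cases hx : x ∈ tsupport φ
    · simp only [hf ⟨L, hL⟩ hLΩ (hφL hx)]
    · simp [image_eq_zero_of_notMem_tsupport hx]

end Weyl

/-! ### Extension of distributional forms across the point at infinity. -/

section Infinity

open MeasureTheory

/-- The gluing condition for `(1,0)`-forms, in the coordinates `x` and `w = 1 / x`. -/
def GlueC (T S : TestC →L[ℂ] ℂ) : Prop :=
  ∀ a b : TestC, 0 ∉ tsupport a → 0 ∉ tsupport b →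
    (∀ x w : ℂ, w * x = 1 → a x = -(starRingEnd ℂ w) ^ 2 * b w) → T a = S b

theorem GlueC.add {T S T' S' : TestC →L[ℂ] ℂ} (h : GlueC T S) (h' : GlueC T' S') :
    GlueC (T + T') (S + S') := fun a b ha hb hab => by
  rw [add_apply, add_apply, h a b ha hb hab, h' a b ha hb hab]

/-- A compactly supported distributional form extends to the projective line. -/
theorem SuppIn.exists_glueC {D : TestC →L[ℂ] ℂ} {R : ℝ}
    (hD : SuppIn D (Metric.closedBall 0 R)) : ∃ S, GlueC D S := by
  obtain ⟨ρ, -, W, hW, hRW, hρ⟩ := exists_test_cutoff (isCompact_closedBall (0 : ℂ) R) isOpen_univ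
    (Set.subset_univ _)
  -- `A` rewrites the coefficient `b` of a test form in the chart `w = 1 / x` as a coefficient in
  -- `x`, using `w̄ = 1 / x̄`. The cutoff `ρ`, equal to `1` near the support of `D`, makes the
  -- result compactly supported.
  obtain ⟨A, hA⟩ := exists_mulCompCLM (E := ℂ) (E' := ℂ)
    (fun x => ρ x * (-((starRingEnd ℂ x) ^ 2)⁻¹)) (fun x => x⁻¹) (fun K => by
    obtain ⟨M, hM⟩ := K.isCompact.isBounded.subset_closedBall (0 : ℂ)
    -- If `x⁻¹` lies in the ball of radius `M`, then `‖x‖` cannot be smaller than `r`, so the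
    -- pulled-back functions vanish near `0`; the summand `1` keeps `r` well defined when `M = 0`.
    set r : ℝ := (|M| + 1)⁻¹ with hr
    have hr0 : 0 < r := by positivity
    refine ⟨⟨tsupport ρ ∩ (Metric.ball 0 r)ᶜ,
      IsCompact.inter_right ρ.hasCompactSupport Metric.isOpen_ball.isClosed_compl⟩, {0}ᶜ,
      isOpen_compl_singleton, ?_, ?_, ?_, ?_⟩
    · rintro x ⟨-, hx⟩ rfl
      exact hx (Metric.mem_ball_self hr0)
    · refine ρ.contDiff.contDiffOn.mul (ContDiffOn.neg ?_)
      refine ContDiffOn.inv ?_ fun x hx => pow_ne_zero 2 ?_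
      · exact (Complex.conjCLE.contDiff.pow 2).contDiffOn
      · exact (map_ne_zero _).2 hx
    · exact contDiffOn_inv ℝ
    · intro x hx
      by_cases hx1 : x ∈ tsupport ρ
      · by_cases hx0 : x = 0
        · left; simp [hx0]
        · right
          have hx2 : ‖x‖ < r := by
            by_contra h
            exact hx ⟨hx1, fun h' => h (mem_ball_zero_iff.1 h')⟩
          intro hxK
          have h3 := mem_closedBall_zero_iff.1 (hM hxK)
          rw [norm_inv] at h3
          have h4 : |M| + 1 < ‖x‖⁻¹ := by
            rw [← inv_inv (|M| + 1)]
            exact (inv_lt_inv₀ hr0 (norm_pos_iff.2 hx0)).2 hx2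
          linarith [le_abs_self M]
      · left
        rw [image_eq_zero_of_notMem_tsupport hx1, zero_mul])
  refine ⟨D ∘L A, fun a b ha hb hab => ?_⟩
  refine hD.congr hW hRW fun x hx => ?_
  change a x = A b x
  rw [hA, hρ x hx, one_mul]
  by_cases hx0 : x = 0
  · rw [hx0, image_eq_zero_of_notMem_tsupport ha]
    simp
  · rw [hab x x⁻¹ (inv_mul_cancel₀ hx0), map_inv₀, inv_pow]

/-- The functional `φ ↦ ∫ φ g`. -/
noncomputable def intTest (g : ℂ → ℂ) : TestC →L[ℂ] ℂ :=
  TestFunction.integralAgainstBilinCLM (ContinuousLinearMap.mul ℂ ℂ) volume g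

theorem intTest_apply {g : ℂ → ℂ} (hg : LocallyIntegrable g) (φ : TestC) :
    intTest g φ = ∫ x, φ x * g x :=
  TestFunction.integralAgainstBilinCLM_eq_integral (hg.locallyIntegrableOn _)

/-- The real Jacobian of `w ↦ 1 / w` is the squared modulus of its complex derivative `-w⁻²`. -/
theorem integral_inv_change (F : ℂ → ℂ) :
    ∫ x, F x = ∫ w, (((‖w‖ ^ 4)⁻¹ : ℝ) : ℂ) * F w⁻¹ := by
  have hae : ∀ G : ℂ → ℂ, ∫ x, G x = ∫ x in ({0}ᶜ : Set ℂ), G x := fun G => by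
    rw [← setIntegral_univ]
    refine setIntegral_congr_set ?_
    exact (ae_eq_univ.2 (by simp)).symm
  have hd : ∀ w ∈ ({0}ᶜ : Set ℂ), HasFDerivWithinAt (𝕜 := ℝ) (fun w : ℂ => w⁻¹)
      ((ContinuousLinearMap.toSpanSingleton ℂ (-(w ^ 2)⁻¹)).restrictScalars ℝ) {0}ᶜ w :=
    fun w hw => ((hasDerivAt_inv hw).hasFDerivAt.restrictScalars ℝ).hasFDerivWithinAt
  have h := integral_image_eq_integral_abs_det_fderiv_smul volume
    (MeasurableSet.compl (measurableSet_singleton (0 : ℂ))) hd inv_injective.injOn F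
  have himg : (fun w : ℂ => w⁻¹) '' {0}ᶜ = {0}ᶜ := by
    ext x
    constructor
    · rintro ⟨w, hw, rfl⟩
      exact inv_ne_zero hw
    · exact fun hx => ⟨x⁻¹, inv_ne_zero hx, inv_inv x⟩
  rw [himg] at h
  rw [hae, h, hae]
  refine setIntegral_congr_fun (MeasurableSet.compl (measurableSet_singleton (0 : ℂ))) fun w hw => ?_
  have hdet : ((ContinuousLinearMap.toSpanSingleton ℂ (-(w ^ 2)⁻¹)).restrictScalars ℝ).det =
      (‖w‖ ^ 4)⁻¹ := by
    change LinearMap.det ((ContinuousLinearMap.toSpanSingleton ℂ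
      (-(w ^ 2)⁻¹)).toLinearMap.restrictScalars ℝ) = _
    rw [LinearMap.det_restrictScalars, LinearMap.det_ring]
    simp [Algebra.norm_complex_eq, Complex.normSq_eq_norm_sq]
    ring
  simp only [hdet]
  rw [abs_of_nonneg (by positivity), Complex.real_smul]

/-- A form which decays at infinity extends to the projective line. -/
theorem exists_glueC_intTest {h : ℂ → ℂ} (hm : Measurable h) {C : ℝ}
    (hh : ∀ x, ‖h x‖ ≤ C * ‖x‖⁻¹) : ∃ S, GlueC (intTest h) S := by
  have hF : LocallyIntegrable fun w : ℂ => -(w ^ 2)⁻¹ * h w⁻¹ := by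
    refine locallyIntegrable_of_norm_le (C := C) ?_ fun w => ?_
    · exact Measurable.aestronglyMeasurable (by fun_prop)
    · rw [norm_mul, norm_neg, norm_inv, norm_pow]
      by_cases hw : w = 0
      · simp [hw]
      · have := hh w⁻¹
        rw [norm_inv, inv_inv] at this
        have hw' : 0 < ‖w‖ := norm_pos_iff.2 hw
        calc _ ≤ (‖w‖ ^ 2)⁻¹ * (C * ‖w‖) := by gcongr
          _ = _ := by field_simp
  -- This is the coefficient of `h dx` in the other chart, since `dx = -dw / w²`.
  refine ⟨intTest fun w : ℂ => -(w ^ 2)⁻¹ * h w⁻¹, fun a b ha hb hab => ?_⟩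
  rw [intTest_apply (locallyIntegrable_of_norm_le hm.aestronglyMeasurable hh), intTest_apply hF,
    integral_inv_change]
  refine integral_congr_ae (ae_of_all _ fun w => ?_)
  by_cases hw : w = 0
  · simp [hw]
  · simp only [hab w⁻¹ w (mul_inv_cancel₀ hw)]
    have h1 : ((‖w‖ : ℝ) : ℂ) ^ 4 = w ^ 2 * (starRingEnd ℂ w) ^ 2 := by
      rw [← mul_pow, Complex.mul_conj, Complex.normSq_eq_norm_sq]
      push_cast
      ring
    have hw' : starRingEnd ℂ w ≠ 0 := (map_ne_zero _).2 hw
    push_cast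
    rw [h1]
    field_simp

end Infinity

/-! ### Cauchy transforms of compactly supported distributions near infinity. -/

section Holomorphic

open MeasureTheory

theorem integral_dzbar_eq_zero (φ : TestC) : ∫ x, dzbar φ x = 0 := by
  have hi : ∀ v : ℂ, Integrable fun x => fderiv ℝ φ x v := fun v =>
    ((φ.contDiff.continuous_fderiv (by simp)).clm_apply
      continuous_const).integrable_of_hasCompactSupport (φ.hasCompactSupport.fderiv_apply ℝ v)
  have h0 : ∀ v : ℂ, ∫ x, fderiv ℝ φ x v = 0 := fun v => by
    have h := integral_mul_fderiv_eq_neg_fderiv_mul_of_integrable (μ := (volume : Measure ℂ))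
      (f := fun _ : ℂ => (1 : ℂ)) (g := φ) (v := v) (by simp) (by simpa using hi v)
      (by simpa using φ.continuous.integrable_of_hasCompactSupport φ.hasCompactSupport)
      (fun x _ => differentiableAt_const _)
      (fun x _ => (φ.contDiff.differentiable (by simp)) x)
    simpa using h
  simp only [dzbar]
  rw [integral_div, integral_add (hi 1) ((hi _).const_mul _), integral_const_mul, h0, h0]
  simp

/-- Holomorphic functions are weak solutions of the Cauchy-Riemann equation. -/
theorem integral_dzbarTest_mul_eq_zero {f : ℂ → ℂ} {U : Set ℂ} (hU : IsOpen U)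
    (hf : DifferentiableOn ℂ f U) {φ : TestC} (hφ : tsupport φ ⊆ U) :
    ∫ x, dzbarTest φ x * f x = 0 := by
  have hz : ∀ x ∉ tsupport φ, (fun y => φ y * f y) =ᶠ[nhds x] fun _ => 0 := fun x hx => by
    filter_upwards [(isClosed_tsupport φ).isOpen_compl.mem_nhds hx] with y hy
    rw [image_eq_zero_of_notMem_tsupport hy, zero_mul]
  let ψ : TestC := ⟨fun x => φ x * f x, by
    rw [contDiff_iff_contDiffAt]
    intro x
    by_cases hx : x ∈ tsupport φ
    · refine φ.contDiff.contDiffAt.mul ?_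
      exact ((hf.contDiffOn hU).contDiffAt (hU.mem_nhds (hφ hx))).restrict_scalars ℝ
    · exact contDiffAt_const.congr_of_eventuallyEq (hz x hx),
    φ.hasCompactSupport.mul_right, fun _ _ => trivial⟩
  rw [← integral_dzbar_eq_zero ψ]
  refine integral_congr_ae (ae_of_all _ fun x => ?_)
  change dzbarTest φ x * f x = dzbar (fun x => φ x * f x) x
  by_cases hx : x ∈ tsupport φ
  · have hfx := hf.differentiableAt (hU.mem_nhds (hφ hx))
    rw [dzbar_mul ((φ.contDiff.differentiable (by simp)) x) (hfx.restrictScalars ℝ),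
      dzbar_eq_zero_of_differentiableAt hfx, dzbarTest_apply, mul_zero, add_zero]
  · rw [dzbar_congr (hz x hx), image_eq_zero_of_notMem_tsupport fun h =>
      hx (tsupport_dzbarTest_subset φ h), dzbar]
    simp

theorem integrable_mul_of_continuousOn {f : ℂ → ℂ} {U : Set ℂ} (hU : IsOpen U)
    (hf : ContinuousOn f U) {φ : TestC} (hφ : tsupport φ ⊆ U) :
    Integrable fun x => f x * φ x := by
  let φ' : 𝓓((⟨U, hU⟩ : Opens ℂ), ℂ) := ⟨φ, φ.contDiff, φ.hasCompactSupport, hφ⟩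
  have := TestFunction.integrable_bilin (ContinuousLinearMap.mul ℂ ℂ)
    (hf.locallyIntegrableOn hU.measurableSet (μ := volume)) φ'
  simpa only [ContinuousLinearMap.mul_apply', mul_comm] using! this

/-- The convolution of a compactly supported distribution with the fundamental solution extends to
the projective line. -/
theorem SuppIn.exists_glueC_cutTransform {u : TestC →L[ℂ] ℂ} {L : Set ℂ} (hL : IsCompact L)
    (hu : SuppIn u L) {κ : TestC} {W : Set ℂ} (hW : IsOpen W) (hLW : L ⊆ W)
    (h1 : ∀ x ∈ W, κ x = 1) : ∃ S, GlueC (u ∘L cutTransform κ) S := by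
  set η := u ∘L cutTransform κ with hη
  have hηu : ∀ φ, η (dzbarTest φ) = u φ := hu.cutTransform_dzbarTest hW hLW h1
  obtain ⟨f, hf, hfη⟩ := exists_holomorphic_of_dzbar_eq_zero (T := η) hL.isClosed.isOpen_compl
    fun φ hφ => by rw [hηu]; exact hu φ (Set.subset_compl_iff_disjoint_right.1 hφ)
  have hκ' : tsupport (dzbarTest κ) ⊆ Lᶜ :=
    Set.subset_compl_iff_disjoint_right.2 ((disjoint_tsupport_dzbarTest hW h1).mono_right hLW)
  set G : ℂ → ℂ := fun y => f y * dzbarTest κ y with hG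
  have hGi : Integrable G :=
    integrable_mul_of_continuousOn hL.isClosed.isOpen_compl hf.continuousOn hκ'
  have hG0 : ∀ y ∉ tsupport (dzbarTest κ), G y = 0 := fun y hy => by
    rw [hG]
    simp [image_eq_zero_of_notMem_tsupport hy]
  obtain ⟨R₀, hR₀⟩ := (HasCompactSupport.isCompact κ.hasCompactSupport).isBounded.subset_closedBall
    (0 : ℂ)
  set R := max R₀ 0
  have hR : tsupport κ ⊆ Metric.closedBall 0 R :=
    hR₀.trans (Metric.closedBall_subset_closedBall (le_max_left _ _))
  have hR0 : 0 ≤ R := le_max_right _ _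
  obtain ⟨C, hC⟩ := exists_norm_kernelIntegral_le G hGi (R := R) fun y hy =>
    hG0 y fun h => by
      have := mem_closedBall_zero_iff.1 (hR (tsupport_dzbarTest_subset κ h))
      linarith
  set U : Set ℂ := {x | 2 * R < ‖x‖}
  have hU : IsOpen U := isOpen_lt continuous_const continuous_norm
  have hUκ : Disjoint U (tsupport κ) := Set.disjoint_left.2 fun x hx hx' => by
    have := mem_closedBall_zero_iff.1 (hR hx')
    have hx2 : 2 * R < ‖x‖ := hx
    linarith
  have hcont : ContinuousOn (kernelIntegral G) U :=
    (differentiableOn_kernelIntegral hGi (isClosed_tsupport _) hG0).continuousOn.mono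
      fun x hx hx' => Set.disjoint_left.1 hUκ hx (tsupport_dzbarTest_subset κ hx')
  classical
  -- Only the behaviour near infinity matters. Setting `h` to zero on the ball makes the decay
  -- estimate global; the remaining difference `η - h` is compactly supported and extends to the
  -- projective line for that reason.
  set h : ℂ → ℂ := U.piecewise (kernelIntegral G) (fun _ => 0) with hh
  have hm : Measurable h := hcont.measurable_piecewise continuousOn_const hU.measurableSet
  have hC0 : 0 ≤ max C 0 := le_max_right _ _
  have hb : ∀ x, ‖h x‖ ≤ max C 0 * ‖x‖⁻¹ := by
    intro x
    by_cases hx : x ∈ U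
    · rw [hh, Set.piecewise_eq_of_mem _ _ _ hx]
      exact (hC x hx).trans (mul_le_mul_of_nonneg_right (le_max_left _ _) (by positivity))
    · rw [hh, Set.piecewise_eq_of_notMem _ _ _ hx, norm_zero]
      positivity
  obtain ⟨S, hS⟩ := exists_glueC_intTest hm hb
  have hsupp : SuppIn (η - intTest h) (Metric.closedBall 0 (2 * R)) := by
    intro φ hφ
    have hφU : tsupport φ ⊆ U := fun x hx => by
      have := Set.disjoint_left.1 hφ hx
      rw [mem_closedBall_zero_iff, not_le] at this
      exact this
    rw [sub_apply, sub_eq_zero, intTest_apply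
      (locallyIntegrable_of_norm_le hm.aestronglyMeasurable hb)]
    have hφκ : Disjoint (tsupport φ) (tsupport κ) := hUκ.mono_left hφU
    -- Far from the support of `κ` the term `κ · φ` drops out of the Leibniz rule. Hence `η φ = u (κ
    -- · Pφ) = η (∂̄(κ · Pφ)) = η (∂̄κ · Pφ)`, and `η` has the holomorphic density `f` on the
    -- support of `∂̄κ`.
    have h2 : dzbarTest (cutTransform κ φ) = cutTransform (dzbarTest κ) φ := by
      ext x
      rw [TemperedForms.dzbarTest_cutTransform, cutTransform_apply]
      by_cases hx : x ∈ tsupport φ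
      · rw [image_eq_zero_of_notMem_tsupport (Set.disjoint_left.1 hφκ hx), zero_mul, add_zero]
      · rw [image_eq_zero_of_notMem_tsupport hx, mul_zero, add_zero]
    have h3 : η φ = η (cutTransform (dzbarTest κ) φ) := by
      rw [← h2, hηu]; rfl
    rw [h3, eq_integral_kernelIntegral hGi
      (fun ψ hψ => by
        rw [hfη ψ (hψ.trans hκ')]
        simp only [mul_comm])
      (hφκ.mono_right (tsupport_dzbarTest_subset κ))]
    refine integral_congr_ae (ae_of_all _ fun x => ?_)
    by_cases hx : x ∈ tsupport φ
    · simp only [hh, Set.piecewise_eq_of_mem _ _ _ (hφU hx)]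
      rfl
    · simp [image_eq_zero_of_notMem_tsupport hx]
  obtain ⟨S', hS'⟩ := hsupp.exists_glueC
  exact ⟨S' + S, by simpa using hS'.add hS⟩

end Holomorphic

/-! ### Transport of currents on a complex line to functionals on `TestC`. -/

noncomputable section Transport

variable {E : Type*} [NormedAddCommGroup E] [NormedSpace ℂ E]

theorem exists_compCLM {E' : Type*} [NormedAddCommGroup E'] [NormedSpace ℂ E'] (c : E' ≃L[ℂ] E) :
    ∃ L : 𝓓((⊤ : Opens E), ℂ) →L[ℂ] 𝓓((⊤ : Opens E'), ℂ), ∀ φ x, L φ x = φ (c x) := by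
  obtain ⟨L, hL⟩ := exists_mulCompCLM (E := E) (E' := E') (fun _ => (1 : ℂ)) (fun x => c x)
    (fun K => ⟨K.map c.symm c.symm.continuous, Set.univ, isOpen_univ, Set.subset_univ _,
      contDiffOn_const, (c.toContinuousLinearMap.restrictScalars ℝ).contDiff.contDiffOn,
      fun x hx => Or.inr fun h => hx ⟨c x, h, c.symm_apply_apply x⟩⟩)
  exact ⟨L, fun φ x => by rw [hL, one_mul]⟩

/-- Pull-back of test functions along a linear coordinate. -/
def pull (c : E ≃L[ℂ] ℂ) : TestC →L[ℂ] 𝓓((⊤ : Opens E), ℂ) := (exists_compCLM c).choose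

theorem pull_apply (c : E ≃L[ℂ] ℂ) (a : TestC) (z : E) : pull c a z = a (c z) :=
  (exists_compCLM c).choose_spec a z

/-- Test functions on a line as functions of a linear coordinate. -/
def push (c : E ≃L[ℂ] ℂ) : 𝓓((⊤ : Opens E), ℂ) →L[ℂ] TestC := (exists_compCLM c.symm).choose

theorem push_apply (c : E ≃L[ℂ] ℂ) (φ : 𝓓((⊤ : Opens E), ℂ)) (x : ℂ) :
    push c φ x = φ (c.symm x) :=
  (exists_compCLM c.symm).choose_spec φ x

/-- The conjugate of a linear coordinate. -/
def conjCoord (c : E ≃L[ℂ] ℂ) : E →L⋆[ℂ] ℂ :=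
  (starL ℂ : ℂ ≃L⋆[ℂ] ℂ).toContinuousLinearMap.comp (c : E →L[ℂ] ℂ)

/-- The `(0,1)`-test form with coefficient `a` in a linear coordinate. -/
def pullForm (c : E ≃L[ℂ] ℂ) : TestC →L[ℂ] 𝓓((⊤ : Opens E), E →L⋆[ℂ] ℂ) :=
  TestFunction.postcompCLM (ContinuousLinearMap.toSpanSingleton ℂ (conjCoord c)) ∘L pull c

theorem pullForm_apply (c : E ≃L[ℂ] ℂ) (a : TestC) (z v : E) :
    pullForm c a z v = a (c z) * starRingEnd ℂ (c v) := by
  change (pull c a z • conjCoord c) v = _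
  rw [pull_apply]; rfl

/-- The coefficient of a `(0,1)`-test form in a linear coordinate. -/
def pushForm (c : E ≃L[ℂ] ℂ) : 𝓓((⊤ : Opens E), E →L⋆[ℂ] ℂ) →L[ℂ] TestC :=
  push c ∘L TestFunction.postcompCLM (ContinuousLinearMap.apply' ℂ (starRingEnd ℂ) (c.symm 1))

theorem pushForm_apply (c : E ≃L[ℂ] ℂ) (χ : 𝓓((⊤ : Opens E), E →L⋆[ℂ] ℂ)) (x : ℂ) :
    pushForm c χ x = χ (c.symm x) (c.symm 1) := by
  change push c _ x = _
  rw [push_apply]; rfl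

theorem pull_push (c : E ≃L[ℂ] ℂ) (φ : 𝓓((⊤ : Opens E), ℂ)) : pull c (push c φ) = φ := by
  ext z
  rw [pull_apply, push_apply, c.symm_apply_apply]

theorem pullForm_pushForm (c : E ≃L[ℂ] ℂ) (χ : 𝓓((⊤ : Opens E), E →L⋆[ℂ] ℂ)) :
    pullForm c (pushForm c χ) = χ := by
  ext z v
  rw [pullForm_apply, pushForm_apply, c.symm_apply_apply]
  have hv : v = c v • c.symm 1 := by
    rw [← map_smul, smul_eq_mul, mul_one, c.symm_apply_apply]
  conv_rhs => rw [hv, map_smulₛₗ]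
  rw [smul_eq_mul, mul_comm]

theorem pushForm_pullForm (c : E ≃L[ℂ] ℂ) (a : TestC) : pushForm c (pullForm c a) = a := by
  ext z
  rw [pushForm_apply, pullForm_apply, c.apply_symm_apply, c.apply_symm_apply, map_one, mul_one]

/-- The coordinate is complex-linear, so taking the conjugate-linear part of a differential commutes
with it; this reduces `∂̄` on `V` to `∂/∂z̄` on `ℂ`. -/
theorem dbarTest_pull (c : E ≃L[ℂ] ℂ) (a : TestC) :
    dbarTest ⊤ (pull c a) = pullForm c (dzbarTest a) := by
  ext z v
  have hc : HasFDerivAt (𝕜 := ℝ) (fun z => c z) (c.toContinuousLinearMap.restrictScalars ℝ) z :=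
    (c.toContinuousLinearMap.restrictScalars ℝ).hasFDerivAt
  have hd : HasFDerivAt (𝕜 := ℝ) (pull c a)
      ((fderiv ℝ a (c z)).comp (c.toContinuousLinearMap.restrictScalars ℝ)) z := by
    have h1 : (pull c a : E → ℂ) = a ∘ fun z => c z := funext fun z => pull_apply c a z
    rw [h1]
    exact ((a.contDiff.differentiable (by simp)) (c z)).hasFDerivAt.comp z hc
  rw [dbarTest_apply, hd.fderiv, pullForm_apply]
  have h2 : dzbarTest a (c z) = conjPart (fderiv ℝ a (c z)) 1 := by
    change dbarTest ⊤ a (c z) 1 = _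
    rw [dbarTest_apply]
  have h3 : conjPart (fderiv ℝ a (c z)) (c v) =
      starRingEnd ℂ (c v) • conjPart (fderiv ℝ a (c z)) 1 := by
    rw [← map_smulₛₗ, smul_eq_mul, mul_one]
  rw [h2, mul_comm, ← smul_eq_mul, ← h3, conjPart_apply, conjPart_apply]
  simp

theorem tsupport_pull_subset (c : E ≃L[ℂ] ℂ) (a : TestC) : tsupport (pull c a) ⊆ c ⁻¹' tsupport a :=
  closure_minimal (fun z hz => subset_tsupport _ fun h => hz (by rw [pull_apply, h]))
    ((isClosed_tsupport a).preimage c.continuous)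

theorem tsupport_pullForm_subset (c : E ≃L[ℂ] ℂ) (a : TestC) :
    tsupport (pullForm c a) ⊆ c ⁻¹' tsupport a :=
  closure_minimal (fun z hz => subset_tsupport _ fun h => hz (by
      ext v; rw [pullForm_apply, h, zero_mul]; rfl))
    ((isClosed_tsupport a).preimage c.continuous)

theorem tsupport_push_subset (c : E ≃L[ℂ] ℂ) (φ : 𝓓((⊤ : Opens E), ℂ)) :
    tsupport (push c φ) ⊆ c.symm ⁻¹' tsupport φ :=
  closure_minimal (fun z hz => subset_tsupport _ fun h => hz (by rw [push_apply, h]))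
    ((isClosed_tsupport φ).preimage c.symm.continuous)

theorem tsupport_pushForm_subset (c : E ≃L[ℂ] ℂ) (χ : 𝓓((⊤ : Opens E), E →L⋆[ℂ] ℂ)) :
    tsupport (pushForm c χ) ⊆ c.symm ⁻¹' tsupport χ :=
  closure_minimal (fun z hz => subset_tsupport _ fun h => hz (by rw [pushForm_apply, h]; rfl))
    ((isClosed_tsupport χ).preimage c.symm.continuous)

/-- The coordinate of the dual line that is dual to a given coordinate. -/
def dualCoord (c : E ≃L[ℂ] ℂ) : StrongDual ℂ E ≃L[ℂ] ℂ :=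
  ContinuousLinearEquiv.equivOfInverse
    (ContinuousLinearMap.apply ℂ ℂ (c.symm 1))
    (ContinuousLinearMap.toSpanSingleton ℂ (c : E →L[ℂ] ℂ))
    (fun ζ => by
      ext v
      change ζ (c.symm 1) * c v = ζ v
      rw [mul_comm, ← smul_eq_mul, ← map_smul, ← map_smul, smul_eq_mul, mul_one,
        c.symm_apply_apply])
    (fun w => by
      change w * c (c.symm 1) = w
      rw [c.apply_symm_apply, mul_one])

theorem dualCoord_symm_apply (c : E ≃L[ℂ] ℂ) (w : ℂ) (v : E) :
    (dualCoord c).symm w v = w * c v := rfl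

/-- In dual coordinates the change of charts is `w = 1 / x` and its differential is multiplication
by `-w²`. A `(0,1)`-form is conjugate-linear, whence the conjugated square in `GlueC`. -/
theorem GlueC.glue10 (c : E ≃L[ℂ] ℂ) {T : Current10 (⊤ : Opens E)} {S : TestC →L[ℂ] ℂ}
    (h : GlueC (T ∘L pullForm c) S) : Glue10 T (S ∘L pushForm (dualCoord c)) := by
  intro χ φ hχ hφ hχφ
  have := h (pushForm c χ) (pushForm (dualCoord c) φ)
    (fun h0 => hχ (by simpa using tsupport_pushForm_subset _ _ h0))
    (fun h0 => hφ (by simpa using tsupport_pushForm_subset _ _ h0)) ?_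
  · rw [ContinuousLinearMap.comp_apply, pullForm_pushForm] at this
    exact this
  · intro x w hwx
    rw [pushForm_apply, pushForm_apply,
      hχφ (c.symm x) ((dualCoord c).symm w) (by rw [dualCoord_symm_apply, c.apply_symm_apply, hwx])]
    have h2 : -((dualCoord c).symm w (c.symm 1)) • (dualCoord c).symm w =
        (-w ^ 2) • (dualCoord c).symm 1 := by
      ext v
      change -((dualCoord c).symm w (c.symm 1)) * (dualCoord c).symm w v =
        (-w ^ 2) * (dualCoord c).symm 1 v
      simp only [dualCoord_symm_apply, c.apply_symm_apply]
      ring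
    rw [h2, map_smulₛₗ, smul_eq_mul, map_neg, map_pow]

theorem mem_tempered10_of_glueC (c : E ≃L[ℂ] ℂ) {T : Current10 (⊤ : Opens E)}
    (h : ∃ S, GlueC (T ∘L pullForm c) S) : T ∈ Tempered10 ⊤ :=
  let ⟨_, hS⟩ := h
  ⟨T, _, hS.glue10 c, restrict10_top T⟩

theorem dbar_mem_tempered11 {T : Current10 (⊤ : Opens E)} (hT : T ∈ Tempered10 ⊤) :
    dbar ⊤ T ∈ Tempered11 ⊤ := by
  obtain ⟨T₀, S, hS, rfl⟩ := hT
  rw [restrict10_top]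
  exact ⟨dbar ⊤ T₀, dbar ⊤ S, hS.dbar, restrict11_top _⟩

/-! ### Restriction of currents and supports -/

section Restriction

variable {F : Type*} [NormedAddCommGroup F] [NormedSpace ℂ F]

theorem coe_monoCLM_top (Ω : Opens E) (χ : 𝓓(Ω, F)) :
    ((TestFunction.monoCLM ℂ χ : 𝓓((⊤ : Opens E), F)) : E → F) = χ := by
  simp

theorem exists_monoCLM_eq {Ω : Opens E} {χ : 𝓓((⊤ : Opens E), F)} (h : tsupport χ ⊆ Ω) :
    ∃ χ' : 𝓓(Ω, F), TestFunction.monoCLM ℂ χ' = χ := by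
  refine ⟨⟨χ, χ.contDiff, χ.hasCompactSupport, h⟩, ?_⟩
  ext z : 1
  rw [coe_monoCLM_top]; rfl

end Restriction

/-- `pullForm` and `pushForm` are inverse to each other and respect supports, so a current is tested
on coefficients in the coordinate. -/
theorem restrict10_eq_iff (c : E ≃L[ℂ] ℂ) (Ω : Opens E) (T : Current10 (⊤ : Opens E))
    (R : Current10 Ω) : restrict10 Ω T = R ↔
      ∀ χ : 𝓓(Ω, E →L⋆[ℂ] ℂ), ∀ φ : TestC, tsupport φ ⊆ c.symm ⁻¹' Ω →
        (∀ x, φ x = χ (c.symm x) (c.symm 1)) → T (pullForm c φ) = R χ := by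
  constructor
  · rintro rfl χ φ - hφ
    have : pushForm c (TestFunction.monoCLM ℂ χ) = φ := by
      ext x
      rw [pushForm_apply, coe_monoCLM_top, hφ]
    rw [← this, pullForm_pushForm]; rfl
  · intro h
    ext χ
    have := h χ (pushForm c (TestFunction.monoCLM ℂ χ))
      (fun x hx => χ.tsupport_subset (by simpa using tsupport_pushForm_subset _ _ hx))
      (fun x => by rw [pushForm_apply, coe_monoCLM_top])
    rw [pullForm_pushForm] at this
    exact this

theorem restrict10_eq_restrict10_iff (c : E ≃L[ℂ] ℂ) (Ω : Opens E)
    (T T' : Current10 (⊤ : Opens E)) : restrict10 Ω T = restrict10 Ω T' ↔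
      ∀ φ : TestC, tsupport φ ⊆ c.symm ⁻¹' Ω → T (pullForm c φ) = T' (pullForm c φ) := by
  constructor
  · intro h φ hφ
    obtain ⟨χ, hχ⟩ := exists_monoCLM_eq (Ω := Ω) (χ := pullForm c φ)
      ((tsupport_pullForm_subset c φ).trans fun z hz => by simpa using hφ hz)
    rw [← hχ]
    exact DFunLike.congr_fun h χ
  · intro h
    ext χ
    have := h (pushForm c (TestFunction.monoCLM ℂ χ))
      (fun x hx => χ.tsupport_subset (by simpa using tsupport_pushForm_subset _ _ hx))
    rwa [pullForm_pushForm] at this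

theorem restrict10_eq_zero_iff (c : E ≃L[ℂ] ℂ) (Ω : Opens E) (T : Current10 (⊤ : Opens E)) :
    restrict10 Ω T = 0 ↔ ∀ φ : TestC, tsupport φ ⊆ c.symm ⁻¹' Ω → T (pullForm c φ) = 0 := by
  simpa using restrict10_eq_restrict10_iff c Ω T 0

theorem restrict11_eq_zero_iff (c : E ≃L[ℂ] ℂ) (Ω : Opens E) (T : Current11 (⊤ : Opens E)) :
    restrict11 Ω T = 0 ↔ ∀ φ : TestC, tsupport φ ⊆ c.symm ⁻¹' Ω → T (pull c φ) = 0 := by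
  constructor
  · intro h φ hφ
    obtain ⟨χ, hχ⟩ := exists_monoCLM_eq (Ω := Ω) (χ := pull c φ)
      ((tsupport_pull_subset c φ).trans fun z hz => by simpa using hφ hz)
    rw [← hχ]
    exact DFunLike.congr_fun h χ
  · intro h
    ext χ
    have := h (push c (TestFunction.monoCLM ℂ χ))
      (fun x hx => χ.tsupport_subset (by simpa using tsupport_push_subset _ _ hx))
    rwa [pull_push] at this

theorem tsupport_subset_preimage_compl_iff {c : E ≃L[ℂ] ℂ} {Z : Closeds E} {φ : TestC} :
    tsupport φ ⊆ c.symm ⁻¹' (Z.compl : Set E) ↔ Disjoint (tsupport φ) (c.symm ⁻¹' Z) := by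
  rw [← Set.subset_compl_iff_disjoint_right]; rfl

theorem suppIn_of_restrict10_eq_zero (c : E ≃L[ℂ] ℂ) {Z : Closeds E} {T : Current10 (⊤ : Opens E)}
    (h : restrict10 Z.compl T = 0) : SuppIn (T ∘L pullForm c) (c.symm ⁻¹' Z) := fun φ hφ =>
  (restrict10_eq_zero_iff c _ T).1 h φ (tsupport_subset_preimage_compl_iff.2 hφ)

theorem suppIn_of_restrict11_eq_zero (c : E ≃L[ℂ] ℂ) {Z : Closeds E} {T : Current11 (⊤ : Opens E)}
    (h : restrict11 Z.compl T = 0) : SuppIn (T ∘L pull c) (c.symm ⁻¹' Z) := fun φ hφ =>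
  (restrict11_eq_zero_iff c _ T).1 h φ (tsupport_subset_preimage_compl_iff.2 hφ)

/-- Temperedness is a condition at infinity: `T - T₁` is compactly supported, hence extends to `P`.
-/
theorem mem_tempered10_of_restrict10_nearInfinity_eq (c : E ≃L[ℂ] ℂ)
    {T T₁ : Current10 (⊤ : Opens E)} {R : ℝ}
    (h : restrict10 (nearInfinity E R) T = restrict10 (nearInfinity E R) T₁)
    (h₁ : T₁ ∈ Tempered10 ⊤) : T ∈ Tempered10 ⊤ := by
  have hD : SuppIn ((T - T₁) ∘L pullForm c) (c.symm ⁻¹' Metric.closedBall 0 R) := fun φ hφ => by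
    have := (restrict10_eq_restrict10_iff c _ T T₁).1 h φ
      (fun x hx => Set.disjoint_left.1 hφ hx)
    change T (pullForm c φ) - T₁ (pullForm c φ) = 0
    rw [this, sub_self]
  have hsub : c.symm ⁻¹' Metric.closedBall 0 R ⊆
      Metric.closedBall 0 (‖(c : E →L[ℂ] ℂ)‖ * R) := fun x hx => by
    rw [Set.mem_preimage, mem_closedBall_zero_iff] at hx
    rw [mem_closedBall_zero_iff]
    have := (c : E →L[ℂ] ℂ).le_opNorm (c.symm x)
    rw [ContinuousLinearEquiv.coe_coe, c.apply_symm_apply] at this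
    exact this.trans (by gcongr)
  have := add_mem (mem_tempered10_of_glueC c (hD.mono hsub).exists_glueC) h₁
  rwa [sub_add_cancel] at this

end Transport

/-! ### Holomorphic forms in a linear coordinate -/

noncomputable section Line

variable {V : Type*} [NormedAddCommGroup V] [NormedSpace ℂ V] [Fact (Module.finrank ℂ V = 1)]

open MeasureTheory

variable (V) in
/-- The linear coordinate attached to the basis vector of a complex line. -/
def lineCoord : V ≃L[ℂ] ℂ :=
  haveI : FiniteDimensional ℂ V :=
    Module.finite_of_finrank_eq_succ (Fact.out : Module.finrank ℂ V = 1)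
  ((lineBasis V).equivFun.trans (LinearEquiv.funUnique (Fin 1) ℂ ℂ)).toContinuousLinearEquiv

theorem lineCoord_symm_one : (lineCoord V).symm 1 = lineBasis V 0 := by
  rw [ContinuousLinearEquiv.symm_apply_eq]
  change _ = ((lineBasis V).equivFun (lineBasis V 0)) 0
  simp

variable [MeasurableSpace V] [BorelSpace V]

variable (V) in
theorem exists_formCurrent_eq_integral : ∃ k : ℂ, k ≠ 0 ∧
    ∀ (Ω : Opens V) (ω : V → StrongDual ℂ V), LocallyIntegrableOn ω (Ω : Set V)
      (Complex.basisOneI.smulTower (lineBasis V)).addHaar → ∀ χ : 𝓓(Ω, V →L⋆[ℂ] ℂ),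
      formCurrent Ω ω χ = k * ∫ x : ℂ, χ ((lineCoord V).symm x) ((lineCoord V).symm 1) *
        ω ((lineCoord V).symm x) ((lineCoord V).symm 1) := by
  set μ := (Complex.basisOneI.smulTower (lineBasis V)).addHaar with hμ
  set c := lineCoord V with hc
  have hemb : MeasurableEmbedding c := c.toHomeomorph.measurableEmbedding
  obtain ⟨k, hk0, hk⟩ : ∃ k : NNReal, k ≠ 0 ∧ μ.map c = k • (volume : Measure ℂ) := by
    refine ⟨_, (Measure.addHaarScalarFactor_pos_of_isAddHaarMeasure (μ.map c) volume).ne',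
      Measure.isAddLeftInvariant_eq_smul _ _⟩
  -- Conjugate-linearity of `φ` and linearity of `ω` turn `φ(ie) ω(e) - φ(e) ω(ie)` into `-2i φ(e)
  -- ω(e)`; `k` compares the two Haar measures.
  refine ⟨-(2 * Complex.I) * (k : ℝ), by simp [hk0], fun Ω ω hω χ => ?_⟩
  rw [formCurrent_apply hω]
  have h1 := hemb.integral_map (μ := μ)
    (fun x => wedge (lineBasis V 0) (χ (c.symm x)) (ω (c.symm x)))
  simp only [c.symm_apply_apply] at h1
  rw [← h1, hk, integral_smul_nnreal_measure, mul_assoc, ← integral_const_mul, NNReal.smul_def,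
    ← integral_smul, ← integral_const_mul]
  congr 1 with x
  rw [wedge_apply, lineCoord_symm_one, map_smulₛₗ, map_smul]
  simp only [Complex.conj_I, smul_eq_mul, Complex.real_smul]
  ring

end Line

/-! ### Extensions of holomorphic forms and the connecting maps of excision. -/

noncomputable section Excision

open MeasureTheory

section Thick

variable {V : Type*} [NormedAddCommGroup V]

theorem isOpen_add_ball (K : Compacts V) (ε : ℝ) : IsOpen ((K : Set V) + Metric.ball 0 ε) :=
  Metric.isOpen_ball.add_left

theorem subset_add_ball (K : Compacts V) {ε : ℝ} (hε : 0 < ε) :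
    (K : Set V) ⊆ (K : Set V) + Metric.ball 0 ε := fun x hx =>
  ⟨x, hx, 0, Metric.mem_ball_self hε, add_zero x⟩

theorem add_ball_subset_thick (K : Compacts V) (ε : ℝ) :
    (K : Set V) + Metric.ball 0 ε ⊆ (thick K ε : Set V) :=
  Set.add_subset_add_left Metric.ball_subset_closedBall

theorem subset_thick (K : Compacts V) {ε : ℝ} (hε : 0 < ε) : (K : Set V) ⊆ (thick K ε : Set V) :=
  (subset_add_ball K hε).trans (add_ball_subset_thick K ε)

theorem compl_thick_le (K : Compacts V) {ε : ℝ} (hε : 0 < ε) :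
    (thick K ε).compl ≤ complOpens K :=
  Set.compl_subset_compl.2 (subset_thick K hε)

/-- `K` is closed, so the sets `V ∖ K_ε` exhaust `V ∖ K`. -/
theorem exists_notMem_thick (K : Compacts V) {z : V} (hz : z ∉ K) :
    ∃ ε : Set.Ioi (0 : ℝ), z ∉ thick K ε := by
  obtain ⟨δ, hδ, h⟩ := Metric.isOpen_iff.1 K.isCompact.isClosed.isOpen_compl z hz
  refine ⟨⟨δ / 2, half_pos hδ⟩, ?_⟩
  rintro ⟨x, hx, y, hy, rfl⟩
  refine h ?_ hx
  rw [Metric.mem_ball, dist_comm, dist_eq_norm, add_sub_cancel_left]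
  have hy' : ‖y‖ ≤ δ / 2 := mem_closedBall_zero_iff.1 hy
  linarith

theorem eventually_nearInfinity_le_compl_thick (K : Compacts V) (ε : ℝ) :
    ∀ᶠ R in Filter.atTop, nearInfinity V R ≤ (thick K ε).compl := by
  obtain ⟨r, hr⟩ :=
    (K.isCompact.isBounded.add Metric.isBounded_closedBall).subset_closedBall (0 : V)
  filter_upwards [Filter.eventually_ge_atTop r] with R hR
  exact Set.compl_subset_compl.2
    ((show ((thick K ε : Set V)) ⊆ _ from hr).trans (Metric.closedBall_subset_closedBall hR))

theorem isCompact_thick [ProperSpace V] (K : Compacts V) (ε : ℝ) :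
    IsCompact (thick K ε : Set V) :=
  K.isCompact.add (isCompact_closedBall 0 ε)

theorem Tempered10.restrict [NormedSpace ℂ V] {T : Current10 (⊤ : Opens V)} (hT : T ∈ Tempered10 ⊤) (Ω : Opens V) :
    restrict10 Ω T ∈ Tempered10 Ω := by
  obtain ⟨T₀, S, hS, rfl⟩ := hT
  rw [restrict10_top]
  exact ⟨T₀, S, hS, rfl⟩

theorem H1.mk_eq_mk_iff [NormedSpace ℂ V] {Z : Closeds V} {u u' : Supported11 Z} :
    (Submodule.Quotient.mk u : H1 Z) = Submodule.Quotient.mk u' ↔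
      ∃ τ ∈ Supported10 Z, dbar ⊤ τ = u.1 - u'.1 := by
  rw [Submodule.Quotient.eq]
  constructor
  · rintro ⟨τ, hτ⟩
    exact ⟨τ.1, τ.2, congrArg Subtype.val hτ⟩
  · rintro ⟨τ, hτ, h⟩
    exact ⟨⟨τ, hτ⟩, Subtype.ext h⟩

/-- The product vanishes identically near `K`, so the behaviour of `ω` at the boundary of `K` plays
no role. -/
theorem continuous_cutoff_smul [NormedSpace ℂ V] {K : Compacts V} {ω : V → StrongDual ℂ V} {ε : ℝ}
    {ψ : V → ℝ} (hψ : Continuous ψ)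
    (hε : 0 < ε) (h0 : ∀ z ∈ thick K ε, ψ z = 0) (hω : ω ∈ HolForm (complOpens K)) :
    Continuous fun z => ψ z • ω z := by
  rw [continuous_iff_continuousAt]
  intro z
  by_cases hz : z ∈ K
  · refine (continuousAt_const (y := (0 : StrongDual ℂ V))).congr ?_
    filter_upwards [(isOpen_add_ball K ε).mem_nhds (subset_add_ball K hε hz)] with y hy
    rw [h0 y (add_ball_subset_thick K ε hy), zero_smul]
  · exact hψ.continuousAt.smul
      (hω.1.continuousOn.continuousAt ((complOpens K).isOpen.mem_nhds hz))

end Thick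

variable {V : Type*} [NormedAddCommGroup V] [NormedSpace ℂ V] [Fact (Module.finrank ℂ V = 1)]

variable (V) in
theorem properSpace_line : ProperSpace V := by
  have : FiniteDimensional ℝ V :=
    (Complex.basisOneI.smulTower (lineBasis V)).finiteDimensional_of_finite
  exact FiniteDimensional.proper_real V

/-- The coefficient of a `(1,0)`-form in the linear coordinate of a complex line. -/
def coeff (ω : V → StrongDual ℂ V) (x : ℂ) : ℂ := ω ((lineCoord V).symm x) ((lineCoord V).symm 1)

/-- The `(1,0)`-form on `Ω` with a given coefficient. -/
def ofCoeff (Ω : Opens V) (f : ℂ → ℂ) : V → StrongDual ℂ V :=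
  (Ω : Set V).indicator fun z => f (lineCoord V z) • (lineCoord V : V →L[ℂ] ℂ)

theorem coeff_ofCoeff {Ω : Opens V} {f : ℂ → ℂ} {x : ℂ} (hx : (lineCoord V).symm x ∈ Ω) :
    coeff (ofCoeff Ω f) x = f x := by
  rw [coeff, ofCoeff, Set.indicator_of_mem hx]
  change f _ * lineCoord V _ = _
  rw [ContinuousLinearEquiv.apply_symm_apply, ContinuousLinearEquiv.apply_symm_apply, mul_one]

theorem eq_of_coeff_eq {ω ω' : V → StrongDual ℂ V} {z : V}
    (h : coeff ω (lineCoord V z) = coeff ω' (lineCoord V z)) : ω z = ω' z := by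
  rw [coeff, coeff, ContinuousLinearEquiv.symm_apply_apply] at h
  ext v
  have hv : v = lineCoord V v • (lineCoord V).symm 1 := by
    rw [← map_smul, smul_eq_mul, mul_one, ContinuousLinearEquiv.symm_apply_apply]
  rw [hv, map_smul, map_smul, h]

theorem HolForm.differentiableOn_coeff {Ω : Opens V} {ω : V → StrongDual ℂ V}
    (hω : ω ∈ HolForm Ω) : DifferentiableOn ℂ (coeff ω) ((lineCoord V).symm ⁻¹' (Ω : Set V)) :=
  (hω.1.comp (lineCoord V).symm.differentiable.differentiableOn fun _ hx => hx).clm_apply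
    (differentiableOn_const _)

theorem ofCoeff_mem_holForm {Ω : Opens V} {f : ℂ → ℂ}
    (hf : DifferentiableOn ℂ f ((lineCoord V).symm ⁻¹' (Ω : Set V))) : ofCoeff Ω f ∈ HolForm Ω :=
  ⟨((hf.comp (lineCoord V).differentiable.differentiableOn fun z hz => by
      rwa [Set.mem_preimage, ContinuousLinearEquiv.symm_apply_apply]).smul_const _).congr
    fun z hz => Set.indicator_of_mem hz _, fun z hz => Set.indicator_of_notMem hz _⟩

theorem exists_cutoff_thick (K : Compacts V) {ε : ℝ} (hε : 0 < ε) : ∃ ψ : V → ℝ,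
    ContDiff ℝ (⊤ : ℕ∞) ψ ∧ (∀ z ∉ thick K ε, ψ z = 1) ∧ ∀ z ∈ thick K (ε / 2), ψ z = 0 := by
  have : FiniteDimensional ℝ V :=
    (Complex.basisOneI.smulTower (lineBasis V)).finiteDimensional_of_finite
  have := properSpace_line V
  obtain ⟨κ, hκ, -, hs, W, -, hW, h1⟩ := exists_cutoff (isCompact_thick K (ε / 2))
    (isOpen_add_ball K ε) (Set.add_subset_add_left
      (Metric.closedBall_subset_ball (half_lt_self hε)))
  refine ⟨fun z => 1 - κ z, contDiff_const.sub hκ, fun z hz => ?_, fun z hz => ?_⟩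
  · change 1 - κ z = 1
    rw [image_eq_zero_of_notMem_tsupport fun h => hz (add_ball_subset_thick K ε (hs h)), sub_zero]
  · change 1 - κ z = 0
    rw [h1 z (hW hz), sub_self]

variable [MeasurableSpace V] [BorelSpace V]

variable (V) in
/-- The constant relating the integral of `(1,1)`-forms on a line to the Lebesgue integral in the
linear coordinate. -/
def formConst : ℂ := (exists_formCurrent_eq_integral V).choose

variable (V) in
theorem formConst_ne_zero : formConst V ≠ 0 := (exists_formCurrent_eq_integral V).choose_spec.1

theorem formCurrent_eq_integral {Ω : Opens V} {ω : V → StrongDual ℂ V}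
    (hω : LocallyIntegrableOn ω (Ω : Set V) (Complex.basisOneI.smulTower (lineBasis V)).addHaar)
    (χ : 𝓓(Ω, V →L⋆[ℂ] ℂ)) : formCurrent Ω ω χ = formConst V *
      ∫ x : ℂ, χ ((lineCoord V).symm x) ((lineCoord V).symm 1) * coeff ω x :=
  (exists_formCurrent_eq_integral V).choose_spec.2 Ω ω hω χ

theorem restrict10_eq_formCurrent_iff {Ω : Opens V} {ω : V → StrongDual ℂ V}
    (hω : LocallyIntegrableOn ω (Ω : Set V) (Complex.basisOneI.smulTower (lineBasis V)).addHaar)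
    (T : Current10 (⊤ : Opens V)) : restrict10 Ω T = formCurrent Ω ω ↔
      ∀ φ : TestC, tsupport φ ⊆ (lineCoord V).symm ⁻¹' (Ω : Set V) →
        T (pullForm (lineCoord V) φ) = formConst V * ∫ x, φ x * coeff ω x := by
  constructor
  · intro h φ hφ
    obtain ⟨χ, hχ⟩ := exists_monoCLM_eq (Ω := Ω) (χ := pullForm (lineCoord V) φ)
      ((tsupport_pullForm_subset _ φ).trans fun z hz => by simpa using hφ hz)
    have h1 : ∀ x, χ ((lineCoord V).symm x) ((lineCoord V).symm 1) = φ x := fun x => by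
      rw [← coe_monoCLM_top, hχ, pullForm_apply]
      simp
    rw [← hχ]
    change restrict10 Ω T χ = _
    rw [h, formCurrent_eq_integral hω]
    simp only [h1]
  · intro h
    rw [restrict10_eq_iff (lineCoord V)]
    intro χ φ hφ hφχ
    rw [h φ hφ, formCurrent_eq_integral hω]
    simp only [hφχ]

theorem formCurrent_top_pullForm {ω : V → StrongDual ℂ V} (hω : Continuous ω) (φ : TestC) :
    formCurrent ⊤ ω (pullForm (lineCoord V) φ) = formConst V * ∫ x, φ x * coeff ω x := by
  have := properSpace_line V
  exact (restrict10_eq_formCurrent_iff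
    (hω.continuousOn.locallyIntegrableOn isOpen_univ.measurableSet) _).1 (restrict10_top _) φ
    (Set.subset_univ _)

/-- `η` is an extension of the form `ω` on the complement of `Z`. -/
def IsExtension (Z : Closeds V) (ω : V → StrongDual ℂ V) (η : Current10 (⊤ : Opens V)) : Prop :=
  restrict10 Z.compl η = formCurrent Z.compl ω

section IsExtension

variable {Ω : Opens V} {Z Z' : Closeds V} {ω ω' : V → StrongDual ℂ V}
  {η η' : Current10 (⊤ : Opens V)}

theorem isExtension_iff (hω : ω ∈ HolForm Ω) (hZ : Z.compl ≤ Ω) : IsExtension Z ω η ↔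
    ∀ φ : TestC, tsupport φ ⊆ (lineCoord V).symm ⁻¹' (Z.compl : Set V) →
      η (pullForm (lineCoord V) φ) = formConst V * ∫ x, φ x * coeff ω x :=
  restrict10_eq_formCurrent_iff (HolForm.locallyIntegrableOn hZ hω) η

theorem IsExtension.restrict10_eq (h : IsExtension Z ω η) (hω : ω ∈ HolForm Ω) (hZ : Z.compl ≤ Ω)
    {Ω' : Opens V} (hΩ' : Ω' ≤ Z.compl) : restrict10 Ω' η = formCurrent Ω' ω :=
  (restrict10_eq_formCurrent_iff (HolForm.locallyIntegrableOn (hΩ'.trans hZ) hω) η).2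
    fun φ hφ => (isExtension_iff hω hZ).1 h φ fun _ hx => hΩ' (hφ hx)

theorem IsExtension.mono (h : IsExtension Z ω η) (hω : ω ∈ HolForm Ω) (hZ : Z.compl ≤ Ω)
    (hZZ' : Z ≤ Z') : IsExtension Z' ω η :=
  h.restrict10_eq hω hZ (Set.compl_subset_compl.2 hZZ')

theorem IsExtension.add (h : IsExtension Z ω η) (h' : IsExtension Z ω' η') (hω : ω ∈ HolForm Ω)
    (hω' : ω' ∈ HolForm Ω) (hZ : Z.compl ≤ Ω) : IsExtension Z (ω + ω') (η + η') := by
  rw [IsExtension, map_add, h, h', formCurrent_add hω hω' hZ]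

theorem IsExtension.smul (h : IsExtension Z ω η) (c : ℂ) (hω : ω ∈ HolForm Ω)
    (hZ : Z.compl ≤ Ω) : IsExtension Z (c • ω) (c • η) := by
  rw [IsExtension, map_smul, h, formCurrent_smul c hω hZ]

/-- Off `Z` the current is a holomorphic form, and holomorphic functions are weak solutions of the
Cauchy-Riemann equation. -/
theorem IsExtension.restrict11_dbar_eq_zero (h : IsExtension Z ω η) (hω : ω ∈ HolForm Ω)
    (hZ : Z.compl ≤ Ω) : restrict11 Z.compl (dbar ⊤ η) = 0 := by
  rw [restrict11_eq_zero_iff (lineCoord V)]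
  intro φ hφ
  change η (dbarTest ⊤ (pull _ φ)) = 0
  rw [dbarTest_pull, (isExtension_iff hω hZ).1 h _ ((tsupport_dzbarTest_subset φ).trans hφ),
    integral_dzbarTest_mul_eq_zero (Z.compl.isOpen.preimage (lineCoord V).symm.continuous)
      ((HolForm.differentiableOn_coeff hω).mono (Set.preimage_mono hZ)) hφ, mul_zero]

end IsExtension

section Connecting

variable {K : Compacts V} {ω ω' : V → StrongDual ℂ V} {η η' : Current10 (⊤ : Opens V)} {ε ε' : ℝ}

/-- Near infinity `η` coincides with `ω`, which is tempered there; no growth condition along the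
boundary of `K` is needed. -/
theorem IsExtension.mem_tempered10 (h : IsExtension (thick K ε) ω η) (hε : 0 < ε)
    (hω : ω ∈ TemperedAtInftyHolForm K) : η ∈ Tempered10 ⊤ := by
  obtain ⟨R, hR, hR'⟩ := (hω.2.and (eventually_nearInfinity_le_compl_thick K ε)).exists
  obtain ⟨T, S, hTS, hT⟩ := hR
  refine mem_tempered10_of_restrict10_nearInfinity_eq (lineCoord V) (T₁ := T) (R := R) ?_
    ⟨T, S, hTS, restrict10_top T⟩
  rw [hT, h.restrict10_eq hω.1 (compl_thick_le K hε) hR']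

theorem IsExtension.dbar_mem_supported11 (h : IsExtension (thick K ε) ω η) (hε : 0 < ε)
    (hω : ω ∈ TemperedAtInftyHolForm K) : dbar ⊤ η ∈ Supported11 (thick K ε) :=
  ⟨dbar_mem_tempered11 (h.mem_tempered10 hε hω),
    h.restrict11_dbar_eq_zero hω.1 (compl_thick_le K hε)⟩

/-- The difference of two extensions is tempered and supported in `K_ε`, so its `∂̄` is a coboundary
with supports. -/
theorem IsExtension.mk_dbar_eq (h : IsExtension (thick K ε) ω η)
    (h' : IsExtension (thick K ε) ω η') (hε : 0 < ε) (hω : ω ∈ TemperedAtInftyHolForm K) :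
    (Submodule.Quotient.mk ⟨dbar ⊤ η, h.dbar_mem_supported11 hε hω⟩ : H1 (thick K ε)) =
      Submodule.Quotient.mk ⟨dbar ⊤ η', h'.dbar_mem_supported11 hε hω⟩ := by
  rw [H1.mk_eq_mk_iff]
  refine ⟨η - η', ⟨sub_mem (h.mem_tempered10 hε hω) (h'.mem_tempered10 hε hω), ?_⟩, map_sub _ _ _⟩
  rw [map_sub, h, h', sub_self]

theorem isExtension_cutoff {ψ : V → ℝ} (hψ : Continuous ψ) (hε : 0 < ε) (hε' : 0 < ε')
    (h1 : ∀ z ∉ thick K ε, ψ z = 1) (h0 : ∀ z ∈ thick K ε', ψ z = 0)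
    (hω : ω ∈ HolForm (complOpens K)) :
    IsExtension (thick K ε) ω (formCurrent ⊤ fun z => ψ z • ω z) := by
  rw [isExtension_iff hω (compl_thick_le K hε)]
  intro φ hφ
  rw [formCurrent_top_pullForm (continuous_cutoff_smul hψ hε' h0 hω)]
  congr 2 with x
  by_cases hx : x ∈ tsupport φ
  · rw [coeff, h1 _ (hφ hx), one_smul]; rfl
  · rw [image_eq_zero_of_notMem_tsupport hx, zero_mul, zero_mul]

theorem exists_isExtension (hω : ω ∈ HolForm (complOpens K)) (hε : 0 < ε) :
    ∃ η, IsExtension (thick K ε) ω η :=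
  let ⟨_, hψ, h1, h0⟩ := exists_cutoff_thick K hε
  ⟨_, isExtension_cutoff hψ.continuous hε (half_pos hε) h1 h0 hω⟩

variable (K) in
/-- The connecting map of the excision sequence of `K_ε`. -/
def connecting (ε : Set.Ioi (0 : ℝ)) : TemperedAtInftyHolForm K →ₗ[ℂ] H1 (thick K ε) where
  toFun ω := Submodule.Quotient.mk ⟨dbar ⊤ (exists_isExtension ω.2.1 ε.2).choose,
    (exists_isExtension ω.2.1 ε.2).choose_spec.dbar_mem_supported11 ε.2 ω.2⟩
  map_add' ω ω' := by
    rw [((exists_isExtension (ω + ω').2.1 ε.2).choose_spec).mk_dbar_eq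
      ((exists_isExtension ω.2.1 ε.2).choose_spec.add (exists_isExtension ω'.2.1 ε.2).choose_spec
        ω.2.1 ω'.2.1 (compl_thick_le K ε.2)) ε.2 (ω + ω').2]
    rfl
  map_smul' c ω := by
    rw [((exists_isExtension (c • ω).2.1 ε.2).choose_spec).mk_dbar_eq
      ((exists_isExtension ω.2.1 ε.2).choose_spec.smul c ω.2.1 (compl_thick_le K ε.2))
      ε.2 (c • ω).2]
    rfl

theorem connecting_eq (ε : Set.Ioi (0 : ℝ)) (ω : TemperedAtInftyHolForm K)
    (h : IsExtension (thick K ε) ω.1 η) : connecting K ε ω =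
      Submodule.Quotient.mk ⟨dbar ⊤ η, h.dbar_mem_supported11 ε.2 ω.2⟩ :=
  (exists_isExtension ω.2.1 ε.2).choose_spec.mk_dbar_eq h ε.2 ω.2

variable (K) in
/-- The connecting maps, as a map to the projective limit. -/
def connectingLim : TemperedAtInftyHolForm K →ₗ[ℂ] limH1 K :=
  (LinearMap.pi (connecting K)).codRestrict (limH1 K) fun ω ε ε' h => by
    obtain ⟨η, hη⟩ := exists_isExtension ω.2.1 ε.2
    rw [LinearMap.pi_apply, LinearMap.pi_apply, connecting_eq ε ω hη,
      connecting_eq ε' ω (hη.mono ω.2.1 (compl_thick_le K ε.2) (thick_mono K h))]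
    rfl

theorem connectingLim_apply (ω : TemperedAtInftyHolForm K) (ε : Set.Ioi (0 : ℝ)) :
    (connectingLim K ω).1 ε = connecting K ε ω := rfl

end Connecting

end Excision

/-! ### Kernel and image of the connecting map into the projective limit. -/

noncomputable section Isomorphism

open MeasureTheory

/-- Entire functions that agree off a compact set are equal. -/
theorem eq_of_eqOn_compl {F G : ℂ → ℂ} (hF : Differentiable ℂ F) (hG : Differentiable ℂ G)
    {L : Set ℂ} (hL : IsCompact L) (h : Set.EqOn F G Lᶜ) : F = G := by
  obtain ⟨x, hx⟩ : Lᶜ.Nonempty := by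
    rw [Set.nonempty_compl]
    rintro rfl
    exact noncompact_univ ℂ hL
  exact (hF.differentiableOn.analyticOnNhd isOpen_univ).eq_of_eventuallyEq
    (hG.differentiableOn.analyticOnNhd isOpen_univ)
    (h.eventuallyEq_of_mem (hL.isClosed.isOpen_compl.mem_nhds hx))

variable {V : Type*} [NormedAddCommGroup V] [NormedSpace ℂ V]

theorem HolForm.continuous {ω : V → StrongDual ℂ V} (hω : ω ∈ HolForm ⊤) : Continuous ω :=
  continuousOn_univ.1 hω.1.continuousOn

variable [Fact (Module.finrank ℂ V = 1)]

theorem isCompact_preimage_thick (K : Compacts V) (ε : ℝ) :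
    IsCompact ((lineCoord V).symm ⁻¹' (thick K ε : Set V)) := by
  have := properSpace_line V
  exact (lineCoord V).symm.toHomeomorph.isCompact_preimage.2 (isCompact_thick K ε)

theorem coeff_restrictForm {Ω : Opens V} {ω : V → StrongDual ℂ V} {x : ℂ}
    (hx : (lineCoord V).symm x ∈ Ω) : coeff (restrictForm Ω ω) x = coeff ω x := by
  rw [coeff, restrictForm]
  change (Ω : Set V).indicator ω _ _ = _
  rw [Set.indicator_of_mem hx]; rfl

/-- Holomorphic functions on the complements of the `K_ε` that agree where both are defined come
from a holomorphic form on the complement of `K`. -/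
theorem exists_holForm_of_compatible {K : Compacts V} {g : Set.Ioi (0 : ℝ) → ℂ → ℂ}
    (hg : ∀ ε, DifferentiableOn ℂ (g ε)
      ((lineCoord V).symm ⁻¹' ((thick K (ε : ℝ)).compl : Set V)))
    (hgg : ∀ ε ε' : Set.Ioi (0 : ℝ), (ε : ℝ) ≤ ε' →
      Set.EqOn (g ε) (g ε') ((lineCoord V).symm ⁻¹' ((thick K (ε' : ℝ)).compl : Set V))) :
    ∃ ω ∈ HolForm (complOpens K), ∀ ε : Set.Ioi (0 : ℝ),
      Set.EqOn (coeff ω) (g ε) ((lineCoord V).symm ⁻¹' ((thick K (ε : ℝ)).compl : Set V)) := by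
  have hgg' : ∀ (ε ε' : Set.Ioi (0 : ℝ)) (x : ℂ), (lineCoord V).symm x ∉ thick K (ε : ℝ) →
      (lineCoord V).symm x ∉ thick K (ε' : ℝ) → g ε x = g ε' x := fun ε ε' x h h' => by
    rcases le_total (ε : ℝ) ε' with hle | hle
    · exact hgg ε ε' hle h'
    · exact (hgg ε' ε hle h).symm
  have hex : ∀ x : ℂ, ∃ ε : Set.Ioi (0 : ℝ),
      (lineCoord V).symm x ∉ K → (lineCoord V).symm x ∉ thick K (ε : ℝ) := fun x => by
    by_cases hx : (lineCoord V).symm x ∈ K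
    · exact ⟨⟨1, Set.mem_Ioi.2 one_pos⟩, fun h => absurd hx h⟩
    · exact (exists_notMem_thick K hx).imp fun _ h _ => h
  choose e he using hex
  have hG : ∀ ε : Set.Ioi (0 : ℝ), Set.EqOn (fun x => g (e x) x) (g ε)
      ((lineCoord V).symm ⁻¹' ((thick K (ε : ℝ)).compl : Set V)) := fun ε x hx =>
    hgg' _ _ x (he x (compl_thick_le K ε.2 hx)) hx
  refine ⟨ofCoeff (complOpens K) fun x => g (e x) x, ofCoeff_mem_holForm fun x hx => ?_,
    fun ε x hx => ?_⟩
  · have hx' := he x hx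
    have hnhds := ((thick K (e x : ℝ)).compl.isOpen.preimage
      (lineCoord V).symm.continuous).mem_nhds (show x ∈ _ from hx')
    exact (((hg (e x)).differentiableAt hnhds).congr_of_eventuallyEq
      ((hG (e x)).eventuallyEq_of_mem hnhds)).differentiableWithinAt
  · rw [coeff_ofCoeff (compl_thick_le K ε.2 hx)]
    exact hG ε hx

variable [MeasurableSpace V] [BorelSpace V] {K : Compacts V}

theorem isExtension_restrictForm {ω : V → StrongDual ℂ V} (hω : ω ∈ HolForm ⊤) {ε : ℝ}
    (hε : 0 < ε) :
    IsExtension (thick K ε) (restrictForm (complOpens K) ω) (formCurrent ⊤ ω) := by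
  rw [isExtension_iff (restrictForm_mem_holForm (complOpens K) hω) (compl_thick_le K hε)]
  intro φ hφ
  rw [formCurrent_top_pullForm (HolForm.continuous hω)]
  congr 2 with x
  by_cases hx : x ∈ tsupport φ
  · rw [coeff_restrictForm (compl_thick_le K hε (hφ hx))]
  · rw [image_eq_zero_of_notMem_tsupport hx, zero_mul, zero_mul]

theorem dbar_formCurrent_eq_zero {ω : V → StrongDual ℂ V} (hω : ω ∈ HolForm ⊤) :
    dbar ⊤ (formCurrent ⊤ ω) = 0 := by
  ext χ
  rw [← pull_push (lineCoord V) χ]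
  change formCurrent ⊤ ω (dbarTest ⊤ (pull _ _)) = 0
  rw [dbarTest_pull, formCurrent_top_pullForm (HolForm.continuous hω),
    integral_dzbarTest_mul_eq_zero isOpen_univ (HolForm.differentiableOn_coeff hω)
      (Set.subset_univ _), mul_zero]

/-- An entire form is its own extension, and it is `∂̄`-closed. -/
theorem connectingLim_restrictTempered (ω : TemperedHolForm V) :
    connectingLim K (restrictTempered K ω) = 0 := by
  ext ε
  rw [connectingLim_apply, connecting_eq ε _ (isExtension_restrictForm ω.2.1 ε.2)]
  refine (Submodule.Quotient.mk_eq_zero _).2 ?_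
  refine ⟨0, ?_⟩
  rw [map_zero]
  exact Subtype.ext (dbar_formCurrent_eq_zero ω.2.1).symm

/-- A `∂̄`-closed extension of `ω` is an entire form. -/
theorem IsExtension.exists_entire {Ω : Opens V} {Z : Closeds V} {ω : V → StrongDual ℂ V}
    {T : Current10 (⊤ : Opens V)} (h : IsExtension Z ω T) (hω : ω ∈ HolForm Ω) (hZ : Z.compl ≤ Ω)
    (hT : dbar ⊤ T = 0) : ∃ F : ℂ → ℂ, Differentiable ℂ F ∧
      Set.EqOn F (coeff ω) ((lineCoord V).symm ⁻¹' (Z.compl : Set V)) ∧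
      T = formCurrent ⊤ (ofCoeff ⊤ F) := by
  obtain ⟨f, hf, hfT⟩ := exists_holomorphic_of_dzbar_eq_zero (T := T ∘L pullForm (lineCoord V))
    isOpen_univ fun φ _ => by
      rw [ContinuousLinearMap.comp_apply, ← dbarTest_pull]
      exact DFunLike.congr_fun hT _
  have hk := formConst_ne_zero V
  have hF : Differentiable ℂ fun x => (formConst V)⁻¹ * f x :=
    (differentiableOn_univ.1 hf).const_mul _
  have hint : ∀ φ : TestC, T (pullForm (lineCoord V) φ) =
      formConst V * ∫ x, φ x * ((formConst V)⁻¹ * f x) := fun φ => by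
    have := hfT φ (Set.subset_univ _)
    rw [ContinuousLinearMap.comp_apply] at this
    rw [this, ← integral_const_mul]
    congr 1 with x
    field_simp
  refine ⟨_, hF, eqOn_of_integral_eq (Z.compl.isOpen.preimage (lineCoord V).symm.continuous)
    hF.continuous.continuousOn
    ((HolForm.differentiableOn_coeff hω).mono (Set.preimage_mono hZ)).continuousOn
    fun φ hφ => ?_, ?_⟩
  · refine mul_left_cancel₀ hk ?_
    rw [← hint, (isExtension_iff hω hZ).1 h φ hφ]
  · have hmem : ofCoeff ⊤ (fun x => (formConst V)⁻¹ * f x) ∈ HolForm (⊤ : Opens V) :=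
      ofCoeff_mem_holForm hF.differentiableOn
    ext χ
    rw [← pullForm_pushForm (lineCoord V) χ, hint,
      formCurrent_top_pullForm (HolForm.continuous hmem)]
    congr 2 with x
    rw [coeff_ofCoeff (Ω := ⊤) trivial]

/-- For each `ε`, triviality of the class allows the extension to be corrected inside `K_ε` to a
`∂̄`-closed one, that is, to an entire tempered form. -/
theorem exists_restrictTempered_eq {ω : TemperedAtInftyHolForm K} (h : connectingLim K ω = 0) :
    ∃ ω₀, restrictTempered K ω₀ = ω := by
  have hex : ∀ ε : Set.Ioi (0 : ℝ), ∃ F : ℂ → ℂ, Differentiable ℂ F ∧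
      Set.EqOn F (coeff ω.1) ((lineCoord V).symm ⁻¹' ((thick K ε).compl : Set V)) ∧
      formCurrent ⊤ (ofCoeff (⊤ : Opens V) F) ∈ Tempered10 ⊤ := fun ε => by
    obtain ⟨η, hη⟩ := exists_isExtension ω.2.1 ε.2
    have h0 : connecting K ε ω = 0 := congrFun (congrArg Subtype.val h) ε
    rw [connecting_eq ε ω hη, ← Submodule.Quotient.mk_zero, H1.mk_eq_mk_iff] at h0
    obtain ⟨τ, hτ, hd⟩ := h0
    have hT : IsExtension (thick K ε) ω.1 (η - τ) := by
      rw [IsExtension, map_sub, hτ.2, sub_zero, hη]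
    obtain ⟨F, hF, hFω, hFT⟩ := hT.exists_entire ω.2.1 (compl_thick_le K ε.2) (by
      rw [map_sub, hd]; simp)
    exact ⟨F, hF, hFω, hFT ▸ hT.mem_tempered10 ε.2 ω.2⟩
  choose F hF hFω hFT using hex
  -- All these entire functions equal the coefficient of `ω` off a compact set, so one function
  -- serves for every `ε`.
  have heq : ∀ ε ε', F ε = F ε' := fun ε ε' =>
    eq_of_eqOn_compl (hF ε) (hF ε')
      ((isCompact_preimage_thick K ε).union (isCompact_preimage_thick K ε')) fun x hx =>
      (hFω ε fun h' => hx (Or.inl h')).trans (hFω ε' fun h' => hx (Or.inr h')).symm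
  let ε₁ : Set.Ioi (0 : ℝ) := ⟨1, Set.mem_Ioi.2 one_pos⟩
  have hmem : ofCoeff ⊤ (F ε₁) ∈ HolForm (⊤ : Opens V) :=
    ofCoeff_mem_holForm (hF ε₁).differentiableOn
  refine ⟨⟨ofCoeff ⊤ (F ε₁), hmem, hFT ε₁⟩, Subtype.ext (funext fun z => ?_)⟩
  change restrictForm (complOpens K) (ofCoeff ⊤ (F ε₁)) z = ω.1 z
  by_cases hz : z ∈ K
  · rw [ω.2.1.2 z fun h => h hz]
    exact Set.indicator_of_notMem (fun h' : z ∉ K => h' hz) _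
  · obtain ⟨ε, hε⟩ := exists_notMem_thick K hz
    refine eq_of_coeff_eq ?_
    rw [coeff_restrictForm (by rwa [ContinuousLinearEquiv.symm_apply_apply]),
      coeff_ofCoeff (Ω := ⊤) trivial, heq ε₁ ε]
    exact hFω ε (by rwa [Set.mem_preimage, ContinuousLinearEquiv.symm_apply_apply])

/-- A tempered `(1,1)`-form supported in `K_ε` has a tempered primitive, which is holomorphic off
`K_ε`, given by the Cauchy transform. -/
theorem exists_tempered_primitive {ε : ℝ} {u : Current11 (⊤ : Opens V)}
    (hu : u ∈ Supported11 (thick K ε)) {κ : TestC} {W : Set ℂ} (hW : IsOpen W)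
    (hKW : (lineCoord V).symm ⁻¹' (thick K ε : Set V) ⊆ W) (h1 : ∀ x ∈ W, κ x = 1) :
    ∃ η ∈ Tempered10 (⊤ : Opens V), dbar ⊤ η = u ∧
      (∀ φ, η (pullForm (lineCoord V) φ) = u (pull (lineCoord V) (cutTransform κ φ))) ∧
      ∃ g : ℂ → ℂ, DifferentiableOn ℂ g ((lineCoord V).symm ⁻¹' ((thick K ε).compl : Set V)) ∧
        ∀ φ : TestC, tsupport φ ⊆ (lineCoord V).symm ⁻¹' ((thick K ε).compl : Set V) →
          η (pullForm (lineCoord V) φ) = formConst V * ∫ x, φ x * g x := by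
  have hs := suppIn_of_restrict11_eq_zero (lineCoord V) hu.2
  set t := (u ∘L pull (lineCoord V)) ∘L cutTransform κ with ht
  have htη : ∀ φ, (t ∘L pushForm (lineCoord V)) (pullForm (lineCoord V) φ) = t φ := fun φ => by
    rw [ContinuousLinearMap.comp_apply, pushForm_pullForm]
  have htu : ∀ φ, t (dzbarTest φ) = u (pull (lineCoord V) φ) :=
    hs.cutTransform_dzbarTest hW hKW h1
  obtain ⟨f, hf, hft⟩ := exists_holomorphic_of_dzbar_eq_zero (T := t)
    ((thick K ε).compl.isOpen.preimage (lineCoord V).symm.continuous) fun φ hφ => by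
      rw [htu]
      exact (restrict11_eq_zero_iff (lineCoord V) _ u).1 hu.2 φ hφ
  refine ⟨t ∘L pushForm (lineCoord V), mem_tempered10_of_glueC (lineCoord V) ?_, ?_,
    fun φ => htη φ, fun x => (formConst V)⁻¹ * f x, hf.const_mul _, fun φ hφ => ?_⟩
  · obtain ⟨S, hS⟩ := hs.exists_glueC_cutTransform (isCompact_preimage_thick K ε) hW hKW h1
    refine ⟨S, ?_⟩
    convert hS using 1
    ext φ
    exact htη φ
  · ext χ
    rw [← pull_push (lineCoord V) χ]
    change (t ∘L pushForm (lineCoord V)) (dbarTest ⊤ (pull _ _)) = _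
    rw [dbarTest_pull, htη, htu]
  · rw [htη, hft φ hφ, ← integral_const_mul]
    have hk := formConst_ne_zero V
    congr 1 with x
    field_simp

/-- The Cauchy transforms of arbitrary representatives are compatible off the thickenings, so their
holomorphic parts glue to a form of which each Cauchy transform is an extension. -/
theorem connectingLim_surjective : Function.Surjective (connectingLim K) := by
  intro c
  have hrep : ∀ ε, ∃ u : Supported11 (thick K (ε : Set.Ioi (0 : ℝ))),
      Submodule.Quotient.mk u = c.1 ε := fun ε => Submodule.Quotient.mk_surjective _ _
  choose u hu using hrep
  have hcut : ∀ ε : Set.Ioi (0 : ℝ), ∃ (κ : TestC) (W : Set ℂ), IsOpen W ∧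
      (lineCoord V).symm ⁻¹' (thick K ε : Set V) ⊆ W ∧ ∀ x ∈ W, κ x = 1 := fun ε => by
    obtain ⟨κ, -, W, h⟩ := exists_test_cutoff (isCompact_preimage_thick K ε) isOpen_univ
      (Set.subset_univ _)
    exact ⟨κ, W, h⟩
  choose κ W hW hKW h1 using hcut
  choose η hηt hηd hηκ g hg hηg using fun ε =>
    exists_tempered_primitive (u ε).2 (hW ε) (hKW ε) (h1 ε)
  obtain ⟨ω, hω, hωg⟩ := exists_holForm_of_compatible hg fun ε ε' hle => by
    have hLL : (lineCoord V).symm ⁻¹' (thick K ε : Set V) ⊆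
      (lineCoord V).symm ⁻¹' (thick K ε' : Set V) := Set.preimage_mono (thick_mono K hle)
    refine eqOn_of_integral_eq ((thick K (ε' : ℝ)).compl.isOpen.preimage
      (lineCoord V).symm.continuous) ((hg ε).continuousOn.mono (Set.compl_subset_compl.2 hLL))
      (hg ε').continuousOn fun φ hφ => mul_left_cancel₀ (formConst_ne_zero V) ?_
    rw [← hηg ε φ (hφ.trans (Set.compl_subset_compl.2 hLL)), ← hηg ε' φ hφ, hηκ, hηκ]
    have hc := c.2 ε ε' hle
    rw [← hu ε, ← hu ε'] at hc
    obtain ⟨τ, hτ, hd⟩ := H1.mk_eq_mk_iff.1 hc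
    have hτs := suppIn_of_restrict10_eq_zero (lineCoord V) hτ.2
    -- The cutoff for `ε'` also works for `u ε`, as `K_ε ⊆ K_ε'`. With one common cutoff the two
    -- transforms differ on `φ` by `τ (∂̄(κ · Pφ)) = τ φ`, which is zero because `φ` is supported
    -- off `K_ε'`.
    have h2 := (suppIn_of_restrict11_eq_zero (lineCoord V) (u ε).2.2).cutTransform_congr (hW ε)
      (hKW ε) (h1 ε) (hW ε') (hLL.trans (hKW ε')) (h1 ε') φ
    have h3 := hτs.dzbarTest_cutTransform (hW ε') (hKW ε') (h1 ε') φ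
    have h4 : dbar ⊤ τ (pull (lineCoord V) (cutTransform (κ ε') φ)) =
        (u ε).1 (pull (lineCoord V) (cutTransform (κ ε') φ)) -
        (u ε').1 (pull (lineCoord V) (cutTransform (κ ε') φ)) := DFunLike.congr_fun hd _
    have h5 : dbar ⊤ τ (pull (lineCoord V) (cutTransform (κ ε') φ)) = 0 := by
      change τ (dbarTest ⊤ (pull _ _)) = 0
      rw [dbarTest_pull]
      refine h3.trans (hτs φ ?_)
      exact tsupport_subset_preimage_compl_iff.1 hφ
    rw [h5] at h4
    exact h2.trans (sub_eq_zero.1 h4.symm)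
  have hext : ∀ ε : Set.Ioi (0 : ℝ), IsExtension (thick K ε) ω (η ε) := fun ε => by
    rw [isExtension_iff hω (compl_thick_le K ε.2)]
    intro φ hφ
    rw [hηg ε φ hφ]
    congr 2 with x
    by_cases hx : x ∈ tsupport φ
    · rw [hωg ε (hφ hx)]
    · rw [image_eq_zero_of_notMem_tsupport hx, zero_mul, zero_mul]
  -- Any single `ε` will do: near infinity `ω` coincides with the tempered primitive `η ε₁`.
  let ε₁ : Set.Ioi (0 : ℝ) := ⟨1, Set.mem_Ioi.2 one_pos⟩
  have hωt : ω ∈ TemperedAtInftyHolForm K := by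
    refine ⟨hω, ?_⟩
    filter_upwards [eventually_nearInfinity_le_compl_thick K ε₁] with R hR
    rw [← (hext ε₁).restrict10_eq hω (compl_thick_le K ε₁.2) hR]
    exact Tempered10.restrict (hηt ε₁) _
  refine ⟨⟨ω, hωt⟩, Subtype.ext (funext fun ε => ?_)⟩
  rw [connectingLim_apply, connecting_eq ε ⟨ω, hωt⟩ (hext ε), ← hu ε]
  congr 1
  exact Subtype.ext (hηd ε)

variable (K) in
/-- The map to the projective limit induced by the connecting maps. -/
def connectingQuot : FormQuotient K →ₗ[ℂ] limH1 K :=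
  (LinearMap.pi fun ε => (LinearMap.range (restrictTempered K)).liftQ (connecting K ε)
    (by
      rintro _ ⟨ω₀, rfl⟩
      exact congrFun (congrArg Subtype.val (connectingLim_restrictTempered ω₀)) ε)).codRestrict
    (limH1 K) fun q => by
      obtain ⟨ω, rfl⟩ := Submodule.Quotient.mk_surjective _ q
      exact (connectingLim K ω).2

theorem connectingQuot_mk (ω : TemperedAtInftyHolForm K) :
    connectingQuot K (Submodule.Quotient.mk ω) = connectingLim K ω := rfl

theorem connectingQuot_injective : Function.Injective (connectingQuot K) := by
  intro q q' h
  obtain ⟨ω, rfl⟩ := Submodule.Quotient.mk_surjective _ q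
  obtain ⟨ω', rfl⟩ := Submodule.Quotient.mk_surjective _ q'
  rw [connectingQuot_mk, connectingQuot_mk] at h
  refine (Submodule.Quotient.eq _).2 (exists_restrictTempered_eq (Subtype.ext (funext fun ε => ?_)))
  have hε : connecting K ε ω = connecting K ε ω' := congrFun (congrArg Subtype.val h) ε
  rw [connectingLim_apply, map_sub, hε, sub_self]
  rfl

variable (K) in
/-- The isomorphism induced by the connecting maps. -/
def connectingEquiv : FormQuotient K ≃ₗ[ℂ] limH1 K :=
  LinearEquiv.ofBijective (connectingQuot K)
    ⟨connectingQuot_injective, fun c =>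
      let ⟨ω, hω⟩ := connectingLim_surjective c
      ⟨Submodule.Quotient.mk ω, hω⟩⟩

end Isomorphism

end TemperedForms

theorem corollary7p2 {V : Type*} [NormedAddCommGroup V] [NormedSpace ℂ V]
    [MeasurableSpace V] [BorelSpace V] [Fact (Module.finrank ℂ V = 1)]
    (K : Compacts V) (hne : (K : Set V).Nonempty) (hK : Convex ℝ (K : Set V)) :
    ∃! Φ : FormQuotient K ≃ₗ[ℂ] limH1 K,
      -- each component is induced by the connecting map of the excision triangle: the class of `ω`
      -- is sent to the class of `∂̄η`, for any tempered extension `η` to `V` of `ω|_{V ∖ K_ε}`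
      (∀ (ε : Set.Ioi (0 : ℝ)) (ω : TemperedAtInftyHolForm K),
        (∃ η ∈ Tempered10 (⊤ : Opens V),
          restrict10 (thick K ε).compl η = formCurrent (thick K ε).compl ω) ∧
        ∀ η ∈ Tempered10 (⊤ : Opens V),
          restrict10 (thick K ε).compl η = formCurrent (thick K ε).compl ω →
          ∃ hη : dbar ⊤ η ∈ Supported11 (thick K ε),
            (Φ (Submodule.Quotient.mk ω)).1 ε = Submodule.Quotient.mk ⟨dbar ⊤ η, hη⟩) ∧
      -- formula with a cutoff function
      (∀ (ε : Set.Ioi (0 : ℝ)) (ψ : V → ℝ), ContDiff ℝ (⊤ : ℕ∞) ψ →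
        (∀ z ∉ thick K ε, ψ z = 1) → (∀ z ∈ thick K (ε / 2), ψ z = 0) →
        ∀ ω : TemperedAtInftyHolForm K,
          ∃ hψ : dbar ⊤ (formCurrent ⊤ fun z => ψ z • ω.1 z) ∈ Supported11 (thick K ε),
            (Φ (Submodule.Quotient.mk ω)).1 ε =
              Submodule.Quotient.mk ⟨dbar ⊤ (formCurrent ⊤ fun z => ψ z • ω.1 z), hψ⟩) := by
  refine ⟨connectingEquiv K, ⟨fun ε ω => ⟨?_, fun η _ hη => ?_⟩, fun ε ψ hψ h1 h0 ω => ?_⟩, ?_⟩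
  · obtain ⟨η, hη⟩ := exists_isExtension ω.2.1 ε.2
    exact ⟨η, hη.mem_tempered10 ε.2 ω.2, hη⟩
  · exact ⟨IsExtension.dbar_mem_supported11 hη ε.2 ω.2, connecting_eq ε ω hη⟩
  · have hη := isExtension_cutoff hψ.continuous ε.2 (half_pos ε.2) h1 h0 ω.2.1
    exact ⟨hη.dbar_mem_supported11 ε.2 ω.2, connecting_eq ε ω hη⟩
  -- The first property alone determines `Φ`: an extension exists for each `ω` and `ε`, and it
  -- prescribes the component of the image in `H¹` of `K_ε`.
  · rintro Φ ⟨hΦ, -⟩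
    refine LinearEquiv.ext fun q => ?_
    obtain ⟨ω, rfl⟩ := Submodule.Quotient.mk_surjective _ q
    refine Subtype.ext (funext fun ε => ?_)
    obtain ⟨⟨η, hη, hηω⟩, h⟩ := hΦ ε ω
    obtain ⟨hd, hΦη⟩ := h η hη hηω
    rw [hΦη]
    exact (connecting_eq ε ω hηω).symm
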